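/- Let $\mathcal X$ be a nonempty finite set and let $r(x,y)\ge 0$, $x,y\in\mathcal X$, with $r(x,x)=0$, be jump rates that are irreducible (any state can be reached from any other one through jumps of positive rate). Let $(X_t)_{t\ge0}$ be the Markov jump process with rates $r$, with generator $\mathcal L f(x)=\sum_y r(x,y)[f(y)-f(x)]$ and unique invariant distribution $\pi$; write $\langle f,h\rangle=\sum_x\pi(x)f(x)h(x)$ (for real $f,h$) and $r^*(x,y)=\pi(y)r(y,x)/\pi(x)$. Let $T>0$ and let $g:\mathbb R\times\mathcal X\times\mathcal X\to\mathbb R$ be bounded, measurable and $T$-periodic in time. For $\lambda\in\mathbb R$ let $(X^\lambda_t)_{t\ge0}$ be the time-inhomogeneous Markov jump process with rates $r^\lambda(s,x,y)=e^{\lambda g(s,x,y)}r(x,y)$: a process arriving in $x$ at time $s$ is still waiting there at time $u$ with probability $\exp\{-\int_s^u\sum_y r^\lambda(\tau,x,y)\,d\tau\}$, and when it jumps, at time $u$, it jumps to $y$ with probability proportional to $r^\lambda(u,x,y)$. Both here and below $\mathbb E_\nu$ refers to the process with initial distribution $\nu$ at time $0$. The discrete-time chain $(X^\lambda_{nT})_{n\ge0}$,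 which has transition matrix $\mathbb P_x(X^\lambda_T=y)$, has exactly one invariant distribution $\pi_\lambda$; the perturbed process started from $\pi_\lambda$ is the oscillatory steady state. Put $$\psi_t(x)=\sum_{y}\big(r^*(x,y)\,g(t,y,x)-r(x,y)\,g(t,x,y)\big),\qquad \beta_r(s,x)=\sum_y\beta(s,x,y)\,r(x,y)$$ for functions $\beta(s,x,y)$. Then, for every $t\ge0$, the following derivatives at $\lambda=0$ exist, all expectations and integrals below are well defined (integrable), and: 1. For every $v:\mathcal X\to\mathbb R$, $$\partial_{\lambda=0}\mathbb E_{\pi_\lambda}[v(X^\lambda_t)]=\int_0^\infty\langle e^{s\mathcal L}v,\psi_{t-s}\rangle\,ds=\int_0^\infty\mathbb E_\pi[v(X_s)\psi_{t-s}(X_0)]\,ds .$$ 2. For every measurable $v:[0,t]\times\mathcal X\to\mathbb R$ with $\int_0^t|v(s,x)|\,ds<\infty$ for all $x$, $$\partial_{\lambda=0}\mathbb E_{\pi_\lambda}\Big[\int_0^tv(s,X^\lambda_s)\,ds\Big]=\int_0^tdu\int_0^\infty ds\,\langle e^{s\mathcal L}v(u,\cdot),\psi_{u-s}\rangle=\int_0^tdu\int_0^\infty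 ds\,\mathbb E_\pi[v(u,X_s)\psi_{u-s}(X_0)] .$$ 3. For every measurable $\alpha:[0,t]\times\mathcal X\times\mathcal X\to\mathbb R$ which is $\mathbb P_\pi$-integrable, i.e. satisfies $\mathbb E_\pi\big[\sum_{s\in(0,t]:X_{s-}\ne X_s}|\alpha(s,X_{s-},X_s)|\big]<\infty$ or $\mathbb E_\pi\big[\int_0^t|\alpha|_r(s,X_s)\,ds\big]<\infty$ (the two bounds are equivalent), $$\partial_{\lambda=0}\mathbb E_{\pi_\lambda}\Big[\sum_{s\in(0,t]:X^\lambda_{s-}\ne X^\lambda_s}\alpha(s,X^\lambda_{s-},X^\lambda_s)\Big]=\int_0^t\mathbb E_\pi[(\alpha g)_r(s,X_s)]\,ds+\int_0^tds\int_0^\infty du\,\mathbb E_\pi[\alpha_r(s,X_u)\,\psi_{s-u}(X_0)] .$$ -/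

import Mathlib

open MeasureTheory ProbabilityTheory Filter Topology
open scoped ENNReal

noncomputable section

namespace MarkovJump

/-! ### Time-inhomogeneous Markov jump processes on a finite set

Jump rates are functions `q : ℝ → 𝒳 → 𝒳 → ℝ`; `q s x y` is the rate at time `s` of the jump from `x`
to `y`, with `q s x x = 0`.  The process is built from its successive pairs (jump time, new state).
-/

section Construction

variable {𝒳 : Type*} [Fintype 𝒳]

/-- The total jump rate (holding time parameter) `r̂_s(x) = ∑_y q(s,x,y)`. -/
def exitRate (q : ℝ → 𝒳 → 𝒳 → ℝ) (s : ℝ) (x : 𝒳) : ℝ := ∑ y, q s x y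

/-- Probability `exp (-∫_s^u r̂_τ(x) dτ)` that a process which has arrived at `x` at time `s`
is still waiting there at time `u`. -/
def survival (q : ℝ → 𝒳 → 𝒳 → ℝ) (s u : ℝ) (x : 𝒳) : ℝ :=
  Real.exp (-∫ τ in s..u, exitRate q τ x)

/-- Joint density, with respect to Lebesgue measure times counting measure, of the time `u` and
the target `y` of the next jump of a process which has arrived at `x` at time `s`: the holding time
density `r̂_u(x) exp (-∫_s^u r̂_τ(x) dτ)` times the jump probability `q(u,x,y) / r̂_u(x)`. -/
def nextJumpDensity (q : ℝ → 𝒳 → 𝒳 → ℝ) (a b : ℝ × 𝒳) : ℝ≥0∞ :=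
  if a.1 < b.1 then ENNReal.ofReal (survival q a.1 b.1 a.2 * q b.1 a.2 b.2) else 0

theorem intervalIntegrable_exitRate {q : ℝ → 𝒳 → 𝒳 → ℝ} {C : ℝ}
    (hm : ∀ x y, Measurable fun s => q s x y)
    (hC : ∀ s x, |exitRate q s x| ≤ C) (x : 𝒳) (s u : ℝ) :
    IntervalIntegrable (fun τ => exitRate q τ x) volume s u := by
  have h1 : Measurable fun τ => exitRate q τ x := by
    unfold exitRate
    exact Finset.measurable_sum _ fun y _ => hm x y
  refine (intervalIntegrable_const (c := C)).mono_fun h1.aestronglyMeasurable ?_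
  filter_upwards with τ
  rw [Real.norm_eq_abs, Real.norm_eq_abs]
  exact (hC τ x).trans (le_abs_self C)

variable [MeasurableSpace 𝒳]

/-- Law of (time, target) of the next jump, given (time, target) of the previous one. -/
def nextJump (q : ℝ → 𝒳 → 𝒳 → ℝ) : Kernel (ℝ × 𝒳) (ℝ × 𝒳) :=
  (Kernel.const (ℝ × 𝒳) ((volume : Measure ℝ).prod (Measure.count : Measure 𝒳))).withDensity
    (nextJumpDensity q)

/-- For measurable rates whose total rates are bounded, the density of the next jump is
jointly measurable. -/
theorem measurable_nextJumpDensity [MeasurableSingletonClass 𝒳] {q : ℝ → 𝒳 → 𝒳 → ℝ} {C : ℝ}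
    (hm : ∀ x y, Measurable fun s => q s x y)
    (hC : ∀ s x, |exitRate q s x| ≤ C) :
    Measurable (Function.uncurry (nextJumpDensity q)) := by
  have hR : ∀ x, Continuous fun u => ∫ τ in (0 : ℝ)..u, exitRate q τ x := fun x =>
    intervalIntegral.continuous_primitive
      (fun a b => intervalIntegrable_exitRate hm hC x a b) 0
  have hq : Measurable fun p : 𝒳 × 𝒳 × ℝ => q p.2.2 p.1 p.2.1 :=
    measurable_from_prod_countable_right fun x =>
      measurable_from_prod_countable_right fun y => hm x y
  have hS : Measurable fun p : 𝒳 × ℝ => ∫ τ in (0 : ℝ)..p.2, exitRate q τ p.1 :=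
    measurable_from_prod_countable_right fun x => (hR x).measurable
  have hS' : Measurable fun p : (ℝ × 𝒳) × (ℝ × 𝒳) =>
      survival q p.1.1 p.2.1 p.1.2 := by
    unfold survival
    have : ∀ p : (ℝ × 𝒳) × (ℝ × 𝒳), (∫ τ in p.1.1..p.2.1, exitRate q τ p.1.2)
        = (∫ τ in (0 : ℝ)..p.2.1, exitRate q τ p.1.2)
          - ∫ τ in (0 : ℝ)..p.1.1, exitRate q τ p.1.2 := fun p =>
      (intervalIntegral.integral_interval_sub_left
        (intervalIntegrable_exitRate hm hC p.1.2 0 p.2.1)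
        (intervalIntegrable_exitRate hm hC p.1.2 0 p.1.1)).symm
    simp_rw [this]
    refine Real.measurable_exp.comp (Measurable.neg (Measurable.sub ?_ ?_))
    · exact hS.comp (f := fun p : (ℝ × 𝒳) × (ℝ × 𝒳) => (p.1.2, p.2.1)) (by fun_prop)
    · exact hS.comp (f := fun p : (ℝ × 𝒳) × (ℝ × 𝒳) => (p.1.2, p.1.1)) (by fun_prop)
  have hq' : Measurable fun p : (ℝ × 𝒳) × (ℝ × 𝒳) => q p.2.1 p.1.2 p.2.2 :=
    hq.comp (f := fun p : (ℝ × 𝒳) × (ℝ × 𝒳) => (p.1.2, p.2.2, p.2.1)) (by fun_prop)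
  refine Measurable.ite (measurableSet_lt (by fun_prop) (by fun_prop)) ?_ measurable_const
  exact (hS'.mul hq').ennreal_ofReal

/-- For nonnegative bounded measurable rates with total rate at `x` bounded away from zero, a next
jump from `x` takes place at a finite time almost surely. -/
theorem nextJump_univ [MeasurableSingletonClass 𝒳] {q : ℝ → 𝒳 → 𝒳 → ℝ} {c C : ℝ}
    (hc : 0 < c)
    (hm : ∀ x y, Measurable fun s => q s x y) (h0 : ∀ s x y, 0 ≤ q s x y)
    (hC : ∀ s x, |exitRate q s x| ≤ C) (x : 𝒳) (hx : ∀ s, c ≤ exitRate q s x) (s : ℝ) :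
    nextJump q (s, x) Set.univ = 1 := by
  have hmd := measurable_nextJumpDensity hm hC
  have hii := intervalIntegrable_exitRate hm hC x
  have he : Measurable fun τ => exitRate q τ x := by
    unfold exitRate
    exact Finset.measurable_sum _ fun y _ => hm x y
  have hC0 : 0 ≤ C := (abs_nonneg _).trans (hC 0 x)
  -- the survival function is Lipschitz to the right of `s`
  have hmono : ∀ a b, s ≤ a → a ≤ b →
      |survival q s b x - survival q s a x| ≤ C * (b - a) := by
    intro a b hsa hab
    have h1 : (∫ τ in s..b, exitRate q τ x)
        = (∫ τ in s..a, exitRate q τ x) + ∫ τ in a..b, exitRate q τ x :=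
      (intervalIntegral.integral_add_adjacent_intervals (hii s a) (hii a b)).symm
    have h2 : 0 ≤ ∫ τ in a..b, exitRate q τ x :=
      intervalIntegral.integral_nonneg hab fun u _ => hc.le.trans (hx u)
    have h3 : 0 ≤ ∫ τ in s..a, exitRate q τ x :=
      intervalIntegral.integral_nonneg hsa fun u _ => hc.le.trans (hx u)
    have h4 : (∫ τ in a..b, exitRate q τ x) ≤ C * (b - a) := by
      have := intervalIntegral.norm_integral_le_of_norm_le_const (a := a) (b := b)
        (f := fun τ => exitRate q τ x) (C := C) fun τ _ => hC τ x
      rw [abs_of_nonneg (sub_nonneg.2 hab)] at this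
      exact (le_abs_self _).trans this
    unfold survival
    rw [h1, neg_add, Real.exp_add]
    have h5 : Real.exp (-∫ τ in s..a, exitRate q τ x) ≤ 1 := Real.exp_le_one_iff.2 (by linarith)
    have h6 := Real.exp_pos (-∫ τ in s..a, exitRate q τ x)
    have h7 : Real.exp (-∫ τ in a..b, exitRate q τ x) ≤ 1 := Real.exp_le_one_iff.2 (by linarith)
    have h8 := Real.add_one_le_exp (-∫ τ in a..b, exitRate q τ x)
    rw [abs_le]
    constructor <;> nlinarith
  have hlip : ∀ b, s ≤ b →
      AbsolutelyContinuousOnInterval (fun u => survival q s u x) s b := by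
    intro b hb
    refine LipschitzOnWith.absolutelyContinuousOnInterval (K := C.toNNReal) ?_
    refine LipschitzOnWith.of_dist_le_mul ?_
    intro u hu v hv
    rw [Set.uIcc_of_le hb] at hu hv
    rw [Real.dist_eq, Real.dist_eq, Real.coe_toNNReal _ hC0]
    rcases le_total u v with h | h
    · have := hmono u v hu.1 h
      rwa [abs_sub_comm, abs_sub_comm u v, abs_of_nonneg (sub_nonneg.2 h)]
    · have := hmono v u hv.1 h
      rwa [abs_of_nonneg (sub_nonneg.2 h)]
  have hS0 : survival q s s x = 1 := by simp [survival]
  have hint : ∀ b, s ≤ b →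
      ∫ u in s..b, survival q s u x * exitRate q u x = 1 - survival q s b x := by
    intro b hb
    have h1 := (hlip b hb).integral_deriv_eq_sub
    rw [hS0] at h1
    have h2 : ∫ u in s..b, survival q s u x * exitRate q u x
        = ∫ u in s..b, -deriv (fun u => survival q s u x) u := by
      refine intervalIntegral.integral_congr_ae ?_
      filter_upwards [(hii s b).ae_hasDerivAt_integral] with u hu hub
      have h3 := hu (Set.uIoc_subset_uIcc hub) s (by simp)
      have h4 : HasDerivAt (fun u => survival q s u x)
          (Real.exp (-∫ τ in s..u, exitRate q τ x) * -exitRate q u x) u := h3.neg.exp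
      rw [h4.deriv]
      unfold survival
      ring
    rw [h2, intervalIntegral.integral_neg, h1]
    ring
  have hlim : Tendsto (fun b => survival q s b x) atTop (𝓝 0) := by
    refine Real.tendsto_exp_neg_atTop_nhds_zero.comp ?_
    refine tendsto_atTop_mono' atTop (f₁ := fun b => c * (b - s)) ?_ ?_
    · filter_upwards [eventually_ge_atTop s] with b hb
      have := intervalIntegral.integral_mono_on hb (intervalIntegrable_const (c := c)) (hii s b)
        fun u _ => hx u
      simp only [intervalIntegral.integral_const, smul_eq_mul] at this
      linarith
    · exact (tendsto_atTop_add_const_right _ (-s) tendsto_id).const_mul_atTop hc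
  have hSm : Measurable fun u => survival q s u x := by
    unfold survival
    exact Real.measurable_exp.comp
      (intervalIntegral.continuous_primitive hii s).measurable.neg
  have hnn : ∀ u, 0 ≤ survival q s u x * exitRate q u x := fun u =>
    mul_nonneg (Real.exp_pos _).le (hc.le.trans (hx u))
  have hlim' : Tendsto (fun b => ∫ u in s..b, ‖survival q s u x * exitRate q u x‖) atTop
      (𝓝 1) := by
    have : Tendsto (fun b => 1 - survival q s b x) atTop (𝓝 1) := by
      simpa using hlim.const_sub 1
    refine this.congr' ?_
    filter_upwards [eventually_ge_atTop s] with b hb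
    rw [← hint b hb]
    simp_rw [Real.norm_of_nonneg (hnn _)]
  have hIoi : IntegrableOn (fun u => survival q s u x * exitRate q u x) (Set.Ioi s) := by
    refine integrableOn_Ioi_of_intervalIntegral_norm_tendsto 1 s (fun b => ?_) tendsto_id hlim'
    have hb : IntervalIntegrable (fun u => survival q s u x * exitRate q u x) volume s b :=
      (hii s b).continuousOn_mul (Real.continuous_exp.comp
        (intervalIntegral.continuous_primitive hii s).neg).continuousOn
    exact hb.1
  have hval : ∫ u in Set.Ioi s, survival q s u x * exitRate q u x = 1 := by
    refine tendsto_nhds_unique (intervalIntegral_tendsto_integral_Ioi s hIoi tendsto_id) ?_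
    simpa [Real.norm_of_nonneg (hnn _)] using hlim'
  unfold nextJump
  rw [Kernel.withDensity_apply' _ hmd, Kernel.const_apply, Measure.restrict_univ,
    lintegral_prod (nextJumpDensity q (s, x)) (hmd.comp measurable_prodMk_left).aemeasurable]
  have h9 : ∀ u, ∫⁻ y, nextJumpDensity q (s, x) (u, y) ∂Measure.count
      = (Set.Ioi s).indicator
        (fun u => ENNReal.ofReal (survival q s u x * exitRate q u x)) u := by
    intro u
    rw [lintegral_count, tsum_fintype]
    by_cases h : s < u
    · simp only [nextJumpDensity, h, if_true, Set.mem_Ioi, Set.indicator_of_mem]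
      rw [← ENNReal.ofReal_sum_of_nonneg fun y _ => 
          mul_nonneg (show 0 ≤ survival q s u x from (Real.exp_pos _).le) (h0 u x y),
        exitRate, Finset.mul_sum]
    · simp [nextJumpDensity, h]
  simp_rw [h9]
  rw [lintegral_indicator measurableSet_Ioi,
    ← ofReal_integral_eq_lintegral_ofReal hIoi (Eventually.of_forall hnn), hval,
    ENNReal.ofReal_one]

/-- The points from which a next jump takes place almost surely in finite time. -/
def properPoints (q : ℝ → 𝒳 → 𝒳 → ℝ) : Set (ℝ × 𝒳) := {a | nextJump q a Set.univ = 1}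

theorem measurableSet_properPoints (q : ℝ → 𝒳 → 𝒳 → ℝ) : MeasurableSet (properPoints q) :=
  (nextJump q).measurable_coe MeasurableSet.univ (measurableSet_singleton 1)

open Classical in
/-- The transition kernel of the sequence of pairs (jump time, new state).  It is `nextJump q`,
except that a process in an absorbing state stays there forever, which is encoded by fictitious
jumps from that state to itself, one per unit of time. -/
def jumpStep (q : ℝ → 𝒳 → 𝒳 → ℝ) : Kernel (ℝ × 𝒳) (ℝ × 𝒳) :=
  Kernel.piecewise (measurableSet_properPoints q) (nextJump q)
    (Kernel.deterministic (fun a : ℝ × 𝒳 => (a.1 + 1, a.2)) (by fun_prop))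

instance (q : ℝ → 𝒳 → 𝒳 → ℝ) : IsMarkovKernel (jumpStep q) := by
  classical
  refine ⟨fun a => ⟨?_⟩⟩
  rw [jumpStep, Kernel.piecewise_apply']
  split_ifs with h
  · exact h
  · simp

/-- The law of the sequence `(0, x₀), (τ₁, x₁), (τ₂, x₂), …` of pairs (jump time, new state) of the
Markov jump process with jump rates `q` and initial distribution `ν`. -/
def jumpLaw (q : ℝ → 𝒳 → 𝒳 → ℝ) (ν : Measure 𝒳) : Measure (ℕ → ℝ × 𝒳) :=
  Kernel.trajMeasure (X := fun _ => ℝ × 𝒳) (ν.map fun x => ((0 : ℝ), x))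
    fun n => (jumpStep q).comap (fun h => h ⟨n, Finset.mem_Iic.2 le_rfl⟩) (by fun_prop)

/-- The path `t ↦ X_t` of the process: `X_t = x_n` for `τ_n ≤ t < τ_{n+1}`. (After a possible
explosion, an event of probability zero for bounded rates, the value is irrelevant.) -/
def path (ω : ℕ → ℝ × 𝒳) (t : ℝ) : 𝒳 := (ω (sInf {n : ℕ | t < (ω (n + 1)).1})).2

/-- The expectation `𝔼_ν[F(X)]` of a functional of the path of the Markov jump process with jump
rates `q` and initial distribution `ν`. -/
def expect (q : ℝ → 𝒳 → 𝒳 → ℝ) (ν : Measure 𝒳) (F : (ℝ → 𝒳) → ℝ) : ℝ :=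
  ∫ ω, F (path ω) ∂jumpLaw q ν

/-- The functional `F` of the path has finite expectation under the law of the Markov jump process
with jump rates `q` and initial distribution `ν`. -/
def HasExpect (q : ℝ → 𝒳 → 𝒳 → ℝ) (ν : Measure 𝒳) (F : (ℝ → 𝒳) → ℝ) : Prop :=
  Integrable (fun ω => F (path ω)) (jumpLaw q ν)

/-- The transition probability `P_t(x,y) = ℙ_x(X_t = y)`, the process starting at time `0`. -/
def transProb (q : ℝ → 𝒳 → 𝒳 → ℝ) (t : ℝ) (x y : 𝒳) : ℝ :=
  (jumpLaw q (Measure.dirac x)).real {ω | path ω t = y}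

/-- `μ` is a probability measure which is invariant for the transition matrix `P`. -/
def IsInvariantProb (P : 𝒳 → 𝒳 → ℝ) (μ : Measure 𝒳) : Prop :=
  IsProbabilityMeasure μ ∧ ∀ y, ∑ x, μ.real {x} * P x y = μ.real {y}

/-- `π` is an invariant distribution of the Markov jump process with time-independent
rates `r`. -/
def IsInvariantDistribution (r : 𝒳 → 𝒳 → ℝ) (π : Measure 𝒳) : Prop :=
  ∀ t : ℝ, 0 ≤ t → IsInvariantProb (transProb (fun _ => r) t) π

/-- The perturbed jump rates `r^λ(s,x,y) = e^{λ g(s,x,y)} r(x,y)`. -/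
def perturbedRate (r : 𝒳 → 𝒳 → ℝ) (g : ℝ → 𝒳 → 𝒳 → ℝ) (lam : ℝ) : ℝ → 𝒳 → 𝒳 → ℝ :=
  fun s x y => Real.exp (lam * g s x y) * r x y

/-- `μ` is the initial distribution of an oscillatory steady state of the `λ`-perturbed process: an
invariant distribution of the discrete-time Markov chain `(X^λ_{nT})_{n ≥ 0}`, whose transition
matrix is `ℙ_x(X^λ_T = y)`. -/
def IsOSS (r : 𝒳 → 𝒳 → ℝ) (g : ℝ → 𝒳 → 𝒳 → ℝ) (T lam : ℝ) (μ : Measure 𝒳) : Prop :=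
  IsInvariantProb (transProb (perturbedRate r g lam) T) μ

end Construction

/-! ### Jumps of a path -/

section Jumps

variable {𝒳 : Type*}

/-- The pairs `(s, a)` such that `0 < s ≤ t`, the path `ξ` has left limit `ξ_{s-} = a` at time `s`
(in the discrete topology), and `ξ_{s-} ≠ ξ_s`. -/
def jumps (ξ : ℝ → 𝒳) (t : ℝ) : Set (ℝ × 𝒳) :=
  {p | 0 < p.1 ∧ p.1 ≤ t ∧ (∀ᶠ u in 𝓝[<] p.1, ξ u = p.2) ∧ p.2 ≠ ξ p.1}

/-- The additive functional `∑_{s ∈ (0,t] : ξ_{s-} ≠ ξ_s} α(s, ξ_{s-}, ξ_s)`. -/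
def jumpSum (α : ℝ → 𝒳 → 𝒳 → ℝ) (t : ℝ) (ξ : ℝ → 𝒳) : ℝ :=
  ∑' p : jumps ξ t, α p.1.1 p.1.2 (ξ p.1.1)

/-- The sum `∑_{s ∈ (0,t] : ξ_{s-} ≠ ξ_s} |α(s, ξ_{s-}, ξ_s)|`, with values in `[0,∞]`. -/
def jumpSumAbs (α : ℝ → 𝒳 → 𝒳 → ℝ) (t : ℝ) (ξ : ℝ → 𝒳) : ℝ≥0∞ :=
  ∑' p : jumps ξ t, ENNReal.ofReal |α p.1.1 p.1.2 (ξ p.1.1)|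

end Jumps

/-! ### Objects attached to the unperturbed process -/

section Unperturbed

variable {𝒳 : Type*} [Fintype 𝒳]

/-- The contraction `α_r(s,x) = ∑_y α(s,x,y) r(x,y)`. -/
def contract (r : 𝒳 → 𝒳 → ℝ) (α : ℝ → 𝒳 → 𝒳 → ℝ) (s : ℝ) (x : 𝒳) : ℝ :=
  ∑ y, α s x y * r x y

/-- The Markov generator `𝓛 f(x) = ∑_y r(x,y) (f(y) - f(x))` of the unperturbed process. -/
def generator (r : 𝒳 → 𝒳 → ℝ) : (𝒳 → ℝ) →L[ℝ] (𝒳 → ℝ) :=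
  LinearMap.toContinuousLinearMap
    { toFun := fun f x => ∑ y, r x y * (f y - f x)
      map_add' := fun f h => by
        ext x
        simp only [Pi.add_apply, ← Finset.sum_add_distrib]
        exact Finset.sum_congr rfl fun y _ => by ring
      map_smul' := fun c f => by
        ext x
        simp only [Pi.smul_apply, smul_eq_mul, RingHom.id_apply, Finset.mul_sum]
        exact Finset.sum_congr rfl fun y _ => by ring }

/-- The semigroup `e^{s𝓛}`. -/
def semigroup (r : 𝒳 → 𝒳 → ℝ) (s : ℝ) : (𝒳 → ℝ) →L[ℝ] (𝒳 → ℝ) :=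
  NormedSpace.exp (s • generator r)

variable [MeasurableSpace 𝒳]

/-- The scalar product `⟨f,h⟩ = ∑_x π(x) f(x) h(x)` of `L²(π)`, on real functions. -/
def scalarProd (π : Measure 𝒳) (f h : 𝒳 → ℝ) : ℝ := ∑ x, π.real {x} * (f x * h x)

/-- The rates `r*(x,y) = π(y) r(y,x) / π(x)` of the stationary time-reversed process. -/
def reversedRate (r : 𝒳 → 𝒳 → ℝ) (π : Measure 𝒳) (x y : 𝒳) : ℝ :=
  π.real {y} * r y x / π.real {x}

/-- The function `ψ_t(x) = ∑_y (r*(x,y) g(t,y,x) - r(x,y) g(t,x,y))`. -/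
def psi (r : 𝒳 → 𝒳 → ℝ) (π : Measure 𝒳) (g : ℝ → 𝒳 → 𝒳 → ℝ) (t : ℝ) (x : 𝒳) : ℝ :=
  ∑ y, (reversedRate r π x y * g t y x - r x y * g t x y)

/-- `α` is `ℙ_π`-integrable on `[0,t]`: one of the two equivalent bounds
`𝔼_π[∑_{s ∈ (0,t]} |α(s, X_{s-}, X_s)|] < ∞` and `𝔼_π[∫_0^t |α|_r(s, X_s) ds] < ∞` holds. -/
def IsPathIntegrable (r : 𝒳 → 𝒳 → ℝ) (π : Measure 𝒳) (t : ℝ) (α : ℝ → 𝒳 → 𝒳 → ℝ) : Prop :=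
  (∫⁻ ω, jumpSumAbs α t (path ω) ∂jumpLaw (fun _ => r) π) < ∞ ∨
  (∫⁻ ω, (∫⁻ s in Set.Ioc (0 : ℝ) t,
    ENNReal.ofReal (contract r (fun s x y => |α s x y|) s (path ω s))) ∂jumpLaw (fun _ => r) π) < ∞

end Unperturbed

end MarkovJump

end

open MarkovJump

set_option linter.unusedSectionVars false

/-! The proof passes from paths to one-time marginals and then studies the Kolmogorov forward
equation.

The link is the compensator formula. The density of the next jump is survival probability times
rate, so the expected sum of `α` over the jumps in `(0,t]` equals the expected time integral of `∑
y, q u X_u y * α u X_u y` (`IsAdmissible.lintegral_tsum_jumps`). Its version for sums over all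
steps, taken with `α = 1`, rules out explosion. With `α = f(y) - f(x)` the sum over the jumps
telescopes and gives the forward equation.

Let `p` be the marginals of the perturbed process, `A_u` its generator and `L` the unperturbed one.
Duhamel's formula reads `p_t(f) = p_0(e^{tL} f) + ∫_0^t p_u((A_u - L) e^{(t-u)L} f) du`. In the
oscillatory steady state `p` is `T`-periodic, so `t` may be replaced on the right by `t + nT` with
`n → ∞`. The transition matrix of the unperturbed process at time one has positive entries, hence
`e^{tL}` shrinks oscillations exponentially. The initial term therefore tends to `π(f)`, and the
integral is controlled uniformly in `n`. A first pass yields `p_t(f) - π(f) = O(λ)`. In a second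
pass `p_u` is replaced by `π` and `A_u - L` by its part linear in `λ`, each at cost `O(λ²)`. What
remains is `λ ∫_0^∞ ⟨e^{sL} f, ψ_{t-s}⟩ ds`, because `⟨h, ψ_u⟩` is the `π`-mean of the linearised
generator applied to `h` (`scalarProd_psi`). The derivative of `π_λ` is never computed separately.

These errors are uniform in `t ≥ 0` and linear in the supremum of `f` (`exists_response_bound`), so
they can be integrated against merely integrable functions of time, which gives the second formula.
For the third, the compensator formula expresses the expectation through `p_s` and `α e^{λg} r`. By
the product rule, differentiating the rates gives the `αg` term and differentiating `p_s` gives the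
response term. -/

namespace MarkovJump

/-! ### Paths with locally finitely many jumps -/

section Paths

variable {𝒳 : Type*}

/-- The sequence of (jump time, state) pairs starts at time `0`, has strictly increasing times and
does not explode. -/
structure IsRegularSeq (ω : ℕ → ℝ × 𝒳) : Prop where
  zero : (ω 0).1 = 0
  lt_succ : ∀ n, (ω n).1 < (ω (n + 1)).1
  unbounded : ∀ k : ℕ, ∃ n, (k : ℝ) < (ω (n + 1)).1

namespace IsRegularSeq

variable {ω : ℕ → ℝ × 𝒳} (h : IsRegularSeq ω)
include h

theorem strictMono : StrictMono fun n => (ω n).1 := strictMono_nat_of_lt_succ h.lt_succ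

theorem path_eq {n : ℕ} {t : ℝ} (h1 : (ω n).1 ≤ t) (h2 : t < (ω (n + 1)).1) :
    path ω t = (ω n).2 := by
  have : sInf {n : ℕ | t < (ω (n + 1)).1} = n := by
    refine le_antisymm (Nat.sInf_le h2) (le_csInf ⟨n, h2⟩ fun m hm => ?_)
    by_contra hlt
    have : (ω (m + 1)).1 ≤ (ω n).1 := h.strictMono.monotone (by omega)
    exact absurd hm (not_lt.2 (this.trans h1))
  rw [path, this]

theorem path_zero : path ω 0 = (ω 0).2 :=
  h.path_eq h.zero.le (by have := h.lt_succ 0; rwa [h.zero] at this)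

theorem exists_index {t : ℝ} (ht : 0 ≤ t) : ∃ n, (ω n).1 ≤ t ∧ t < (ω (n + 1)).1 := by
  classical
  have hex : ∃ n, t < (ω (n + 1)).1 := by
    obtain ⟨k, hk⟩ := exists_nat_gt t
    obtain ⟨n, hn⟩ := h.unbounded k
    exact ⟨n, hk.trans hn⟩
  refine ⟨Nat.find hex, ?_, Nat.find_spec hex⟩
  rcases Nat.eq_zero_or_eq_succ_pred (Nat.find hex) with h0 | h0
  · rw [h0, h.zero]; exact ht
  · have := Nat.find_min hex (m := (Nat.find hex).pred) (by omega)
    rw [h0]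
    exact not_lt.1 this

theorem le_iff {n m : ℕ} {t : ℝ} (h1 : (ω n).1 ≤ t) (h2 : t < (ω (n + 1)).1) :
    (ω m).1 ≤ t ↔ m ≤ n := by
  constructor
  · intro hm
    have := h.strictMono.lt_iff_lt.1 (hm.trans_lt h2)
    omega
  · intro hm
    exact (h.strictMono.monotone hm).trans h1

theorem eq_index {n m : ℕ} {t : ℝ} (h1 : (ω n).1 ≤ t) (h2 : t < (ω (n + 1)).1)
    (h3 : (ω m).1 ≤ t) (h4 : t < (ω (m + 1)).1) : m = n :=
  le_antisymm ((h.le_iff h1 h2).1 h3) ((h.le_iff h3 h4).1 h1)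

theorem eventually_path_left (n : ℕ) : ∀ᶠ u in 𝓝[<] (ω (n + 1)).1, path ω u = (ω n).2 := by
  filter_upwards [Ioo_mem_nhdsLT (h.lt_succ n)] with u hu
  exact h.path_eq hu.1.le hu.2

theorem path_jump (n : ℕ) : path ω (ω (n + 1)).1 = (ω (n + 1)).2 :=
  h.path_eq le_rfl (h.lt_succ (n + 1))

/-- The punctured left neighbourhood filter is nontrivial, so two values taken eventually to the
left of a point coincide and the left limit is determined. The condition `hne` excludes listed times
at which the state does not change. -/
theorem mem_jumps_iff (hne : ∀ n, (ω n).2 ≠ (ω (n + 1)).2) {t : ℝ} {p : ℝ × 𝒳} :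
    p ∈ jumps (path ω) t ↔ ∃ n, (ω (n + 1)).1 ≤ t ∧ ((ω (n + 1)).1, (ω n).2) = p := by
  constructor
  · rintro ⟨h0, ht, hl, hn⟩
    obtain ⟨n, h1, h2⟩ := h.exists_index h0.le
    rw [h.path_eq h1 h2] at hn
    rcases h1.eq_or_lt with h3 | h3
    · cases n with
      | zero => rw [h.zero] at h3; exact absurd h3 h0.ne
      | succ m =>
        refine ⟨m, h3 ▸ ht, ?_⟩
        have h4 := h.eventually_path_left m
        rw [h3] at h4
        obtain ⟨u, hu1, hu2⟩ := (h4.and hl).exists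
        exact Prod.ext h3 (hu1.symm.trans hu2)
    · exfalso
      have h4 : ∀ᶠ u in 𝓝[<] p.1, path ω u = (ω n).2 := by
        filter_upwards [Ioo_mem_nhdsLT h3] with u hu
        exact h.path_eq hu.1.le (hu.2.trans h2)
      obtain ⟨u, hu1, hu2⟩ := (h4.and hl).exists
      exact hn (hu2.symm.trans hu1)
  · rintro ⟨n, hn, rfl⟩
    refine ⟨?_, hn, h.eventually_path_left n, ?_⟩
    · have := h.strictMono (Nat.succ_pos n)
      simpa [h.zero] using this
    · simp only [h.path_jump]
      exact hne n

/-- Only the first `N` jump times lie in `(0,t]`, so the sum is finite and no summability is needed.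
The target `M` is general because both real and `ℝ≥0∞`-valued sums are used. -/
theorem tsum_jumps (hne : ∀ n, (ω n).2 ≠ (ω (n + 1)).2) {M : Type*} [AddCommMonoid M]
    [TopologicalSpace M] (F : ℝ → 𝒳 → 𝒳 → M) {t : ℝ} {N : ℕ}
    (h1 : (ω N).1 ≤ t) (h2 : t < (ω (N + 1)).1) :
    ∑' p : jumps (path ω) t, F p.1.1 p.1.2 (path ω p.1.1)
      = ∑ n ∈ Finset.range N, F (ω (n + 1)).1 (ω n).2 (ω (n + 1)).2 := by
  have hi : ∀ n, (ω (n + 1)).1 ≤ t ↔ n ∈ Finset.range N := fun n => by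
    rw [h.le_iff h1 h2, Finset.mem_range, Nat.succ_le_iff]
  let e : (Finset.range N) ≃ jumps (path ω) t := Equiv.ofBijective
    (fun n => ⟨((ω (n.1 + 1)).1, (ω n.1).2), (h.mem_jumps_iff hne).2 ⟨n.1, (hi n.1).2 n.2, rfl⟩⟩)
    ⟨fun n m hnm => by
      have h3 := congrArg (fun p => p.1.1) hnm
      have h4 := h.strictMono.injective h3
      exact Subtype.ext (by omega), fun p => by
      obtain ⟨n, hn, hp⟩ := (h.mem_jumps_iff hne).1 p.2
      exact ⟨⟨n, (hi n).1 hn⟩, Subtype.ext hp⟩⟩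
  rw [← e.tsum_eq, tsum_fintype, ← Finset.sum_coe_sort (Finset.range N)]
  refine Finset.sum_congr rfl fun n _ => ?_
  change F _ _ (path ω (ω (n.1 + 1)).1) = _
  rw [h.path_jump]
  rfl

end IsRegularSeq

/-- This disposes of the one-point state space, where the sequence consists of fictitious self-jumps
and no positive lower bound on the rates is available. -/
theorem jumps_eq_empty [Subsingleton 𝒳] (ξ : ℝ → 𝒳) (t : ℝ) : jumps ξ t = ∅ := by
  ext p
  simp only [jumps, Set.mem_ofPred_eq, Set.mem_empty_iff_false, iff_false]
  rintro ⟨-, -, -, h⟩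
  exact h (Subsingleton.elim _ _)

end Paths

/-! ### Joint measurability of the path in the sequence and in time -/

section Measurability

variable {𝒳 : Type*} [MeasurableSpace 𝒳]

theorem measurable_path : Measurable fun p : (ℕ → ℝ × 𝒳) × ℝ => path p.1 p.2 := by
  have hN : Measurable fun p : (ℕ → ℝ × 𝒳) × ℝ => sInf {n : ℕ | p.2 < (p.1 (n + 1)).1} := by
    refine measurable_to_countable' fun k => ?_
    have hs : ∀ n : ℕ, MeasurableSet {p : (ℕ → ℝ × 𝒳) × ℝ | p.2 < (p.1 (n + 1)).1} := fun n =>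
      measurableSet_lt (by fun_prop) (by fun_prop)
    have hle : ∀ k : ℕ, MeasurableSet
        {p : (ℕ → ℝ × 𝒳) × ℝ | sInf {n : ℕ | p.2 < (p.1 (n + 1)).1} ≤ k} := by
      intro k
      -- The second part of the union collects the points for which no index qualifies: there `sInf
      -- ∅ = 0` in `ℕ`, which is at most `k`.
      have : {p : (ℕ → ℝ × 𝒳) × ℝ | sInf {n : ℕ | p.2 < (p.1 (n + 1)).1} ≤ k}
          = (⋃ n : ℕ, ⋃ (_ : n ≤ k), {p | p.2 < (p.1 (n + 1)).1})
            ∪ ⋂ n : ℕ, {p | p.2 < (p.1 (n + 1)).1}ᶜ := by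
        ext p
        simp only [Set.mem_ofPred_eq, Set.mem_union, Set.mem_iUnion, Set.mem_iInter,
          Set.mem_compl_iff, exists_prop]
        constructor
        · intro h
          by_cases he : ∃ n : ℕ, p.2 < (p.1 (n + 1)).1
          · exact Or.inl ⟨_, h, Nat.sInf_mem he⟩
          · exact Or.inr fun n hn => he ⟨n, hn⟩
        · rintro (⟨n, hn, hp⟩ | h)
          · exact (Nat.sInf_le hp).trans hn
          · have : {n : ℕ | p.2 < (p.1 (n + 1)).1} = ∅ := by
              ext n; simpa using h n
            rw [this, Nat.sInf_empty]
            exact Nat.zero_le k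
      rw [this]
      exact (MeasurableSet.iUnion fun n => MeasurableSet.iUnion fun _ => hs n).union
        (MeasurableSet.iInter fun n => (hs n).compl)
    exact (measurable_of_Iic hle) (measurableSet_singleton k)
  have hev : Measurable fun z : ((ℕ → ℝ × 𝒳) × ℝ) × ℕ => (z.1.1 z.2).2 :=
    measurable_from_prod_countable_left fun n =>
      measurable_snd.comp ((measurable_pi_apply n).comp measurable_fst)
  exact hev.comp (measurable_id.prodMk hN)

theorem measurable_path_apply (t : ℝ) : Measurable fun ω : ℕ → ℝ × 𝒳 => path ω t :=
  measurable_path.comp measurable_prodMk_right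

end Measurability

/-! ### The law of the jump sequence -/

section Admissible

variable {𝒳 : Type*} [Fintype 𝒳]

/-- Bounded measurable jump rates; unless there is only one state, the total rate of each state is
bounded away from zero. -/
structure IsAdmissible (q : ℝ → 𝒳 → 𝒳 → ℝ) (C : ℝ) : Prop where
  measurable : ∀ x y, Measurable fun s => q s x y
  nonneg : ∀ s x y, 0 ≤ q s x y
  diag : ∀ s x, q s x x = 0
  exitRate_le : ∀ s x, exitRate q s x ≤ C
  subsingleton_or : Subsingleton 𝒳 ∨ ∃ c, 0 < c ∧ ∀ s x, c ≤ exitRate q s x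

namespace IsAdmissible

variable {q : ℝ → 𝒳 → 𝒳 → ℝ} {C : ℝ} (hq : IsAdmissible q C)
include hq

theorem abs_exitRate_le (s : ℝ) (x : 𝒳) : |exitRate q s x| ≤ C := by
  rw [exitRate, abs_of_nonneg (Finset.sum_nonneg fun y _ => hq.nonneg s x y)]
  exact hq.exitRate_le s x

theorem le_bound (s : ℝ) (x y : 𝒳) : q s x y ≤ C :=
  (Finset.single_le_sum (fun y _ => hq.nonneg s x y) (Finset.mem_univ y)).trans
    (hq.exitRate_le s x)

theorem eq_zero [Subsingleton 𝒳] (s : ℝ) (x y : 𝒳) : q s x y = 0 := by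
  rw [Subsingleton.elim y x, hq.diag]

end IsAdmissible

end Admissible

section Law

variable {𝒳 : Type*} [Fintype 𝒳] [MeasurableSpace 𝒳]

instance isProbabilityMeasure_jumpLaw (q : ℝ → 𝒳 → 𝒳 → ℝ) (ν : Measure 𝒳)
    [IsProbabilityMeasure ν] : IsProbabilityMeasure (jumpLaw q ν) := by
  have : IsProbabilityMeasure (ν.map fun x => ((0 : ℝ), x)) :=
    Measure.isProbabilityMeasure_map (by fun_prop)
  unfold jumpLaw
  infer_instance

/-- The Markov property of the jump sequence: the kernel that extends the history up to step `n`
depends only on its last entry. -/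
theorem lintegral_jumpLaw_succ (q : ℝ → 𝒳 → 𝒳 → ℝ) (ν : Measure 𝒳) [IsProbabilityMeasure ν]
    (n : ℕ) {F : ℝ × 𝒳 → ℝ × 𝒳 → ℝ≥0∞} (hF : Measurable (Function.uncurry F)) :
    ∫⁻ ω, F (ω n) (ω (n + 1)) ∂jumpLaw q ν
      = ∫⁻ ω, ∫⁻ b, F (ω n) b ∂jumpStep q (ω n) ∂jumpLaw q ν := by
  have : IsProbabilityMeasure (ν.map fun x => ((0 : ℝ), x)) :=
    Measure.isProbabilityMeasure_map (by fun_prop)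
  have key := Kernel.map_frestrictLe_trajMeasure_compProd_eq_map_trajMeasure
    (X := fun _ => ℝ × 𝒳) (μ₀ := ν.map fun x => ((0 : ℝ), x))
    (κ := fun n => (jumpStep q).comap (fun h => h ⟨n, Finset.mem_Iic.2 le_rfl⟩) (by fun_prop))
    (a := n)
  let G : ((i : Finset.Iic n) → ℝ × 𝒳) × (ℝ × 𝒳) → ℝ≥0∞ :=
    fun p => F (p.1 ⟨n, Finset.mem_Iic.2 le_rfl⟩) p.2
  have hm : Measurable fun p : ((i : Finset.Iic n) → ℝ × 𝒳) × (ℝ × 𝒳) =>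
      (p.1 ⟨n, Finset.mem_Iic.2 le_rfl⟩, p.2) :=
    ((measurable_pi_apply _).comp measurable_fst).prodMk measurable_snd
  have hG : Measurable G := hF.comp hm
  have key2 := congrArg (fun μ => ∫⁻ p, G p ∂μ) key
  rw [Measure.lintegral_compProd hG, lintegral_map hG (by fun_prop),
    lintegral_map (hG.lintegral_kernel_prod_right') (by fun_prop)] at key2
  exact key2.symm

variable [MeasurableSingletonClass 𝒳]

/-- Both sides come from one trajectory kernel integrated against the law of the initial state,
which is a finite sum of atoms. -/
theorem jumpLaw_eq_sum (q : ℝ → 𝒳 → 𝒳 → ℝ) (ν : Measure 𝒳) :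
    jumpLaw q ν = ∑ x, ν {x} • jumpLaw q (Measure.dirac x) := by
  let κ : (n : ℕ) → Kernel ((i : Finset.Iic n) → ℝ × 𝒳) (ℝ × 𝒳) :=
    fun n => (jumpStep q).comap (fun h => h ⟨n, Finset.mem_Iic.2 le_rfl⟩) (by fun_prop)
  have key : ∀ (μ : Measure 𝒳) (s : Set (ℕ → ℝ × 𝒳)), MeasurableSet s →
      jumpLaw q μ s = ∫⁻ x, Kernel.traj (X := fun _ => ℝ × 𝒳) κ 0
        ((MeasurableEquiv.piUnique fun _ : Finset.Iic 0 => ℝ × 𝒳).symm (0, x)) s ∂μ := by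
    intro μ s hs
    have hm : Measurable fun h => Kernel.traj (X := fun _ => ℝ × 𝒳) κ 0 h s :=
      Kernel.measurable_coe _ hs
    unfold jumpLaw Kernel.trajMeasure
    rw [Measure.bind_apply hs (Kernel.aemeasurable _), lintegral_map hm (by fun_prop)]
    exact lintegral_map (hm.comp (MeasurableEquiv.measurable _)) (by fun_prop)
  ext s hs
  rw [key ν s hs, lintegral_fintype, Measure.finsetSum_apply]
  refine Finset.sum_congr rfl fun x _ => ?_
  rw [Measure.smul_apply, key _ s hs, lintegral_dirac, smul_eq_mul, mul_comm]

theorem ae_jumpLaw_dirac_zero (q : ℝ → 𝒳 → 𝒳 → ℝ) (x : 𝒳) :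
    ∀ᵐ ω ∂jumpLaw q (Measure.dirac x), ω 0 = (0, x) := by
  have : IsProbabilityMeasure ((Measure.dirac x).map fun x => ((0 : ℝ), x)) :=
    Measure.isProbabilityMeasure_map (by fun_prop)
  have h1 : (jumpLaw q (Measure.dirac x)).map (fun ω => ω 0) = Measure.dirac ((0 : ℝ), x) := by
    have h2 : (jumpLaw q (Measure.dirac x)).map (Preorder.frestrictLe (π := fun _ => ℝ × 𝒳) 0)
        = ((Measure.dirac x).map fun x => ((0 : ℝ), x)).map
          (MeasurableEquiv.piUnique fun _ : Finset.Iic 0 => ℝ × 𝒳).symm := by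
      unfold jumpLaw Kernel.trajMeasure
      rw [Measure.map_comp _ _ (by fun_prop), Kernel.traj_map_frestrictLe,
        Kernel.partialTraj_self, Measure.id_comp]
    have h3 := congrArg (fun μ => μ.map fun h => h ⟨0, Finset.mem_Iic.2 le_rfl⟩) h2
    rw [Measure.map_map (by fun_prop) (by fun_prop), Measure.map_map (by fun_prop) (by fun_prop),
      Measure.map_map (by fun_prop) (by fun_prop)] at h3
    exact h3.trans (Measure.map_dirac' (by fun_prop) x)
  have h2 : ∀ᵐ a ∂(jumpLaw q (Measure.dirac x)).map (fun ω => ω 0), a = ((0 : ℝ), x) := by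
    rw [h1]
    exact (ae_dirac_iff (measurableSet_singleton _)).2 rfl
  exact ae_of_ae_map (measurable_pi_apply 0).aemeasurable h2

theorem lintegral_nextJump {q : ℝ → 𝒳 → 𝒳 → ℝ}
    (hmd : Measurable (Function.uncurry (nextJumpDensity q))) (a : ℝ × 𝒳)
    {F : ℝ × 𝒳 → ℝ≥0∞} (hF : Measurable F) :
    ∫⁻ b, F b ∂nextJump q a = ∫⁻ u, ∑ y, nextJumpDensity q a (u, y) * F (u, y) := by
  have hm : Measurable (nextJumpDensity q a) := hmd.comp measurable_prodMk_left
  unfold nextJump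
  rw [Kernel.lintegral_withDensity _ hmd _ hF, Kernel.const_apply,
    lintegral_prod (fun b => nextJumpDensity q a b * F b) (hm.mul hF).aemeasurable]
  simp_rw [lintegral_count, tsum_fintype]

namespace IsAdmissible

variable {q : ℝ → 𝒳 → 𝒳 → ℝ} {C : ℝ} (hq : IsAdmissible q C)
include hq

theorem measurable_density : Measurable (Function.uncurry (nextJumpDensity q)) :=
  measurable_nextJumpDensity hq.measurable hq.abs_exitRate_le

theorem nextJump_univ [Nontrivial 𝒳] (a : ℝ × 𝒳) : nextJump q a Set.univ = 1 := by
  obtain h | ⟨c, hc, h⟩ := hq.subsingleton_or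
  · exact absurd h (not_subsingleton 𝒳)
  · exact MarkovJump.nextJump_univ hc hq.measurable hq.nonneg hq.abs_exitRate_le a.2
      (fun s => h s a.2) a.1

theorem jumpStep_eq [Nontrivial 𝒳] (a : ℝ × 𝒳) : jumpStep q a = nextJump q a := by
  classical
  rw [jumpStep, Kernel.piecewise_apply, if_pos]
  exact hq.nextJump_univ a

/-- Survival is multiplicative in time. Beyond `u` the density of the next jump is therefore the
survival up to `u` times the density for a process that arrives at the same state at time `u`, and
the latter has total mass one. -/
theorem nextJump_lt [Nontrivial 𝒳] (a : ℝ × 𝒳) {u : ℝ} (hu : a.1 ≤ u) :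
    nextJump q a {b | u < b.1} = ENNReal.ofReal (survival q a.1 u a.2) := by
  have hs : MeasurableSet {b : ℝ × 𝒳 | u < b.1} := measurableSet_lt (by fun_prop) (by fun_prop)
  rw [← lintegral_indicator_one hs, lintegral_nextJump hq.measurable_density a
    (measurable_one.indicator hs)]
  have h1 := hq.nextJump_univ (u, a.2)
  rw [← lintegral_one, lintegral_nextJump hq.measurable_density _ measurable_const] at h1
  have hm : Measurable fun w => ∑ y, nextJumpDensity q (u, a.2) (w, y) * 1 :=
    Finset.measurable_sum _ fun y _ => ((hq.measurable_density.comp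
      measurable_prodMk_left).comp measurable_prodMk_right).mul_const 1
  rw [← mul_one (ENNReal.ofReal _), ← h1, ← lintegral_const_mul _ hm]
  refine lintegral_congr fun w => ?_
  rw [Finset.mul_sum]
  refine Finset.sum_congr rfl fun y _ => ?_
  by_cases hw : u < w
  · have hI := intervalIntegrable_exitRate hq.measurable hq.abs_exitRate_le a.2
    have hS : survival q a.1 w a.2 = survival q a.1 u a.2 * survival q u w a.2 := by
      unfold survival
      rw [← Real.exp_add, ← intervalIntegral.integral_add_adjacent_intervals (hI a.1 u) (hI u w)]
      ring_nf
    rw [Set.indicator_of_mem (by exact hw)]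
    simp only [nextJumpDensity, hu.trans_lt hw, hw, if_true, Pi.one_apply, mul_one]
    rw [hS, mul_assoc, ENNReal.ofReal_mul (show 0 ≤ survival q a.1 u a.2 from (Real.exp_pos _).le)]
  · rw [Set.indicator_of_notMem (by exact hw)]
    simp [nextJumpDensity, hw]

/-- The one-step compensator: a jump at time `u` to `y` has density survival times `q u a.2 y`, and
by `nextJump_lt` the survival is the probability that the next jump comes after `u`. Tonelli's
theorem then matches the two sides. -/
theorem lintegral_nextJump_compensator [Nontrivial 𝒳] {α : ℝ → 𝒳 → 𝒳 → ℝ≥0∞}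
    (hα : ∀ x y, Measurable fun s => α s x y) (t : ℝ) (a : ℝ × 𝒳) :
    ∫⁻ b, (Set.Ioc 0 t).indicator (fun u => α u a.2 b.2) b.1 ∂nextJump q a
      = ∫⁻ b, (∫⁻ u in Set.Ioc (0 : ℝ) t, if a.1 ≤ u ∧ u < b.1 then
          ∑ y, ENNReal.ofReal (q u a.2 y) * α u a.2 y else 0) ∂nextJump q a := by
  have : IsFiniteMeasure (nextJump q a) := ⟨by rw [hq.nextJump_univ]; exact ENNReal.one_lt_top⟩
  have hG : Measurable fun u => ∑ y, ENNReal.ofReal (q u a.2 y) * α u a.2 y :=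
    Finset.measurable_sum _ fun y _ => (hq.measurable a.2 y).ennreal_ofReal.mul (hα a.2 y)
  have hα' : Measurable fun b : ℝ × 𝒳 => α b.1 a.2 b.2 :=
    measurable_from_prod_countable_left fun y => hα a.2 y
  have hsI : MeasurableSet {b : ℝ × 𝒳 | b.1 ∈ Set.Ioc 0 t} :=
    measurable_fst measurableSet_Ioc
  have hL : Measurable fun b : ℝ × 𝒳 =>
      (Set.Ioc 0 t).indicator (fun u => α u a.2 b.2) b.1 := by
    exact hα'.indicator hsI
  have hR : Measurable fun p : (ℝ × 𝒳) × ℝ => (if a.1 ≤ p.2 ∧ p.2 < p.1.1 then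
      ∑ y, ENNReal.ofReal (q p.2 a.2 y) * α p.2 a.2 y else 0) :=
    Measurable.ite (MeasurableSet.inter
      (s₁ := {p : (ℝ × 𝒳) × ℝ | a.1 ≤ p.2}) (s₂ := {p : (ℝ × 𝒳) × ℝ | p.2 < p.1.1})
      (measurableSet_le (by fun_prop) (by fun_prop))
      (measurableSet_lt (by fun_prop) (by fun_prop))) (hG.comp measurable_snd) measurable_const
  rw [lintegral_nextJump hq.measurable_density a hL, lintegral_lintegral_swap hR.aemeasurable,
    ← lintegral_indicator measurableSet_Ioc]
  -- The density requires `a.1 < u` and the indicator `a.1 ≤ u`; they differ at a single point,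
  -- which is Lebesgue-null.
  have hne : ∀ᵐ u : ℝ, u ≠ a.1 := by
    simp [ae_iff]
  refine lintegral_congr_ae (hne.mono fun u hu => ?_)
  by_cases hut : u ∈ Set.Ioc 0 t
  · simp only [Set.indicator_of_mem hut]
    by_cases hau : a.1 ≤ u
    · have hlt : a.1 < u := lt_of_le_of_ne hau hu.symm
      have h1 : ∀ b : ℝ × 𝒳, (if a.1 ≤ u ∧ u < b.1 then
          ∑ y, ENNReal.ofReal (q u a.2 y) * α u a.2 y else 0)
          = {b : ℝ × 𝒳 | u < b.1}.indicator
            (fun _ => ∑ y, ENNReal.ofReal (q u a.2 y) * α u a.2 y) b := by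
        intro b
        simp [hau, Set.indicator_apply]
      simp_rw [h1]
      rw [lintegral_indicator_const (measurableSet_lt (by fun_prop) (by fun_prop)),
        hq.nextJump_lt a hau, Finset.sum_mul]
      refine Finset.sum_congr rfl fun y _ => ?_
      simp only [nextJumpDensity, hlt, if_true]
      rw [ENNReal.ofReal_mul (show 0 ≤ survival q a.1 u a.2 from (Real.exp_pos _).le)]
      ring
    · have hlt : ¬ a.1 < u := fun h => hau h.le
      simp [nextJumpDensity, hau, hlt]
  · simp [Set.indicator_of_notMem hut]

end IsAdmissible

end Law

/-! ### The compensator of the jumps -/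

/-- At most one interval between consecutive times contains `u`. Unlike `IsRegularSeq.tsum_between`,
this does not ask that some interval contain it, so it applies before explosion is excluded. -/
theorem tsum_between_le {τ : ℕ → ℝ} (hτ : StrictMono τ) (u : ℝ) (F : ℕ → ℝ≥0∞) (c : ℝ≥0∞)
    (hF : ∀ n, F n ≤ c) :
    ∑' n, (if τ n ≤ u ∧ u < τ (n + 1) then F n else 0) ≤ c := by
  by_cases h : ∃ n, τ n ≤ u ∧ u < τ (n + 1)
  · obtain ⟨n, hn⟩ := h
    rw [tsum_eq_single n]
    · rw [if_pos hn]; exact hF n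
    · intro m hm
      rw [if_neg]
      intro hm2
      have h1 := hτ.lt_iff_lt.1 (hm2.1.trans_lt hn.2)
      have h2 := hτ.lt_iff_lt.1 (hn.1.trans_lt hm2.2)
      omega
  · push Not at h
    have : ∀ n, (if τ n ≤ u ∧ u < τ (n + 1) then F n else 0) = 0 := fun n =>
      if_neg fun hn => absurd hn.2 (not_lt.2 (h n hn.1))
    simp [this]

namespace IsRegularSeq

variable {𝒳 : Type*} {ω : ℕ → ℝ × 𝒳} (h : IsRegularSeq ω)
include h

theorem tsum_between {u : ℝ} (hu : 0 ≤ u) (Γ : 𝒳 → ℝ≥0∞) :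
    ∑' n, (if (ω n).1 ≤ u ∧ u < (ω (n + 1)).1 then Γ (ω n).2 else 0) = Γ (path ω u) := by
  obtain ⟨n, h1, h2⟩ := h.exists_index hu
  rw [tsum_eq_single n, if_pos ⟨h1, h2⟩, h.path_eq h1 h2]
  intro m hm
  exact if_neg fun hm2 => hm (h.eq_index h1 h2 hm2.1 hm2.2)

theorem tsum_jumps_eq_tsum (hne : ∀ n, (ω n).2 ≠ (ω (n + 1)).2) {t : ℝ} (ht : 0 ≤ t)
    (α : ℝ → 𝒳 → 𝒳 → ℝ≥0∞) :
    ∑' p : jumps (path ω) t, α p.1.1 p.1.2 (path ω p.1.1)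
      = ∑' n, (Set.Ioc 0 t).indicator (fun u => α u (ω n).2 (ω (n + 1)).2) (ω (n + 1)).1 := by
  obtain ⟨N, h1, h2⟩ := h.exists_index ht
  have hpos : ∀ n, 0 < (ω (n + 1)).1 := fun n => by
    have := h.strictMono (Nat.succ_pos n)
    simpa [h.zero] using this
  rw [h.tsum_jumps hne _ h1 h2, tsum_eq_sum (s := Finset.range N)]
  · refine Finset.sum_congr rfl fun n hn => ?_
    rw [Set.indicator_of_mem]
    exact ⟨hpos n, (h.le_iff h1 h2).2 (Nat.succ_le_of_lt (Finset.mem_range.1 hn))⟩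
  · intro n hn
    refine Set.indicator_of_notMem (fun hm => hn ?_) _
    have := (h.le_iff h1 h2).1 hm.2
    exact Finset.mem_range.2 this

end IsRegularSeq

section Law

variable {𝒳 : Type*} [Fintype 𝒳] [MeasurableSpace 𝒳] [MeasurableSingletonClass 𝒳]

theorem ae_jumpLaw_zero (q : ℝ → 𝒳 → 𝒳 → ℝ) (ν : Measure 𝒳) :
    ∀ᵐ ω ∂jumpLaw q ν, (ω 0).1 = 0 := by
  have hs : MeasurableSet {ω : ℕ → ℝ × 𝒳 | (ω 0).1 = 0} :=
    (measurable_fst.comp (measurable_pi_apply 0)) (measurableSet_singleton 0)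
  rw [ae_iff, jumpLaw_eq_sum, Measure.finsetSum_apply]
  refine Finset.sum_eq_zero fun x _ => ?_
  rw [Measure.smul_apply]
  have : (jumpLaw q (Measure.dirac x)) {ω | ¬ (ω 0).1 = 0} = 0 := by
    rw [← ae_iff]
    exact (ae_jumpLaw_dirac_zero q x).mono fun ω h => by rw [h]
  rw [this, smul_zero]

theorem measurable_jump_term {α : ℝ → 𝒳 → 𝒳 → ℝ≥0∞} (hα : ∀ x y, Measurable fun s => α s x y)
    (t : ℝ) (n : ℕ) : Measurable fun ω : ℕ → ℝ × 𝒳 =>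
      (Set.Ioc 0 t).indicator (fun u => α u (ω n).2 (ω (n + 1)).2) (ω (n + 1)).1 := by
  have h1 : Measurable fun z : 𝒳 × 𝒳 × ℝ => α z.2.2 z.1 z.2.1 :=
    measurable_from_prod_countable_right fun x =>
      measurable_from_prod_countable_right fun y => hα x y
  have h2 : Measurable fun ω : ℕ → ℝ × 𝒳 => α (ω (n + 1)).1 (ω n).2 (ω (n + 1)).2 :=
    h1.comp (f := fun ω : ℕ → ℝ × 𝒳 => ((ω n).2, (ω (n + 1)).2, (ω (n + 1)).1)) (by fun_prop)
  have hs : MeasurableSet {ω : ℕ → ℝ × 𝒳 | (ω (n + 1)).1 ∈ Set.Ioc (0 : ℝ) t} :=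
    (measurable_fst.comp (measurable_pi_apply (n + 1))) measurableSet_Ioc
  exact h2.indicator hs

namespace IsAdmissible

variable {q : ℝ → 𝒳 → 𝒳 → ℝ} {C : ℝ} (hq : IsAdmissible q C)
include hq

/-- The density of the next jump vanishes unless time increases, and it vanishes at an unchanged
state because `q s x x = 0`. -/
theorem ae_lt_ne_succ [Nontrivial 𝒳] (ν : Measure 𝒳) [IsProbabilityMeasure ν] :
    ∀ᵐ ω ∂jumpLaw q ν, ∀ n, (ω n).1 < (ω (n + 1)).1 ∧ (ω n).2 ≠ (ω (n + 1)).2 := by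
  classical
  rw [ae_all_iff]
  intro n
  let F : ℝ × 𝒳 → ℝ × 𝒳 → ℝ≥0∞ := fun a b => if a.1 < b.1 ∧ a.2 ≠ b.2 then 0 else 1
  have hF : Measurable (Function.uncurry F) := by
    refine Measurable.ite (MeasurableSet.inter
      (s₁ := {p : (ℝ × 𝒳) × (ℝ × 𝒳) | p.1.1 < p.2.1})
      (s₂ := {p : (ℝ × 𝒳) × (ℝ × 𝒳) | p.1.2 ≠ p.2.2})
      (measurableSet_lt (by fun_prop) (by fun_prop)) ?_) measurable_const measurable_const
    have hm : Measurable fun p : (ℝ × 𝒳) × (ℝ × 𝒳) => (p.1.2, p.2.2) := by fun_prop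
    exact hm (t := {p : 𝒳 × 𝒳 | p.1 ≠ p.2}) (Set.toFinite _).measurableSet
  have h1 := lintegral_jumpLaw_succ q ν n hF
  have h2 : ∀ a, ∫⁻ b, F a b ∂jumpStep q a = 0 := by
    intro a
    rw [hq.jumpStep_eq, lintegral_nextJump (F := F a) hq.measurable_density a
      (hF.comp measurable_prodMk_left)]
    refine (lintegral_congr fun u => Finset.sum_eq_zero fun y _ => ?_).trans lintegral_zero
    by_cases hau : a.1 < u
    · by_cases hay : a.2 = y
      · simp [nextJumpDensity, ← hay, hq.diag]
      · simp [F, hau, hay]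
    · simp [nextJumpDensity, hau]
  simp_rw [h2, lintegral_zero] at h1
  have hm : Measurable fun ω : ℕ → ℝ × 𝒳 => F (ω n) (ω (n + 1)) :=
    hF.comp (f := fun ω : ℕ → ℝ × 𝒳 => (ω n, ω (n + 1))) (by fun_prop)
  filter_upwards [(lintegral_eq_zero_iff hm).1 h1] with ω hω
  by_contra hc
  simp [F, hc] at hω

theorem lintegral_succ_compensator [Nontrivial 𝒳] (ν : Measure 𝒳) [IsProbabilityMeasure ν]
    {α : ℝ → 𝒳 → 𝒳 → ℝ≥0∞} (hα : ∀ x y, Measurable fun s => α s x y) (t : ℝ) (n : ℕ) :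
    ∫⁻ ω, (Set.Ioc 0 t).indicator (fun u => α u (ω n).2 (ω (n + 1)).2) (ω (n + 1)).1 ∂jumpLaw q ν
      = ∫⁻ ω, (∫⁻ u in Set.Ioc (0 : ℝ) t, if (ω n).1 ≤ u ∧ u < (ω (n + 1)).1 then
          ∑ y, ENNReal.ofReal (q u (ω n).2 y) * α u (ω n).2 y else 0) ∂jumpLaw q ν := by
  have hα' : Measurable fun p : (ℝ × 𝒳) × (ℝ × 𝒳) => α p.2.1 p.1.2 p.2.2 := by
    have : Measurable fun z : 𝒳 × 𝒳 × ℝ => α z.2.2 z.1 z.2.1 :=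
      measurable_from_prod_countable_right fun x =>
        measurable_from_prod_countable_right fun y => hα x y
    exact this.comp (f := fun p : (ℝ × 𝒳) × (ℝ × 𝒳) => (p.1.2, p.2.2, p.2.1)) (by fun_prop)
  have hL : Measurable (Function.uncurry fun a b : ℝ × 𝒳 =>
      (Set.Ioc 0 t).indicator (fun u => α u a.2 b.2) b.1) := by
    have hs : MeasurableSet {p : (ℝ × 𝒳) × (ℝ × 𝒳) | p.2.1 ∈ Set.Ioc 0 t} :=
      (measurable_fst.comp measurable_snd) measurableSet_Ioc
    exact hα'.indicator hs
  have hG : Measurable fun z : ℝ × 𝒳 => ∑ y, ENNReal.ofReal (q z.1 z.2 y) * α z.1 z.2 y :=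
    measurable_from_prod_countable_left fun x => Finset.measurable_sum _ fun y _ =>
      (hq.measurable x y).ennreal_ofReal.mul (hα x y)
  have hR : Measurable (Function.uncurry fun a b : ℝ × 𝒳 =>
      ∫⁻ u in Set.Ioc (0 : ℝ) t, if a.1 ≤ u ∧ u < b.1 then
        ∑ y, ENNReal.ofReal (q u a.2 y) * α u a.2 y else 0) := by
    have : Measurable fun p : ((ℝ × 𝒳) × (ℝ × 𝒳)) × ℝ => if p.1.1.1 ≤ p.2 ∧ p.2 < p.1.2.1 then
        ∑ y, ENNReal.ofReal (q p.2 p.1.1.2 y) * α p.2 p.1.1.2 y else 0 := by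
      refine Measurable.ite (MeasurableSet.inter
        (s₁ := {p : ((ℝ × 𝒳) × (ℝ × 𝒳)) × ℝ | p.1.1.1 ≤ p.2})
        (s₂ := {p : ((ℝ × 𝒳) × (ℝ × 𝒳)) × ℝ | p.2 < p.1.2.1})
        (measurableSet_le (by fun_prop) (by fun_prop))
        (measurableSet_lt (by fun_prop) (by fun_prop))) ?_ measurable_const
      exact hG.comp (f := fun p : ((ℝ × 𝒳) × (ℝ × 𝒳)) × ℝ => (p.2, p.1.1.2)) (by fun_prop)
    exact this.lintegral_prod_right'
  rw [lintegral_jumpLaw_succ q ν n hL, lintegral_jumpLaw_succ q ν n hR]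
  refine lintegral_congr fun ω => ?_
  rw [hq.jumpStep_eq]
  exact hq.lintegral_nextJump_compensator hα t (ω n)

theorem measurable_between {α : ℝ → 𝒳 → 𝒳 → ℝ≥0∞} (hα : ∀ x y, Measurable fun s => α s x y)
    (n : ℕ) : Measurable fun p : (ℕ → ℝ × 𝒳) × ℝ =>
      if (p.1 n).1 ≤ p.2 ∧ p.2 < (p.1 (n + 1)).1 then
        ∑ y, ENNReal.ofReal (q p.2 (p.1 n).2 y) * α p.2 (p.1 n).2 y else 0 := by
  have hG : Measurable fun z : ℝ × 𝒳 => ∑ y, ENNReal.ofReal (q z.1 z.2 y) * α z.1 z.2 y :=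
    measurable_from_prod_countable_left fun x => Finset.measurable_sum _ fun y _ =>
      (hq.measurable x y).ennreal_ofReal.mul (hα x y)
  refine Measurable.ite (MeasurableSet.inter
    (s₁ := {p : (ℕ → ℝ × 𝒳) × ℝ | (p.1 n).1 ≤ p.2})
    (s₂ := {p : (ℕ → ℝ × 𝒳) × ℝ | p.2 < (p.1 (n + 1)).1})
    (measurableSet_le (by fun_prop) (by fun_prop))
    (measurableSet_lt (by fun_prop) (by fun_prop))) ?_ measurable_const
  exact hG.comp (f := fun p : (ℕ → ℝ × 𝒳) × ℝ => (p.2, (p.1 n).2)) (by fun_prop)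

/-- The inner sum over `n` is kept: identifying it with a function of `path ω u` would require that
the jump times exhaust the half-line, and this identity is itself used to prove that. -/
theorem tsum_lintegral_compensator [Nontrivial 𝒳] (ν : Measure 𝒳) [IsProbabilityMeasure ν]
    {α : ℝ → 𝒳 → 𝒳 → ℝ≥0∞} (hα : ∀ x y, Measurable fun s => α s x y) (t : ℝ) :
    ∑' n, ∫⁻ ω, (Set.Ioc 0 t).indicator (fun u => α u (ω n).2 (ω (n + 1)).2) (ω (n + 1)).1
        ∂jumpLaw q ν
      = ∫⁻ ω, (∫⁻ u in Set.Ioc (0 : ℝ) t, ∑' n, if (ω n).1 ≤ u ∧ u < (ω (n + 1)).1 then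
          ∑ y, ENNReal.ofReal (q u (ω n).2 y) * α u (ω n).2 y else 0) ∂jumpLaw q ν := by
  simp_rw [hq.lintegral_succ_compensator ν hα t]
  rw [← lintegral_tsum fun n => (hq.measurable_between hα n).lintegral_prod_right'.aemeasurable]
  refine lintegral_congr fun ω => ?_
  exact (lintegral_tsum fun n =>
    ((hq.measurable_between hα n).comp measurable_prodMk_left).aemeasurable).symm

/-- With `α = 1` the compensator bounds the expected number of jumps in `(0,k]` by `C * k`. By the
first Borel–Cantelli lemma, almost surely only finitely many jump times lie there, and being
positive some later one exceeds `k`. -/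
theorem ae_unbounded [Nontrivial 𝒳] (ν : Measure 𝒳) [IsProbabilityMeasure ν] :
    ∀ᵐ ω ∂jumpLaw q ν, ∀ k : ℕ, ∃ n, (k : ℝ) < (ω (n + 1)).1 := by
  rw [ae_all_iff]
  intro k
  have hs : ∀ n : ℕ, MeasurableSet {ω : ℕ → ℝ × 𝒳 | (ω (n + 1)).1 ∈ Set.Ioc (0 : ℝ) k} := fun n =>
    (measurable_fst.comp (measurable_pi_apply (n + 1))) measurableSet_Ioc
  have h1 : ∑' n, jumpLaw q ν {ω | (ω (n + 1)).1 ∈ Set.Ioc (0 : ℝ) k} ≠ ∞ := by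
    have h2 := hq.tsum_lintegral_compensator ν (α := fun _ _ _ => 1)
      (fun _ _ => measurable_const) k
    have h3 : ∀ n, ∫⁻ ω, (Set.Ioc (0 : ℝ) k).indicator (fun _ => (1 : ℝ≥0∞)) (ω (n + 1)).1
        ∂jumpLaw q ν = jumpLaw q ν {ω | (ω (n + 1)).1 ∈ Set.Ioc (0 : ℝ) k} := by
      intro n
      rw [← lintegral_indicator_one (hs n)]
      rfl
    simp_rw [h3, mul_one] at h2
    rw [h2]
    have h4 : ∀ᵐ ω ∂jumpLaw q ν, (∫⁻ u in Set.Ioc (0 : ℝ) k, ∑' n,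
        if (ω n).1 ≤ u ∧ u < (ω (n + 1)).1 then
          ∑ y, ENNReal.ofReal (q u (ω n).2 y) else 0) ≤ ENNReal.ofReal C * ENNReal.ofReal k := by
      filter_upwards [hq.ae_lt_ne_succ ν] with ω hω
      calc _ ≤ ∫⁻ u in Set.Ioc (0 : ℝ) k, ENNReal.ofReal C := by
            refine lintegral_mono fun u => ?_
            refine tsum_between_le (τ := fun n => (ω n).1)
              (strictMono_nat_of_lt_succ fun n => (hω n).1) u
              (fun n => ∑ y, ENNReal.ofReal (q u (ω n).2 y)) _ fun n => ?_
            rw [← ENNReal.ofReal_sum_of_nonneg fun y _ => hq.nonneg _ _ _]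
            exact ENNReal.ofReal_le_ofReal (hq.exitRate_le u _)
        _ = _ := by simp
    refine ((lintegral_mono_ae h4).trans_lt ?_).ne
    rw [lintegral_const, measure_univ, mul_one]
    exact ENNReal.mul_lt_top ENNReal.ofReal_lt_top ENNReal.ofReal_lt_top
  filter_upwards [ae_eventually_notMem h1, ae_jumpLaw_zero q ν, hq.ae_lt_ne_succ ν] with ω h2 h3 h4
  obtain ⟨n, hn⟩ := h2.exists
  refine ⟨n, ?_⟩
  have hpos : 0 < (ω (n + 1)).1 := by
    have := (strictMono_nat_of_lt_succ fun n => (h4 n).1) (Nat.succ_pos n)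
    simpa [h3] using this
  by_contra hle
  exact hn ⟨hpos, not_lt.1 hle⟩

theorem ae_isRegularSeq [Nontrivial 𝒳] (ν : Measure 𝒳) [IsProbabilityMeasure ν] :
    ∀ᵐ ω ∂jumpLaw q ν, IsRegularSeq ω ∧ ∀ n, (ω n).2 ≠ (ω (n + 1)).2 := by
  filter_upwards [ae_jumpLaw_zero q ν, hq.ae_lt_ne_succ ν, hq.ae_unbounded ν] with ω h1 h2 h3
  exact ⟨⟨h1, fun n => (h2 n).1, h3⟩, fun n => (h2 n).2⟩

theorem aemeasurable_tsum_jumps (ν : Measure 𝒳) [IsProbabilityMeasure ν]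
    {α : ℝ → 𝒳 → 𝒳 → ℝ≥0∞} (hα : ∀ x y, Measurable fun s => α s x y) {t : ℝ} (ht : 0 ≤ t) :
    AEMeasurable (fun ω => ∑' p : jumps (path ω) t, α p.1.1 p.1.2 (path ω p.1.1))
      (jumpLaw q ν) := by
  rcases subsingleton_or_nontrivial 𝒳 with h | h
  · simp [jumps_eq_empty]
  · refine ⟨fun ω => ∑' n, (Set.Ioc 0 t).indicator (fun u => α u (ω n).2 (ω (n + 1)).2)
      (ω (n + 1)).1, Measurable.tsum fun n => measurable_jump_term hα t n, ?_⟩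
    filter_upwards [hq.ae_isRegularSeq ν] with ω hω
    exact hω.1.tsum_jumps_eq_tsum hω.2 ht α

/-- The compensator formula for nonnegative additive functionals of the jumps. -/
theorem lintegral_tsum_jumps (ν : Measure 𝒳) [IsProbabilityMeasure ν]
    {α : ℝ → 𝒳 → 𝒳 → ℝ≥0∞} (hα : ∀ x y, Measurable fun s => α s x y) {t : ℝ} (ht : 0 ≤ t) :
    ∫⁻ ω, ∑' p : jumps (path ω) t, α p.1.1 p.1.2 (path ω p.1.1) ∂jumpLaw q ν
      = ∫⁻ ω, (∫⁻ u in Set.Ioc (0 : ℝ) t,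
          ∑ y, ENNReal.ofReal (q u (path ω u) y) * α u (path ω u) y) ∂jumpLaw q ν := by
  rcases subsingleton_or_nontrivial 𝒳 with h | h
  · simp [jumps_eq_empty, hq.eq_zero]
  · have h1 : ∀ᵐ ω ∂jumpLaw q ν, ∑' p : jumps (path ω) t, α p.1.1 p.1.2 (path ω p.1.1)
        = ∑' n, (Set.Ioc 0 t).indicator
          (fun u => α u (ω n).2 (ω (n + 1)).2) (ω (n + 1)).1 := by
      filter_upwards [hq.ae_isRegularSeq ν] with ω hω
      exact hω.1.tsum_jumps_eq_tsum hω.2 ht α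
    rw [lintegral_congr_ae h1, lintegral_tsum fun n => (measurable_jump_term hα t n).aemeasurable,
      hq.tsum_lintegral_compensator ν hα t]
    refine lintegral_congr_ae ?_
    filter_upwards [hq.ae_isRegularSeq ν] with ω hω
    refine setLIntegral_congr_fun measurableSet_Ioc fun u hu => ?_
    exact hω.1.tsum_between hu.1.le fun x => ∑ y, ENNReal.ofReal (q u x y) * α u x y

end IsAdmissible

end Law

/-! ### One-dimensional marginals -/

section Marginals

variable {𝒳 : Type*} [Fintype 𝒳] [MeasurableSpace 𝒳]

/-- The law of `X_t` for the process with rates `q` and initial distribution `ν`. -/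
noncomputable def marginal (q : ℝ → 𝒳 → 𝒳 → ℝ) (ν : Measure 𝒳) (t : ℝ) (x : 𝒳) : ℝ :=
  (jumpLaw q ν).real {ω | path ω t = x}

variable [MeasurableSingletonClass 𝒳]

theorem measurable_path_family {E : Type*} [MeasurableSpace E] {v : ℝ → 𝒳 → E}
    (hv : ∀ x, Measurable fun s => v s x) :
    Measurable fun p : (ℕ → ℝ × 𝒳) × ℝ => v p.2 (path p.1 p.2) := by
  have h1 : Measurable fun z : ℝ × 𝒳 => v z.1 z.2 := measurable_from_prod_countable_left hv
  exact h1.comp (measurable_snd.prodMk measurable_path)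

theorem measurableSet_path_eq (t : ℝ) (x : 𝒳) :
    MeasurableSet {ω : ℕ → ℝ × 𝒳 | path ω t = x} :=
  measurable_path_apply t (measurableSet_singleton x)

theorem sum_indicator_path {M : Type*} [AddCommMonoid M] (w : 𝒳 → M) (ω : ℕ → ℝ × 𝒳) (t : ℝ) :
    w (path ω t) = ∑ x, {ω : ℕ → ℝ × 𝒳 | path ω t = x}.indicator (fun _ => w x) ω := by
  classical
  rw [Finset.sum_eq_single (path ω t)]
  · exact (Set.indicator_of_mem (s := {ω' : ℕ → ℝ × 𝒳 | path ω' t = path ω t}) rfl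
      (fun _ => w (path ω t))).symm
  · intro x _ hx
    exact Set.indicator_of_notMem (fun h => hx h.symm) _
  · simp

theorem jumpLaw_real_eq_sum (q : ℝ → 𝒳 → 𝒳 → ℝ) (ν : Measure 𝒳) [IsProbabilityMeasure ν]
    (s : Set (ℕ → ℝ × 𝒳)) :
    (jumpLaw q ν).real s = ∑ x, ν.real {x} * (jumpLaw q (Measure.dirac x)).real s := by
  unfold Measure.real
  rw [jumpLaw_eq_sum, Measure.finsetSum_apply, ENNReal.toReal_sum]
  · simp [ENNReal.toReal_mul]
  · intro x _
    rw [Measure.smul_apply, smul_eq_mul]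
    exact ENNReal.mul_ne_top (measure_ne_top _ _) (measure_ne_top _ _)

theorem marginal_eq_sum (q : ℝ → 𝒳 → 𝒳 → ℝ) (ν : Measure 𝒳) [IsProbabilityMeasure ν]
    (t : ℝ) (y : 𝒳) : marginal q ν t y = ∑ x, ν.real {x} * transProb q t x y :=
  jumpLaw_real_eq_sum q ν _

theorem transProb_eq_marginal (q : ℝ → 𝒳 → 𝒳 → ℝ) (t : ℝ) (x y : 𝒳) :
    transProb q t x y = marginal q (Measure.dirac x) t y := rfl

theorem marginal_nonneg (q : ℝ → 𝒳 → 𝒳 → ℝ) (ν : Measure 𝒳) (t : ℝ) (x : 𝒳) :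
    0 ≤ marginal q ν t x := measureReal_nonneg

theorem measurable_marginal (q : ℝ → 𝒳 → 𝒳 → ℝ) (ν : Measure 𝒳) [IsProbabilityMeasure ν]
    (x : 𝒳) : Measurable fun t => marginal q ν t x := by
  have hs : MeasurableSet {p : (ℕ → ℝ × 𝒳) × ℝ | path p.1 p.2 = x} :=
    measurable_path (measurableSet_singleton x)
  exact (measurable_measure_prodMk_right hs).ennreal_toReal

theorem integrable_path (q : ℝ → 𝒳 → 𝒳 → ℝ) (ν : Measure 𝒳) [IsProbabilityMeasure ν]
    (t : ℝ) (w : 𝒳 → ℝ) : Integrable (fun ω => w (path ω t)) (jumpLaw q ν) := by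
  simp_rw [sum_indicator_path w]
  exact integrable_finsetSum _ fun x _ =>
    (integrable_const (w x)).indicator (measurableSet_path_eq t x)

theorem integral_path (q : ℝ → 𝒳 → 𝒳 → ℝ) (ν : Measure 𝒳) [IsProbabilityMeasure ν]
    (t : ℝ) (w : 𝒳 → ℝ) : ∫ ω, w (path ω t) ∂jumpLaw q ν = ∑ x, marginal q ν t x * w x := by
  simp_rw [sum_indicator_path w]
  rw [integral_finsetSum _ fun x _ =>
    (integrable_const (w x)).indicator (measurableSet_path_eq t x)]
  refine Finset.sum_congr rfl fun x _ => ?_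
  rw [integral_indicator_const _ (measurableSet_path_eq t x), smul_eq_mul]
  rfl

theorem lintegral_path (q : ℝ → 𝒳 → 𝒳 → ℝ) (ν : Measure 𝒳) [IsProbabilityMeasure ν]
    (t : ℝ) (w : 𝒳 → ℝ≥0∞) :
    ∫⁻ ω, w (path ω t) ∂jumpLaw q ν = ∑ x, ENNReal.ofReal (marginal q ν t x) * w x := by
  simp_rw [sum_indicator_path w]
  rw [lintegral_finsetSum _ fun x _ =>
    measurable_const.indicator (measurableSet_path_eq t x)]
  refine Finset.sum_congr rfl fun x _ => ?_
  rw [lintegral_indicator_const (measurableSet_path_eq t x), marginal, ofReal_measureReal,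
    mul_comm]

theorem sum_marginal (q : ℝ → 𝒳 → 𝒳 → ℝ) (ν : Measure 𝒳) [IsProbabilityMeasure ν] (t : ℝ) :
    ∑ x, marginal q ν t x = 1 := by
  have := integral_path q ν t fun _ => 1
  simpa using this.symm

theorem marginal_le_one (q : ℝ → 𝒳 → 𝒳 → ℝ) (ν : Measure 𝒳) [IsProbabilityMeasure ν] (t : ℝ)
    (x : 𝒳) : marginal q ν t x ≤ 1 := measureReal_le_one

/-- Fubini for time integrals along the path. -/
theorem integrable_path_prod (q : ℝ → 𝒳 → 𝒳 → ℝ) (ν : Measure 𝒳) [IsProbabilityMeasure ν]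
    {s : Set ℝ} {v : ℝ → 𝒳 → ℝ} (hv : ∀ x, Measurable fun u => v u x)
    (hi : ∀ x, IntegrableOn (fun u => v u x) s) :
    Integrable (fun p : (ℕ → ℝ × 𝒳) × ℝ => v p.2 (path p.1 p.2))
      ((jumpLaw q ν).prod (volume.restrict s)) := by
  have h1 : Integrable (fun u => ∑ x, |v u x|) (volume.restrict s) :=
    integrable_finsetSum _ fun x _ => (hi x).abs
  refine (h1.comp_snd (jumpLaw q ν)).mono' (measurable_path_family hv).aestronglyMeasurable ?_
  filter_upwards with p
  exact Finset.single_le_sum (f := fun x => |v p.2 x|) (fun x _ => abs_nonneg _)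
    (Finset.mem_univ (path p.1 p.2))

theorem integral_path_setIntegral (q : ℝ → 𝒳 → 𝒳 → ℝ) (ν : Measure 𝒳) [IsProbabilityMeasure ν]
    {s : Set ℝ} {v : ℝ → 𝒳 → ℝ} (hv : ∀ x, Measurable fun u => v u x)
    (hi : ∀ x, IntegrableOn (fun u => v u x) s) :
    ∫ ω, (∫ u in s, v u (path ω u)) ∂jumpLaw q ν = ∫ u in s, ∑ x, marginal q ν u x * v u x := by
  rw [integral_integral_swap (integrable_path_prod q ν hv hi)]
  simp_rw [integral_path q ν _ (v _)]

theorem integrableOn_marginal_mul (q : ℝ → 𝒳 → 𝒳 → ℝ) (ν : Measure 𝒳) [IsProbabilityMeasure ν]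
    {s : Set ℝ} {f : ℝ → ℝ} (hf : IntegrableOn f s) (x : 𝒳) :
    IntegrableOn (fun u => marginal q ν u x * f u) s := by
  refine hf.bdd_mul (c := 1) (measurable_marginal q ν x).aestronglyMeasurable ?_
  filter_upwards with u
  rw [Real.norm_of_nonneg (marginal_nonneg q ν u x)]
  exact marginal_le_one q ν u x

theorem lintegral_path_setLIntegral (q : ℝ → 𝒳 → 𝒳 → ℝ) (ν : Measure 𝒳) [IsProbabilityMeasure ν]
    {s : Set ℝ} {v : ℝ → 𝒳 → ℝ≥0∞} (hv : ∀ x, Measurable fun u => v u x) :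
    ∫⁻ ω, (∫⁻ u in s, v u (path ω u)) ∂jumpLaw q ν
      = ∑ x, ∫⁻ u in s, ENNReal.ofReal (marginal q ν u x) * v u x := by
  rw [lintegral_lintegral_swap (measurable_path_family hv).aemeasurable]
  simp_rw [lintegral_path q ν _ (v _)]
  exact lintegral_finsetSum _ fun x _ => (measurable_marginal q ν x).ennreal_ofReal.mul (hv x)

theorem integrable_two_time (q : ℝ → 𝒳 → 𝒳 → ℝ) (ν : Measure 𝒳) [IsProbabilityMeasure ν] (t : ℝ) (v h : 𝒳 → ℝ) :
    Integrable (fun ω => v (path ω t) * h (path ω 0)) (jumpLaw q ν) := by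
  refine (integrable_path q ν 0 h).bdd_mul (c := ∑ x, |v x|)
    (integrable_path q ν t v).aestronglyMeasurable ?_
  filter_upwards with ω
  exact Finset.single_le_sum (f := fun x => |v x|) (fun x _ => abs_nonneg _)
    (Finset.mem_univ (path ω t))

namespace IsAdmissible

variable {q : ℝ → 𝒳 → 𝒳 → ℝ} {C : ℝ} (hq : IsAdmissible q C)
include hq

theorem ae_path_zero (x : 𝒳) : ∀ᵐ ω ∂jumpLaw q (Measure.dirac x), path ω 0 = x := by
  rcases subsingleton_or_nontrivial 𝒳 with h | h
  · exact Eventually.of_forall fun ω => Subsingleton.elim _ _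
  · filter_upwards [hq.ae_isRegularSeq (Measure.dirac x), ae_jumpLaw_dirac_zero q x] with ω h1 h2
    rw [h1.1.path_zero, h2]

theorem marginal_zero (ν : Measure 𝒳) [IsProbabilityMeasure ν] (y : 𝒳) :
    marginal q ν 0 y = ν.real {y} := by
  classical
  rw [marginal_eq_sum, Finset.sum_eq_single y]
  · have : transProb q 0 y y = 1 := by
      unfold transProb
      rw [measureReal_congr (t := Set.univ), probReal_univ]
      filter_upwards [hq.ae_path_zero y] with ω hω
      exact propext ⟨fun _ => trivial, fun _ => hω⟩
    rw [this, mul_one]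
  · intro x _ hxy
    have : transProb q 0 x y = 0 := by
      unfold transProb
      rw [measureReal_congr (t := ∅), measureReal_empty]
      filter_upwards [hq.ae_path_zero x] with ω hω
      exact propext ⟨fun h => hxy (hω.symm.trans h), fun h => h.elim⟩
    rw [this, mul_zero]
  · simp

/-- The law is a mixture over initial states, and under the law started from `x` the factor `h (path
ω 0)` is almost surely the constant `h x`. -/
theorem integral_two_time (ν : Measure 𝒳) [IsProbabilityMeasure ν] (t : ℝ) (v h : 𝒳 → ℝ) :
    ∫ ω, v (path ω t) * h (path ω 0) ∂jumpLaw q ν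
      = ∑ x, ν.real {x} * ((∑ y, transProb q t x y * v y) * h x) := by
  rw [jumpLaw_eq_sum, integral_finsetSum_measure fun x _ =>
    (integrable_two_time q (Measure.dirac x) t v h).smul_measure (measure_ne_top _ _)]
  refine Finset.sum_congr rfl fun x _ => ?_
  rw [integral_smul_measure, smul_eq_mul]
  congr 1
  have : (fun ω => v (path ω t) * h (path ω 0)) =ᵐ[jumpLaw q (Measure.dirac x)]
      fun ω => v (path ω t) * h x := by
    filter_upwards [hq.ae_path_zero x] with ω hω
    rw [hω]
  rw [integral_congr_ae this, integral_mul_const, integral_path]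
  rfl

/-- Almost surely there are finitely many jumps up to time `t`, so the sum splits into positive and
negative parts, both finite. This carries the compensator formula from nonnegative to signed `α`. -/
theorem jumpSum_eq_toReal_sub (ν : Measure 𝒳) [IsProbabilityMeasure ν] (α : ℝ → 𝒳 → 𝒳 → ℝ)
    {t : ℝ} (ht : 0 ≤ t) : ∀ᵐ ω ∂jumpLaw q ν, jumpSum α t (path ω)
      = (∑' p : jumps (path ω) t, ENNReal.ofReal (α p.1.1 p.1.2 (path ω p.1.1))).toReal
        - (∑' p : jumps (path ω) t, ENNReal.ofReal (-α p.1.1 p.1.2 (path ω p.1.1))).toReal := by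
  rcases subsingleton_or_nontrivial 𝒳 with h | h
  · simp [jumpSum, jumps_eq_empty]
  · filter_upwards [hq.ae_isRegularSeq ν] with ω hω
    obtain ⟨N, h1, h2⟩ := hω.1.exists_index ht
    rw [jumpSum, hω.1.tsum_jumps hω.2 α h1 h2,
      hω.1.tsum_jumps hω.2 (fun s x y => ENNReal.ofReal (α s x y)) h1 h2,
      hω.1.tsum_jumps hω.2 (fun s x y => ENNReal.ofReal (-α s x y)) h1 h2,
      ENNReal.toReal_sum fun _ _ => ENNReal.ofReal_ne_top,
      ENNReal.toReal_sum fun _ _ => ENNReal.ofReal_ne_top, ← Finset.sum_sub_distrib]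
    refine Finset.sum_congr rfl fun n _ => ?_
    rw [ENNReal.toReal_ofReal', ENNReal.toReal_ofReal', max_zero_sub_max_neg_zero_eq_self]

theorem lintegral_tsum_jumps_ofReal (ν : Measure 𝒳) [IsProbabilityMeasure ν]
    {α : ℝ → 𝒳 → 𝒳 → ℝ} (hα : ∀ x y, Measurable fun s => α s x y)
    {t : ℝ} (ht : 0 ≤ t) :
    ∫⁻ ω, ∑' p : jumps (path ω) t, ENNReal.ofReal (α p.1.1 p.1.2 (path ω p.1.1)) ∂jumpLaw q ν
      = ∑ x, ∑ y, ∫⁻ u in Set.Ioc (0 : ℝ) t,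
          ENNReal.ofReal (marginal q ν u x * max (α u x y * q u x y) 0) := by
  rw [hq.lintegral_tsum_jumps ν (α := fun s x y => ENNReal.ofReal (α s x y))
    (fun x y => (hα x y).ennreal_ofReal) ht, lintegral_path_setLIntegral q ν
    (v := fun u x => ∑ y, ENNReal.ofReal (q u x y) * ENNReal.ofReal (α u x y)) fun x =>
      Finset.measurable_sum _ fun y _ =>
        (hq.measurable x y).ennreal_ofReal.mul (hα x y).ennreal_ofReal]
  refine Finset.sum_congr rfl fun x _ => ?_
  rw [← lintegral_finsetSum]
  · refine lintegral_congr fun u => ?_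
    rw [Finset.mul_sum]
    refine Finset.sum_congr rfl fun y _ => ?_
    rw [← ENNReal.ofReal_mul (hq.nonneg u x y), ENNReal.ofReal_mul (marginal_nonneg q ν u x)]
    congr 1
    rw [mul_comm]
    rcases le_total (α u x y * q u x y) 0 with h | h
    · rw [max_eq_right h, ENNReal.ofReal_of_nonpos h, ENNReal.ofReal_zero]
    · rw [max_eq_left h]
  · intro y _
    exact ((measurable_marginal q ν x).mul
      (((hα x y).mul (hq.measurable x y)).max measurable_const)).ennreal_ofReal

theorem integral_toReal_tsum_jumps (ν : Measure 𝒳) [IsProbabilityMeasure ν]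
    {α : ℝ → 𝒳 → 𝒳 → ℝ} (hα : ∀ x y, Measurable fun s => α s x y)
    {t : ℝ} (ht : 0 ≤ t) (hi : ∀ x y, IntegrableOn (fun s => α s x y * q s x y) (Set.Ioc 0 t)) :
    Integrable (fun ω => (∑' p : jumps (path ω) t,
      ENNReal.ofReal (α p.1.1 p.1.2 (path ω p.1.1))).toReal) (jumpLaw q ν) ∧
    ∫ ω, (∑' p : jumps (path ω) t, ENNReal.ofReal (α p.1.1 p.1.2 (path ω p.1.1))).toReal
        ∂jumpLaw q ν
      = ∑ x, ∑ y, ∫ u in Set.Ioc (0 : ℝ) t, marginal q ν u x * max (α u x y * q u x y) 0 := by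
  have h1 := hq.lintegral_tsum_jumps_ofReal ν hα ht
  have hm := hq.aemeasurable_tsum_jumps ν (α := fun s x y => ENNReal.ofReal (α s x y))
    (fun x y => (hα x y).ennreal_ofReal) ht
  have hint : ∀ x y, IntegrableOn (fun u => marginal q ν u x * max (α u x y * q u x y) 0)
      (Set.Ioc 0 t) := fun x y => integrableOn_marginal_mul q ν (hi x y).pos_part x
  have h2 : ∀ x y, ∫⁻ u in Set.Ioc (0 : ℝ) t,
      ENNReal.ofReal (marginal q ν u x * max (α u x y * q u x y) 0)
      = ENNReal.ofReal (∫ u in Set.Ioc (0 : ℝ) t,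
        marginal q ν u x * max (α u x y * q u x y) 0) := fun x y =>
    (ofReal_integral_eq_lintegral_ofReal (hint x y) (Eventually.of_forall fun u =>
      mul_nonneg (marginal_nonneg q ν u x) (le_max_right _ _))).symm
  simp_rw [h2] at h1
  have h3 : ∫⁻ ω, ∑' p : jumps (path ω) t, ENNReal.ofReal (α p.1.1 p.1.2 (path ω p.1.1))
      ∂jumpLaw q ν ≠ ∞ := by
    rw [h1]
    exact ENNReal.sum_ne_top.2 fun x _ => ENNReal.sum_ne_top.2 fun y _ => ENNReal.ofReal_ne_top
  refine ⟨integrable_toReal_of_lintegral_ne_top hm h3, ?_⟩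
  rw [integral_toReal hm (ae_lt_top' hm h3), h1,
    ENNReal.toReal_sum fun x _ => ENNReal.sum_ne_top.2 fun y _ => ENNReal.ofReal_ne_top]
  refine Finset.sum_congr rfl fun x _ => ?_
  rw [ENNReal.toReal_sum fun y _ => ENNReal.ofReal_ne_top]
  refine Finset.sum_congr rfl fun y _ => ?_
  exact ENNReal.toReal_ofReal (integral_nonneg fun u =>
    mul_nonneg (marginal_nonneg q ν u x) (le_max_right _ _))

/-- The compensator formula. -/
theorem integral_jumpSum (ν : Measure 𝒳) [IsProbabilityMeasure ν]
    {α : ℝ → 𝒳 → 𝒳 → ℝ} (hα : ∀ x y, Measurable fun s => α s x y)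
    {t : ℝ} (ht : 0 ≤ t) (hi : ∀ x y, IntegrableOn (fun s => α s x y * q s x y) (Set.Ioc 0 t)) :
    Integrable (fun ω => jumpSum α t (path ω)) (jumpLaw q ν) ∧
    ∫ ω, jumpSum α t (path ω) ∂jumpLaw q ν
      = ∑ x, ∑ y, ∫ u in Set.Ioc (0 : ℝ) t, marginal q ν u x * (α u x y * q u x y) := by
  have hi' : ∀ x y, IntegrableOn (fun s => -α s x y * q s x y) (Set.Ioc 0 t) := fun x y => by
    simp_rw [neg_mul]; exact (hi x y).neg
  obtain ⟨h1, h2⟩ := hq.integral_toReal_tsum_jumps ν hα ht hi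
  obtain ⟨h3, h4⟩ := hq.integral_toReal_tsum_jumps ν (α := fun s x y => -α s x y)
    (fun x y => (hα x y).neg) ht hi'
  have h5 := hq.jumpSum_eq_toReal_sub ν α ht
  refine ⟨(h1.sub h3).congr (h5.mono fun ω h => h.symm), ?_⟩
  rw [integral_congr_ae h5, integral_sub h1 h3, h2, h4, ← Finset.sum_sub_distrib]
  refine Finset.sum_congr rfl fun x _ => ?_
  rw [← Finset.sum_sub_distrib]
  refine Finset.sum_congr rfl fun y _ => ?_
  rw [← integral_sub (integrableOn_marginal_mul q ν (hi x y).pos_part x)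
    (integrableOn_marginal_mul q ν (hi' x y).pos_part x)]
  refine integral_congr_ae (Eventually.of_forall fun u => ?_)
  simp only [neg_mul]
  rw [← mul_sub, max_zero_sub_max_neg_zero_eq_self]

theorem integrableOn_const_mul (f : ℝ) (x y : 𝒳) (t : ℝ) :
    IntegrableOn (fun s => f * q s x y) (Set.Ioc 0 t) := by
  refine (Integrable.of_bound (C := C) (hq.measurable x y).aestronglyMeasurable ?_).const_mul f
  filter_upwards with s
  rw [Real.norm_of_nonneg (hq.nonneg s x y)]
  exact hq.le_bound s x y

/-- The Kolmogorov forward equation. -/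
theorem forward_equation (ν : Measure 𝒳) [IsProbabilityMeasure ν] (f : 𝒳 → ℝ)
    {t : ℝ} (ht : 0 ≤ t) :
    ∑ x, marginal q ν t x * f x = ∑ x, ν.real {x} * f x
      + ∫ u in (0 : ℝ)..t, ∑ x, marginal q ν u x * ∑ y, q u x y * (f y - f x) := by
  have hi : ∀ x y, IntegrableOn (fun s => (f y - f x) * q s x y) (Set.Ioc 0 t) := fun x y =>
    hq.integrableOn_const_mul _ x y t
  -- For `α = f y - f x` the sum over the jumps telescopes to `f (X_t) - f (X_0)`, so the
  -- compensator formula becomes the forward equation.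
  have h1 := (hq.integral_jumpSum ν (α := fun _ x y => f y - f x)
    (fun _ _ => measurable_const) ht hi).2
  have h2 : ∀ᵐ ω ∂jumpLaw q ν, jumpSum (fun _ x y => f y - f x) t (path ω)
      = f (path ω t) - f (path ω 0) := by
    rcases subsingleton_or_nontrivial 𝒳 with h | h
    · refine Eventually.of_forall fun ω => ?_
      rw [Subsingleton.elim (path ω t) (path ω 0)]
      simp [jumpSum, jumps_eq_empty]
    · filter_upwards [hq.ae_isRegularSeq ν] with ω hω
      obtain ⟨N, h1, h2⟩ := hω.1.exists_index ht
      rw [jumpSum, hω.1.tsum_jumps hω.2 (fun _ x y => f y - f x) h1 h2,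
        Finset.sum_range_sub fun n => f (ω n).2, hω.1.path_zero, hω.1.path_eq h1 h2]
  rw [integral_congr_ae h2, integral_sub (integrable_path q ν t f) (integrable_path q ν 0 f),
    integral_path, integral_path] at h1
  simp_rw [hq.marginal_zero] at h1
  rw [intervalIntegral.integral_of_le ht, sub_eq_iff_eq_add'.1 h1, add_right_inj]
  have hI : ∀ x y, Integrable (fun u => marginal q ν u x * (q u x y * (f y - f x)))
      (volume.restrict (Set.Ioc 0 t)) := fun x y => by
    simp_rw [mul_comm (q _ x y)]
    exact integrableOn_marginal_mul q ν (hi x y) x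
  simp_rw [Finset.mul_sum]
  rw [integral_finsetSum _ fun x _ => integrable_finsetSum _ fun y _ => hI x y]
  refine Finset.sum_congr rfl fun x _ => ?_
  rw [integral_finsetSum _ fun y _ => hI x y]
  simp_rw [mul_comm (q _ x _)]

end IsAdmissible

end Marginals

/-! ### Solutions of the forward equation -/

section Forward

variable {𝒳 : Type*} [Fintype 𝒳]

/-- Bounded measurable nonnegative rates. -/
structure IsBoundedRate (q : ℝ → 𝒳 → 𝒳 → ℝ) (C : ℝ) : Prop where
  measurable : ∀ x y, Measurable fun s => q s x y
  nonneg : ∀ s x y, 0 ≤ q s x y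
  exitRate_le : ∀ s x, exitRate q s x ≤ C

theorem IsAdmissible.isBoundedRate {q : ℝ → 𝒳 → 𝒳 → ℝ} {C : ℝ} (hq : IsAdmissible q C) :
    IsBoundedRate q C := ⟨hq.measurable, hq.nonneg, hq.exitRate_le⟩

/-- A curve `p` of probability vectors which solves the Kolmogorov forward equation
`∂_t p_t = p_t A_t` in integrated form, `A_t` being the generator with rates `q t`. -/
structure IsForwardSolution (q : ℝ → 𝒳 → 𝒳 → ℝ) (p : ℝ → 𝒳 → ℝ) : Prop where
  measurable : ∀ x, Measurable fun s => p s x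
  nonneg : ∀ s x, 0 ≤ p s x
  sum_eq_one : ∀ s, ∑ x, p s x = 1
  eq_add_integral : ∀ (f : 𝒳 → ℝ) (t : ℝ), 0 ≤ t → ∑ x, p t x * f x = ∑ x, p 0 x * f x
    + ∫ u in (0 : ℝ)..t, ∑ x, p u x * ∑ y, q u x y * (f y - f x)

theorem abs_sum_mul_le {p w : 𝒳 → ℝ} {d : ℝ} (hp : ∀ x, 0 ≤ p x) (hs : ∑ x, p x = 1)
    (hw : ∀ x, |w x| ≤ d) : |∑ x, p x * w x| ≤ d := by
  calc _ ≤ ∑ x, |p x * w x| := Finset.abs_sum_le_sum_abs _ _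
    _ ≤ ∑ x, p x * d := Finset.sum_le_sum fun x _ => by
        rw [abs_mul, abs_of_nonneg (hp x)]
        exact mul_le_mul_of_nonneg_left (hw x) (hp x)
    _ = d := by rw [← Finset.sum_mul, hs, one_mul]

theorem abs_sum_mul_sub_le {q f : 𝒳 → ℝ} {C d : ℝ} (x : 𝒳) (hC : ∑ y, |q y| ≤ C)
    (hd : 0 ≤ d) (hf : ∀ y, |f y - f x| ≤ d) : |∑ y, q y * (f y - f x)| ≤ C * d := by
  calc _ ≤ ∑ y, |q y * (f y - f x)| := Finset.abs_sum_le_sum_abs _ _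
    _ ≤ ∑ y, |q y| * d := Finset.sum_le_sum fun y _ => by
        rw [abs_mul]
        exact mul_le_mul_of_nonneg_left (hf y) (abs_nonneg _)
    _ ≤ C * d := by rw [← Finset.sum_mul]; exact mul_le_mul_of_nonneg_right hC hd

namespace IsBoundedRate

variable {q : ℝ → 𝒳 → 𝒳 → ℝ} {C : ℝ} (hq : IsBoundedRate q C)
include hq

theorem sum_abs_le (s : ℝ) (x : 𝒳) : ∑ y, |q s x y| ≤ C := by
  simp_rw [abs_of_nonneg (hq.nonneg s x _)]
  exact hq.exitRate_le s x

theorem le_bound (s : ℝ) (x y : 𝒳) : q s x y ≤ C :=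
  (Finset.single_le_sum (fun y _ => hq.nonneg s x y) (Finset.mem_univ y)).trans
    (hq.exitRate_le s x)

theorem comp_add (T : ℝ) : IsBoundedRate (fun s => q (T + s)) C :=
  ⟨fun x y => (hq.measurable x y).comp (measurable_const_add T), fun s => hq.nonneg (T + s),
    fun s => hq.exitRate_le (T + s)⟩

end IsBoundedRate

namespace IsForwardSolution

variable {q : ℝ → 𝒳 → 𝒳 → ℝ} {C : ℝ} {p : ℝ → 𝒳 → ℝ} (hp : IsForwardSolution q p)
  (hq : IsBoundedRate q C)
include hp

theorem le_one (s : ℝ) (x : 𝒳) : p s x ≤ 1 := by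
  rw [← hp.sum_eq_one s]
  exact Finset.single_le_sum (fun y _ => hp.nonneg s y) (Finset.mem_univ x)

include hq

theorem integrable_mul_rate (s t : ℝ) (x y : 𝒳) :
    IntervalIntegrable (fun u => p u x * q u x y) volume s t := by
  refine (intervalIntegrable_const (c := C)).mono_fun'
    ((hp.measurable x).mul (hq.measurable x y)).aestronglyMeasurable ?_
  filter_upwards with u
  rw [Real.norm_of_nonneg (mul_nonneg (hp.nonneg u x) (hq.nonneg u x y))]
  calc p u x * q u x y ≤ 1 * q u x y :=
        mul_le_mul_of_nonneg_right (hp.le_one u x) (hq.nonneg u x y)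
    _ ≤ C := by rw [one_mul]; exact hq.le_bound u x y

theorem integrable_flux (s t : ℝ) (f : 𝒳 → ℝ) :
    IntervalIntegrable (fun u => ∑ x, p u x * ∑ y, q u x y * (f y - f x)) volume s t := by
  simp_rw [Finset.mul_sum, ← mul_assoc]
  rw [intervalIntegrable_iff]
  refine integrable_finsetSum _ fun x _ => integrable_finsetSum _ fun y _ => ?_
  exact (intervalIntegrable_iff.1 (hp.integrable_mul_rate hq s t x y)).mul_const _

theorem comp_add {T : ℝ} (hT : 0 ≤ T) :
    IsForwardSolution (fun s => q (T + s)) (fun s => p (T + s)) := by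
  refine ⟨fun x => (hp.measurable x).comp (measurable_const_add T), fun s => hp.nonneg (T + s),
    fun s => hp.sum_eq_one (T + s), fun f t ht => ?_⟩
  have h1 := hp.eq_add_integral f (T + t) (by linarith)
  have h2 := hp.eq_add_integral f T hT
  rw [← intervalIntegral.integral_add_adjacent_intervals (hp.integrable_flux hq 0 T f)
    (hp.integrable_flux hq T (T + t) f)] at h1
  have h3 := intervalIntegral.integral_comp_add_left (a := 0) (b := t)
    (fun u => ∑ x, p u x * ∑ y, q u x y * (f y - f x)) T
  simp only [add_zero] at h3 ⊢
  rw [h3, h1, h2]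
  ring

/-- The forward equation for time-dependent test functions. -/
theorem eq_add_integral_of_hasDerivAt {φ φ' : ℝ → 𝒳 → ℝ}
    (hφ : ∀ s x, HasDerivAt (fun s => φ s x) (φ' s x) s)
    (hφ' : ∀ x, Continuous fun s => φ' s x) {t : ℝ} (ht : 0 ≤ t) :
    ∑ x, p t x * φ t x = ∑ x, p 0 x * φ 0 x
      + ∫ u in (0 : ℝ)..t, ∑ x, p u x * (φ' u x + ∑ y, q u x y * (φ u y - φ u x)) := by
  classical
  let δ : 𝒳 → 𝒳 → ℝ := fun z x => if x = z then 1 else 0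
  let b : 𝒳 → ℝ → ℝ := fun z u => ∑ x, p u x * ∑ y, q u x y * (δ z y - δ z x)
  have hb : ∀ z, IntervalIntegrable (b z) volume 0 t := fun z => hp.integrable_flux hq 0 t (δ z)
  have hpb : ∀ z s, 0 ≤ s → p s z = p 0 z + ∫ u in (0 : ℝ)..s, b z u := by
    intro z s hs
    simpa [δ] using hp.eq_add_integral (δ z) s hs
  -- `P z` coincides with `p · z` only at nonnegative times, but it is an absolutely continuous
  -- primitive on the whole interval, which is what integration by parts requires.
  let P : 𝒳 → ℝ → ℝ := fun z s => p 0 z + ∫ u in (0 : ℝ)..s, b z u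
  have hPac : ∀ z, AbsolutelyContinuousOnInterval (P z) 0 t := fun z =>
    (LipschitzOnWith.absolutelyContinuousOnInterval
      ((LipschitzWith.const (p 0 z)).lipschitzOnWith)).add
      ((hb z).absolutelyContinuousOnInterval_intervalIntegral (by simp))
  have hφac : ∀ z, AbsolutelyContinuousOnInterval (fun s => φ s z) 0 t := fun z => by
    refine ContDiffOn.absolutelyContinuousOnInterval (ContDiff.contDiffOn ?_)
    refine contDiff_one_iff_deriv.2 ⟨fun s => (hφ s z).differentiableAt, ?_⟩
    have : deriv (fun s => φ s z) = fun s => φ' s z := funext fun s => (hφ s z).deriv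
    rw [this]
    exact hφ' z
  have hφc : ∀ z, Continuous fun s => φ s z := fun z =>
    continuous_iff_continuousAt.2 fun s => (hφ s z).continuousAt
  have h1 : ∀ z, p t z * φ t z - p 0 z * φ 0 z
      = ∫ u in (0 : ℝ)..t, (b z u * φ u z + p u z * φ' u z) := by
    intro z
    have h2 := (hPac z).integral_deriv_mul_eq_sub (hφac z)
    have h3 : P z 0 = p 0 z := by simp [P]
    have h4 : P z t = p t z := (hpb z t ht).symm
    rw [h3, h4] at h2
    rw [← h2]
    refine intervalIntegral.integral_congr_ae ?_
    filter_upwards [(hb z).ae_hasDerivAt_integral] with u hu hut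
    have h5 : HasDerivAt (P z) (b z u) u :=
      (hu (Set.uIoc_subset_uIcc hut) 0 (by simp)).const_add (p 0 z)
    have hu0 : 0 ≤ u := by
      rw [Set.uIoc_of_le ht] at hut
      exact hut.1.le
    rw [h5.deriv, (hφ u z).deriv, hpb z u hu0]
  have hint : ∀ z, IntervalIntegrable (fun u => b z u * φ u z + p u z * φ' u z) volume 0 t := by
    intro z
    refine ((hb z).mul_continuousOn (hφc z).continuousOn).add ?_
    have : IntervalIntegrable (fun u => p u z) volume 0 t := by
      refine (intervalIntegrable_const (c := (1 : ℝ))).mono_fun'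
        (hp.measurable z).aestronglyMeasurable (Eventually.of_forall fun u => ?_)
      change ‖p u z‖ ≤ 1
      rw [Real.norm_of_nonneg (hp.nonneg u z)]
      exact hp.le_one u z
    exact this.mul_continuousOn (hφ' z).continuousOn
  rw [← sub_eq_iff_eq_add', ← Finset.sum_sub_distrib, Finset.sum_congr rfl fun z _ => h1 z,
    ← intervalIntegral.integral_finsetSum fun z _ => hint z]
  refine intervalIntegral.integral_congr fun u _ => ?_
  simp only [mul_add, Finset.sum_add_distrib]
  rw [add_comm]
  congr 1
  simp only [b, Finset.sum_mul, Finset.mul_sum]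
  rw [Finset.sum_comm]
  refine Finset.sum_congr rfl fun x _ => ?_
  rw [Finset.sum_comm]
  refine Finset.sum_congr rfl fun y _ => ?_
  have : ∀ z, p u x * (q u x y * (δ z y - δ z x)) * φ u z
      = p u x * q u x y * (δ z y * φ u z) - p u x * q u x y * (δ z x * φ u z) := fun z => by ring
  simp_rw [this, Finset.sum_sub_distrib, ← Finset.mul_sum]
  simp [δ]
  ring

end IsForwardSolution

end Forward

theorem IsAdmissible.isForwardSolution {𝒳 : Type*} [Fintype 𝒳] [MeasurableSpace 𝒳]
    [MeasurableSingletonClass 𝒳] {q : ℝ → 𝒳 → 𝒳 → ℝ} {C : ℝ} (hq : IsAdmissible q C)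
    (ν : Measure 𝒳) [IsProbabilityMeasure ν] : IsForwardSolution q (marginal q ν) := by
  refine ⟨measurable_marginal q ν, marginal_nonneg q ν, sum_marginal q ν, fun f t ht => ?_⟩
  simp_rw [hq.marginal_zero]
  exact hq.forward_equation ν f ht

/-! ### Uniqueness, periodicity and positivity of forward solutions -/

section Forward

variable {𝒳 : Type*} [Fintype 𝒳]

namespace IsForwardSolution

variable {q : ℝ → 𝒳 → 𝒳 → ℝ} {C : ℝ} {p p' : ℝ → 𝒳 → ℝ}

/-- Grönwall: testing both equations on indicators of points bounds the `ℓ¹` distance `D` by a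
constant times its own time integral. -/
theorem eq_of_zero_eq (hp : IsForwardSolution q p) (hp' : IsForwardSolution q p')
    (hq : IsBoundedRate q C) (h0 : p 0 = p' 0) {t : ℝ} (ht : 0 ≤ t) : p t = p' t := by
  classical
  let δ : 𝒳 → 𝒳 → ℝ := fun z x => if x = z then 1 else 0
  have hδ : ∀ z x y, |δ z y - δ z x| ≤ 1 := fun z x y => by
    simp only [δ]
    split_ifs <;> norm_num
  let a : 𝒳 → ℝ → 𝒳 → ℝ := fun z u x => ∑ y, q u x y * (δ z y - δ z x)
  have ha : ∀ z u x, |a z u x| ≤ C := fun z u x => by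
    have := abs_sum_mul_sub_le (f := δ z) x (hq.sum_abs_le u x) zero_le_one fun y => hδ z x y
    rwa [mul_one] at this
  -- the distance of the two curves, constant to the left of `0`
  let P : (ℝ → 𝒳 → ℝ) → ℝ → 𝒳 → ℝ := fun p s z => ∫ u in (0 : ℝ)..s, ∑ x, p u x * a z u x
  let D : ℝ → ℝ := fun s => ∑ z, |P p s z - P p' s z|
  have hPc : ∀ p, IsForwardSolution q p → ∀ z, Continuous fun s => P p s z := fun p hp z =>
    intervalIntegral.continuous_primitive (fun c d => hp.integrable_flux hq c d (δ z)) 0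
  have hDc : Continuous D := continuous_finsetSum _ fun z _ =>
    ((hPc p hp z).sub (hPc p' hp' z)).abs
  have hpP : ∀ p, IsForwardSolution q p → ∀ z s, 0 ≤ s → p s z = p 0 z + P p s z := by
    intro p hp z s hs
    simpa [δ] using hp.eq_add_integral (δ z) s hs
  have hD : ∀ s, 0 ≤ s → D s = ∑ z, |p s z - p' s z| := fun s hs =>
    Finset.sum_congr rfl fun z _ => by
      rw [hpP p hp z s hs, hpP p' hp' z s hs, h0]
      ring_nf
  have hD0 : ∀ s, 0 ≤ D s := fun s => Finset.sum_nonneg fun z _ => abs_nonneg _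
  -- Grönwall's inequality in differential form is applied to this primitive, since `D` is
  -- continuous but need not be differentiable.
  let φ : ℝ → ℝ := fun s => ∫ u in (0 : ℝ)..s, D u
  have hφ : ∀ s, HasDerivAt φ (D s) s := fun s =>
    intervalIntegral.integral_hasDerivAt_right (hDc.intervalIntegrable _ _)
      hDc.stronglyMeasurable.stronglyMeasurableAtFilter hDc.continuousAt
  have hle : ∀ s, 0 ≤ s → D s ≤ Fintype.card 𝒳 * C * φ s := by
    intro s hs
    have h1 : ∀ z, |P p s z - P p' s z| ≤ C * φ s := by
      intro z
      have h2 : P p s z - P p' s z = ∫ u in (0 : ℝ)..s, ∑ x, (p u x - p' u x) * a z u x := by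
        simp only [P]
        rw [← intervalIntegral.integral_sub (hp.integrable_flux hq 0 s (δ z))
          (hp'.integrable_flux hq 0 s (δ z))]
        simp_rw [sub_mul, Finset.sum_sub_distrib]
        rfl
      have h3 : C * φ s = ∫ u in (0 : ℝ)..s, C * D u := by
        rw [intervalIntegral.integral_const_mul]
      rw [h2, h3, ← Real.norm_eq_abs]
      refine intervalIntegral.norm_integral_le_of_norm_le hs ?_
        ((hDc.const_mul C).intervalIntegrable _ _)
      refine Eventually.of_forall fun u hu => ?_
      rw [hD u hu.1.le, Real.norm_eq_abs, Finset.mul_sum]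
      refine (Finset.abs_sum_le_sum_abs _ _).trans (Finset.sum_le_sum fun x _ => ?_)
      rw [abs_mul, mul_comm]
      exact mul_le_mul_of_nonneg_right (ha z u x) (abs_nonneg _)
    calc D s ≤ ∑ _z : 𝒳, C * φ s := Finset.sum_le_sum fun z _ => h1 z
      _ = _ := by simp [mul_assoc]
  have hφ0 : φ 0 = 0 := by simp [φ]
  have hφnn : ∀ s, 0 ≤ s → 0 ≤ φ s := fun s hs =>
    intervalIntegral.integral_nonneg hs fun u _ => hD0 u
  have hgr := norm_le_gronwallBound_of_norm_deriv_right_le (f := φ) (f' := D) (δ := 0)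
    (K := Fintype.card 𝒳 * C) (ε := 0) (a := 0) (b := t)
    (fun s _ => (hφ s).continuousAt.continuousWithinAt)
    (fun s _ => (hφ s).hasDerivWithinAt) (by simp [hφ0]) (fun s hs => by
      rw [Real.norm_of_nonneg (hD0 s), Real.norm_of_nonneg (hφnn s hs.1), add_zero]
      exact hle s hs.1) t ⟨ht, le_rfl⟩
  simp only [gronwallBound_ε0, zero_mul] at hgr
  have h4 : φ t = 0 := norm_le_zero_iff.1 hgr
  have h5 : D t ≤ 0 := by simpa [h4] using hle t ht
  rw [hD t ht] at h5
  funext z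
  have h6 := (Finset.sum_eq_zero_iff_of_nonneg fun z _ => abs_nonneg _).1
    (le_antisymm h5 (Finset.sum_nonneg fun z _ => abs_nonneg (p t z - p' t z))) z
    (Finset.mem_univ z)
  exact sub_eq_zero.1 (abs_eq_zero.1 h6)

/-- As the rates are periodic, the curve shifted by `T` solves the same equation with the same
initial value. Uniqueness identifies the two, and induction gives all multiples of `T`. -/
theorem add_mul_eq (hp : IsForwardSolution q p) (hq : IsBoundedRate q C) {T : ℝ} (hT : 0 ≤ T)
    (hper : ∀ x y, Function.Periodic (fun s => q s x y) T) (h0 : p T = p 0) (n : ℕ) {t : ℝ}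
    (ht : 0 ≤ t) : p (t + n * T) = p t := by
  have hqT : (fun s => q (T + s)) = q := by
    funext s x y
    rw [add_comm]
    exact hper x y s
  have h1 := hp.comp_add hq hT
  rw [hqT] at h1
  have h2 : ∀ s, 0 ≤ s → p (T + s) = p s := fun s hs =>
    h1.eq_of_zero_eq hp hq (by simpa using h0) hs
  induction n with
  | zero => simp
  | succ n ih =>
    rw [← ih, ← h2 (t + n * T) (by positivity)]
    congr 1
    push_cast
    ring

/-- Testing with `e^{Cs}` times the indicator of `y` turns the outflow `-exitRate` into `C -
exitRate ≥ 0`. All terms on the right are then nonnegative, from which positivity can be read off.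
-/
theorem exp_mul_eq (hp : IsForwardSolution q p) (hq : IsBoundedRate q C) (y : 𝒳) {t : ℝ}
    (ht : 0 ≤ t) : Real.exp (C * t) * p t y = p 0 y + ∫ u in (0 : ℝ)..t, Real.exp (C * u) *
      (p u y * (C - exitRate q u y) + ∑ x, p u x * q u x y) := by
  classical
  have h1 := hp.eq_add_integral_of_hasDerivAt hq
    (φ := fun s x => if x = y then Real.exp (C * s) else 0)
    (φ' := fun s x => if x = y then C * Real.exp (C * s) else 0)
    (fun s x => by
      by_cases hx : x = y
      · simp only [hx, if_true]
        have := ((hasDerivAt_id s).const_mul C).exp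
        simpa [mul_comm] using this
      · simpa [hx] using hasDerivAt_const s (0 : ℝ))
    (fun x => by
      by_cases hx : x = y
      · simp only [hx, if_true]; fun_prop
      · simpa [hx] using continuous_const) ht
  simp only [mul_ite, mul_zero, Finset.sum_ite_eq', Finset.mem_univ, if_true, Real.exp_zero,
    mul_one] at h1
  rw [mul_comm, h1, add_right_inj]
  refine intervalIntegral.integral_congr fun u _ => ?_
  have h2 : ∀ x, ∑ z, q u x z * ((if z = y then Real.exp (C * u) else 0)
      - if x = y then Real.exp (C * u) else 0)
      = q u x y * Real.exp (C * u) - if x = y then exitRate q u x * Real.exp (C * u) else 0 := by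
    intro x
    simp only [mul_sub, Finset.sum_sub_distrib, mul_ite, mul_zero, Finset.sum_ite_eq',
      Finset.mem_univ, if_true]
    split_ifs
    · rw [exitRate, Finset.sum_mul]
    · simp
  simp only [h2]
  simp only [mul_add, mul_sub, Finset.sum_add_distrib, Finset.sum_sub_distrib, mul_ite,
    mul_zero, Finset.sum_ite_eq', Finset.mem_univ, if_true, Finset.mul_sum]
  have h3 : ∑ x, p u x * (q u x y * Real.exp (C * u)) = ∑ x, Real.exp (C * u) * (p u x * q u x y) :=
    Finset.sum_congr rfl fun x _ => by ring
  rw [h3]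
  ring

theorem intervalIntegrable_exp_mul (hp : IsForwardSolution q p) (hq : IsBoundedRate q C) (y : 𝒳)
    (s t : ℝ) : IntervalIntegrable (fun u => Real.exp (C * u) *
      (p u y * (C - exitRate q u y) + ∑ x, p u x * q u x y)) volume s t := by
  refine IntervalIntegrable.continuousOn_mul ?_ (by fun_prop)
  have h1 : ∀ z, IntervalIntegrable (fun u => p u y * q u y z) volume s t := fun z =>
    hp.integrable_mul_rate hq s t y z
  have h2 : IntervalIntegrable (fun u => p u y) volume s t := by
    refine (intervalIntegrable_const (c := (1 : ℝ))).mono_fun'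
      (hp.measurable y).aestronglyMeasurable (Eventually.of_forall fun u => ?_)
    change ‖p u y‖ ≤ 1
    rw [Real.norm_of_nonneg (hp.nonneg u y)]
    exact hp.le_one u y
  have h3 : IntervalIntegrable (fun u => p u y * (C - exitRate q u y)) volume s t := by
    simp_rw [mul_sub, exitRate, Finset.mul_sum]
    refine (h2.mul_const C).sub ?_
    rw [intervalIntegrable_iff]
    exact integrable_finsetSum _ fun z _ => intervalIntegrable_iff.1 (h1 z)
  refine h3.add ?_
  rw [intervalIntegrable_iff]
  exact integrable_finsetSum _ fun x _ =>
    intervalIntegrable_iff.1 (hp.integrable_mul_rate hq s t x y)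

theorem pos_of_pos_zero (hp : IsForwardSolution q p) (hq : IsBoundedRate q C) {y : 𝒳}
    (h0 : 0 < p 0 y) {t : ℝ} (ht : 0 ≤ t) : 0 < p t y := by
  have h1 := hp.exp_mul_eq hq y ht
  have h2 : 0 ≤ ∫ u in (0 : ℝ)..t, Real.exp (C * u) *
      (p u y * (C - exitRate q u y) + ∑ x, p u x * q u x y) :=
    intervalIntegral.integral_nonneg ht fun u _ => mul_nonneg (Real.exp_pos _).le
      (add_nonneg (mul_nonneg (hp.nonneg u y) (sub_nonneg.2 (hq.exitRate_le u y)))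
        (Finset.sum_nonneg fun x _ => mul_nonneg (hp.nonneg u x) (hq.nonneg u x y)))
  refine pos_of_mul_pos_right ?_ (Real.exp_pos (C * t)).le
  rw [h1]
  linarith

/-- The inflow from `x` makes the integrand of `exp_mul_eq` strictly positive at every positive
time. The rate must be positive at all times, which holds for `e^{λg} r` whenever `r x y > 0`. -/
theorem pos_of_rate_pos (hp : IsForwardSolution q p) (hq : IsBoundedRate q C) {x y : 𝒳}
    (hxy : ∀ s, 0 < q s x y) (hx : ∀ t, 0 < t → 0 < p t x) {t : ℝ} (ht : 0 < t) : 0 < p t y := by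
  have h1 := hp.exp_mul_eq hq y ht.le
  have h2 : 0 < ∫ u in (0 : ℝ)..t, Real.exp (C * u) *
      (p u y * (C - exitRate q u y) + ∑ x, p u x * q u x y) := by
    refine intervalIntegral.intervalIntegral_pos_of_pos_on
      (hp.intervalIntegrable_exp_mul hq y 0 t) (fun u hu => ?_) ht
    refine mul_pos (Real.exp_pos _) (add_pos_of_nonneg_of_pos
      (mul_nonneg (hp.nonneg u y) (sub_nonneg.2 (hq.exitRate_le u y))) ?_)
    exact Finset.sum_pos' (fun x _ => mul_nonneg (hp.nonneg u x) (hq.nonneg u x y))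
      ⟨x, Finset.mem_univ x, mul_pos (hx u hu.1) (hxy u)⟩
  refine pos_of_mul_pos_right ?_ (Real.exp_pos (C * t)).le
  rw [h1]
  have := hp.nonneg 0 y
  linarith

theorem pos_of_irreducible (hp : IsForwardSolution q p) (hq : IsBoundedRate q C) {x y : 𝒳}
    (hirr : Relation.ReflTransGen (fun a b => ∀ s, 0 < q s a b) x y) (h0 : 0 < p 0 x) :
    ∀ t, 0 < t → 0 < p t y := by
  induction hirr with
  | refl => exact fun t ht => hp.pos_of_pos_zero hq h0 ht.le
  | tail _ hbc ih => exact fun t ht => hp.pos_of_rate_pos hq hbc ih ht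

end IsForwardSolution

end Forward

/-! ### Stochastic matrices with positive entries -/

section Stochastic

theorem measure_eq_of_real_singleton {𝒳 : Type*} [Finite 𝒳] [MeasurableSpace 𝒳]
    {μ μ' : Measure 𝒳} [IsProbabilityMeasure μ]
    [IsProbabilityMeasure μ'] (h : ∀ x, μ.real {x} = μ'.real {x}) : μ = μ' := by
  refine Measure.ext_of_singleton fun x => ?_
  have := h x
  rwa [Measure.real, Measure.real, ENNReal.toReal_eq_toReal_iff' (measure_ne_top _ _)
    (measure_ne_top _ _)] at this

theorem exists_pos_le {ι : Type*} [Finite ι] (F : ι → ℝ) (hF : ∀ i, 0 < F i) :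
    ∃ ε, 0 < ε ∧ ε < 1 ∧ ∀ i, ε ≤ F i := by
  rcases isEmpty_or_nonempty ι with h | h
  · exact ⟨1 / 2, by norm_num, by norm_num, fun i => h.elim i⟩
  · obtain ⟨i, hi⟩ := Finite.exists_min F
    exact ⟨min (F i) (1 / 2), lt_min (hF i) (by norm_num),
      (min_le_right _ _).trans_lt (by norm_num), fun j => (min_le_left _ _).trans (hi j)⟩

variable {𝒳 : Type*} [Fintype 𝒳] {P : 𝒳 → 𝒳 → ℝ}

/-- `P - 1` annihilates the constants, so it is singular and also has a left null vector `v`. Then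
`|v| ≤ |v| P` entrywise, while the total masses agree because rows sum to one. Equality holds
throughout, and `|v|` can be normalised. -/
theorem exists_invariant_vector [Nonempty 𝒳] (h0 : ∀ x y, 0 ≤ P x y) (h1 : ∀ x, ∑ y, P x y = 1) :
    ∃ w : 𝒳 → ℝ, (∀ x, 0 ≤ w x) ∧ ∑ x, w x = 1 ∧ ∀ y, ∑ x, w x * P x y = w y := by
  classical
  let M : Matrix 𝒳 𝒳 ℝ := Matrix.of P - 1
  have hdet : M.det = 0 := by
    refine Matrix.exists_mulVec_eq_zero_iff.1 ⟨fun _ => 1, ?_, ?_⟩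
    · exact Function.ne_iff.2 ⟨Classical.arbitrary 𝒳, one_ne_zero⟩
    · ext x
      simp only [M, Matrix.sub_mulVec, Matrix.one_mulVec]
      simp [Matrix.mulVec, dotProduct, h1]
  obtain ⟨v, hv, hvM⟩ := Matrix.exists_vecMul_eq_zero_iff.2 hdet
  have hvP : ∀ y, ∑ x, v x * P x y = v y := fun y => by
    have := congrFun hvM y
    simp only [M, Matrix.vecMul_sub, Matrix.vecMul_one, Pi.sub_apply, Pi.zero_apply] at this
    exact sub_eq_zero.1 this
  have hle : ∀ y ∈ Finset.univ, |v y| ≤ ∑ x, |v x| * P x y := fun y _ => by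
    rw [← hvP y]
    refine (Finset.abs_sum_le_sum_abs _ _).trans_eq (Finset.sum_congr rfl fun x _ => ?_)
    rw [abs_mul, abs_of_nonneg (h0 x y)]
  have hsum : ∑ y, |v y| = ∑ y, ∑ x, |v x| * P x y := by
    rw [Finset.sum_comm]
    simp_rw [← Finset.mul_sum, h1, mul_one]
  have heq := (Finset.sum_eq_sum_iff_of_le hle).1 hsum
  have hpos : 0 < ∑ x, |v x| := by
    obtain ⟨x, hx⟩ := Function.ne_iff.1 hv
    exact Finset.sum_pos' (fun x _ => abs_nonneg _) ⟨x, Finset.mem_univ x, abs_pos.2 hx⟩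
  refine ⟨fun x => |v x| / ∑ x, |v x|, fun x => by positivity, ?_, fun y => ?_⟩
  · rw [← Finset.sum_div, div_self hpos.ne']
  · simp_rw [div_mul_eq_mul_div]
    rw [← Finset.sum_div, ← heq y (Finset.mem_univ y)]

/-- A stochastic matrix with entries at least `ε` contracts oscillations. -/
theorem osc_contraction (h0 : ∀ x y, 0 ≤ P x y) (h1 : ∀ x, ∑ y, P x y = 1) {ε : ℝ}
    (hε : ∀ x y, ε ≤ P x y) {f : 𝒳 → ℝ} {d : ℝ} (hf : ∀ a b, |f a - f b| ≤ d)
    (a b : 𝒳) : |∑ y, P a y * f y - ∑ y, P b y * f y| ≤ (1 - ε) * d := by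
  classical
  -- Every row average lies in `[f m, f m + (1 - ε) * d]` for a minimiser `m`: the row puts mass at
  -- least `ε` on `m`, and elsewhere `f` exceeds `f m` by at most `d`.
  obtain ⟨m, -, hm⟩ := Finset.exists_min_image Finset.univ f ⟨a, Finset.mem_univ a⟩
  have hlow : ∀ x, f m ≤ ∑ y, P x y * f y := fun x => by
    calc f m = ∑ y, P x y * f m := by rw [← Finset.sum_mul, h1, one_mul]
      _ ≤ _ := Finset.sum_le_sum fun y hy => mul_le_mul_of_nonneg_left (hm y hy) (h0 x y)
  have hup : ∀ x, ∑ y, P x y * f y - f m ≤ (1 - ε) * d := fun x => by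
    have h2 : ∑ y, P x y * f y - f m = ∑ y, P x y * (f y - f m) := by
      simp_rw [mul_sub, Finset.sum_sub_distrib, ← Finset.sum_mul, h1, one_mul]
    have h3 : ∑ y, P x y * (f y - f m) ≤ ∑ y, P x y * (if y = m then 0 else d) :=
      Finset.sum_le_sum fun y _ => mul_le_mul_of_nonneg_left (by
        split_ifs with h
        · simp [h]
        · exact (le_abs_self _).trans (hf y m)) (h0 x y)
    have h4 : ∑ y, P x y * (if y = m then 0 else d) = (1 - P x m) * d := by
      have : ∀ y, P x y * (if y = m then 0 else d) = P x y * d - if y = m then P x y * d else 0 :=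
        fun y => by split_ifs <;> simp
      simp_rw [this, Finset.sum_sub_distrib, ← Finset.sum_mul, h1]
      simp
      ring
    have hd : 0 ≤ d := (abs_nonneg _).trans (hf m m)
    have h5 : (1 - P x m) * d ≤ (1 - ε) * d :=
      mul_le_mul_of_nonneg_right (by linarith [hε x m]) hd
    linarith
  rw [abs_le]
  constructor <;> linarith [hlow a, hlow b, hup a, hup b]

theorem abs_sum_sub_sum_le {w w' f : 𝒳 → ℝ} {d : ℝ} (hw0 : ∀ x, 0 ≤ w x) (hw : ∑ x, w x = 1)
    (hw0' : ∀ x, 0 ≤ w' x) (hw' : ∑ x, w' x = 1)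
    (hf : ∀ a b, |f a - f b| ≤ d) : |∑ x, w x * f x - ∑ x, w' x * f x| ≤ d := by
  have h1 : ∑ x, w x * f x - ∑ x, w' x * f x = ∑ x, w x * ∑ y, w' y * (f x - f y) := by
    simp_rw [mul_sub, Finset.sum_sub_distrib, ← Finset.sum_mul, hw', one_mul, mul_sub,
      Finset.sum_sub_distrib, ← Finset.sum_mul, hw, one_mul]
  rw [h1]
  exact abs_sum_mul_le hw0 hw fun x => abs_sum_mul_le hw0' hw' fun y => hf x y

/-- An invariant vector gives `f` and `P^n f` the same mean, while `P^n f` has oscillation at most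
`(1 - ε)^n` times that of `f`. Two such means therefore agree in the limit. -/
theorem invariant_vector_unique [Nonempty 𝒳] (hpos : ∀ x y, 0 < P x y)
    (h1 : ∀ x, ∑ y, P x y = 1) {w w' : 𝒳 → ℝ} (hw0 : ∀ x, 0 ≤ w x) (hw : ∑ x, w x = 1)
    (hwP : ∀ y, ∑ x, w x * P x y = w y) (hw0' : ∀ x, 0 ≤ w' x) (hw' : ∑ x, w' x = 1)
    (hwP' : ∀ y, ∑ x, w' x * P x y = w' y) : w = w' := by
  classical
  obtain ⟨ε, hε0, hε1, hε⟩ := exists_pos_le (fun z : 𝒳 × 𝒳 => P z.1 z.2)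
    fun z => hpos z.1 z.2
  have hinv : ∀ u : 𝒳 → ℝ, (∀ y, ∑ x, u x * P x y = u y) → ∀ f : 𝒳 → ℝ,
      ∑ x, u x * ∑ y, P x y * f y = ∑ x, u x * f x := fun u hu f => by
    simp_rw [Finset.mul_sum, ← mul_assoc]
    rw [Finset.sum_comm]
    simp_rw [← Finset.sum_mul, hu]
  have key : ∀ (n : ℕ) (f : 𝒳 → ℝ) (d : ℝ), (∀ a b, |f a - f b| ≤ d) →
      |∑ x, w x * f x - ∑ x, w' x * f x| ≤ (1 - ε) ^ n * d := by
    intro n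
    induction n with
    | zero => intro f d hf; simpa using abs_sum_sub_sum_le hw0 hw hw0' hw' hf
    | succ n ih =>
      intro f d hf
      rw [← hinv w hwP f, ← hinv w' hwP' f, pow_succ, mul_assoc]
      exact ih _ _ (osc_contraction (fun x y => (hpos x y).le) h1 (fun x y => hε (x, y)) hf)
  funext z
  have h2 : ∀ n : ℕ, |w z - w' z| ≤ (1 - ε) ^ n * 1 := fun n => by
    have := key n (fun x => if x = z then 1 else 0) 1 fun a b => by
      split_ifs <;> norm_num
    simpa using this
  have h3 : Tendsto (fun n : ℕ => (1 - ε) ^ n * 1) atTop (𝓝 (0 * 1)) :=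
    (tendsto_pow_atTop_nhds_zero_of_lt_one (by linarith) (by linarith)).mul_const 1
  rw [zero_mul] at h3
  have h4 : |w z - w' z| ≤ 0 := ge_of_tendsto' h3 h2
  exact sub_eq_zero.1 (abs_eq_zero.1 (le_antisymm h4 (abs_nonneg _)))

variable [MeasurableSpace 𝒳] [MeasurableSingletonClass 𝒳]

theorem exists_measure_real_eq {w : 𝒳 → ℝ} (hw0 : ∀ x, 0 ≤ w x) (hw : ∑ x, w x = 1) :
    ∃ μ : Measure 𝒳, IsProbabilityMeasure μ ∧ ∀ x, μ.real {x} = w x := by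
  classical
  let μ : Measure 𝒳 := ∑ x, ENNReal.ofReal (w x) • Measure.dirac x
  have hx : ∀ x, μ {x} = ENNReal.ofReal (w x) := fun x => by
    simp only [μ, Measure.finsetSum_apply, Measure.smul_apply, smul_eq_mul]
    rw [Finset.sum_eq_single x]
    · simp
    · intro y _ hyx
      simp [hyx]
    · simp
  refine ⟨μ, ⟨?_⟩, fun x => ?_⟩
  · simp only [μ, Measure.finsetSum_apply, Measure.smul_apply, smul_eq_mul, measure_univ, mul_one]
    rw [← ENNReal.ofReal_sum_of_nonneg fun x _ => hw0 x, hw, ENNReal.ofReal_one]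
  · rw [Measure.real, hx, ENNReal.toReal_ofReal (hw0 x)]

theorem sum_real_singleton (μ : Measure 𝒳) [IsProbabilityMeasure μ] : ∑ x, μ.real {x} = 1 := by
  rw [sum_measureReal_singleton]
  simp

theorem existsUnique_isInvariantProb [Nonempty 𝒳] (hpos : ∀ x y, 0 < P x y)
    (h1 : ∀ x, ∑ y, P x y = 1) : ∃! μ : Measure 𝒳, IsInvariantProb P μ := by
  obtain ⟨w, hw0, hw, hwP⟩ := exists_invariant_vector (fun x y => (hpos x y).le) h1
  obtain ⟨μ, hμ, hμw⟩ := exists_measure_real_eq hw0 hw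
  refine ⟨μ, ⟨hμ, fun y => by simp_rw [hμw, hwP]⟩, fun μ' ⟨hμ', hinv⟩ => ?_⟩
  refine measure_eq_of_real_singleton fun x => ?_
  rw [hμw]
  exact congrFun (invariant_vector_unique hpos h1 (fun x => measureReal_nonneg)
    (sum_real_singleton μ') hinv hw0 hw hwP) x

end Stochastic

/-! ### The unperturbed semigroup and the perturbed rates -/

section Rates

theorem perturbedRate_zero {𝒳 : Type*} (r : 𝒳 → 𝒳 → ℝ) (g : ℝ → 𝒳 → 𝒳 → ℝ) :
    perturbedRate r g 0 = fun _ => r := by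
  funext s x y
  simp [perturbedRate]

variable {𝒳 : Type*} [Fintype 𝒳]

/-- Irreducible time-independent jump rates. -/
structure IsIrreducibleRate (r : 𝒳 → 𝒳 → ℝ) : Prop where
  nonneg : ∀ x y, 0 ≤ r x y
  diag : ∀ x, r x x = 0
  irred : ∀ x y, Relation.ReflTransGen (fun a b => 0 < r a b) x y

theorem generator_apply (r : 𝒳 → 𝒳 → ℝ) (f : 𝒳 → ℝ) (x : 𝒳) :
    generator r f x = ∑ y, r x y * (f y - f x) := rfl

theorem hasDerivAt_semigroup (r : 𝒳 → 𝒳 → ℝ) (f : 𝒳 → ℝ) (s : ℝ) :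
    HasDerivAt (fun s => semigroup r s f) (generator r (semigroup r s f)) s := by
  have h1 := hasDerivAt_exp_smul_const' (𝕂 := ℝ) (generator r) s
  exact (h1.clm_apply (hasDerivAt_const s f)).congr_deriv (by simp [semigroup])

theorem continuous_semigroup (r : 𝒳 → 𝒳 → ℝ) (f : 𝒳 → ℝ) :
    Continuous fun s => semigroup r s f :=
  continuous_iff_continuousAt.2 fun s => (hasDerivAt_semigroup r f s).continuousAt

theorem continuous_semigroup_apply (r : 𝒳 → 𝒳 → ℝ) (f : 𝒳 → ℝ) (x : 𝒳) :
    Continuous fun s => semigroup r s f x :=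
  (continuous_apply x).comp (continuous_semigroup r f)

theorem semigroup_zero (r : 𝒳 → 𝒳 → ℝ) (f : 𝒳 → ℝ) : semigroup r 0 f = f := by
  simp [semigroup]

theorem semigroup_add (r : 𝒳 → 𝒳 → ℝ) (s t : ℝ) (f : 𝒳 → ℝ) :
    semigroup r (s + t) f = semigroup r s (semigroup r t f) := by
  let _ : NormedAlgebra ℚ ((𝒳 → ℝ) →L[ℝ] (𝒳 → ℝ)) := .restrictScalars ℚ ℝ _
  unfold semigroup
  rw [add_smul, NormedSpace.exp_add_of_commute]
  · rfl
  · exact ((Commute.refl (generator r)).smul_left s).smul_right t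

/-- Duhamel's formula: a solution of the forward equation with rates `q`, compared with the
semigroup of the constant rates `r`. -/
theorem IsForwardSolution.duhamel {q : ℝ → 𝒳 → 𝒳 → ℝ} {C : ℝ} {p : ℝ → 𝒳 → ℝ}
    (hp : IsForwardSolution q p) (hq : IsBoundedRate q C) (r : 𝒳 → 𝒳 → ℝ) (f : 𝒳 → ℝ) {t : ℝ}
    (ht : 0 ≤ t) : ∑ x, p t x * f x = ∑ x, p 0 x * semigroup r t f x
      + ∫ u in (0 : ℝ)..t, ∑ x, p u x * ∑ y, (q u x y - r x y)
        * (semigroup r (t - u) f y - semigroup r (t - u) f x) := by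
  -- The test function is `s ↦ e^{(t-s)𝓛} f`. Its time derivative cancels the part of the flux due
  -- to `r`, leaving the difference `q - r`.
  have h1 : ∀ s x, HasDerivAt (fun s => semigroup r (t - s) f x)
      (-generator r (semigroup r (t - s) f) x) s := fun s x =>
    (hasDerivAt_pi.1 (hasDerivAt_semigroup r f (t - s)) x).comp_const_sub t s
  have h2 := hp.eq_add_integral_of_hasDerivAt hq h1 (fun x => by
    refine Continuous.neg ((continuous_apply x).comp ((generator r).continuous.comp ?_))
    exact (continuous_semigroup r f).comp (by fun_prop)) ht
  simp only [sub_self, semigroup_zero, sub_zero] at h2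
  rw [h2, add_right_inj]
  refine intervalIntegral.integral_congr fun u _ => ?_
  refine Finset.sum_congr rfl fun x _ => ?_
  simp only [generator_apply, sub_mul, Finset.sum_sub_distrib]
  ring

theorem transProb_nonneg [MeasurableSpace 𝒳] (q : ℝ → 𝒳 → 𝒳 → ℝ) (t : ℝ) (x y : 𝒳) :
    0 ≤ transProb q t x y := measureReal_nonneg

theorem sum_transProb [MeasurableSpace 𝒳] [MeasurableSingletonClass 𝒳] (q : ℝ → 𝒳 → 𝒳 → ℝ)
    (t : ℝ) (x : 𝒳) : ∑ y, transProb q t x y = 1 :=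
  sum_marginal q (Measure.dirac x) t

namespace IsIrreducibleRate

variable {r : 𝒳 → 𝒳 → ℝ} (hr : IsIrreducibleRate r)
include hr

theorem exitRate_pos [Nontrivial 𝒳] (x : 𝒳) : 0 < ∑ y, r x y := by
  obtain ⟨y, hy⟩ := exists_ne x
  rcases Relation.ReflTransGen.cases_head (hr.irred x y) with h | ⟨z, hz, -⟩
  · exact absurd h.symm hy
  · exact Finset.sum_pos' (fun z _ => hr.nonneg x z) ⟨z, Finset.mem_univ z, hz⟩

theorem isAdmissible_perturbedRate {g : ℝ → 𝒳 → 𝒳 → ℝ} {G : ℝ}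
    (hg : ∀ x y, Measurable fun s => g s x y) (hG : ∀ s x y, |g s x y| ≤ G) (lam : ℝ) :
    IsAdmissible (perturbedRate r g lam) (Real.exp (|lam| * G) * ∑ x, ∑ y, r x y) := by
  have hlam : ∀ s x y, |lam * g s x y| ≤ |lam| * G := fun s x y => by
    rw [abs_mul]
    exact mul_le_mul_of_nonneg_left (hG s x y) (abs_nonneg _)
  refine ⟨fun x y => ?_, fun s x y => mul_nonneg (Real.exp_pos _).le (hr.nonneg x y),
    fun s x => by simp [perturbedRate, hr.diag], fun s x => ?_, ?_⟩
  · unfold perturbedRate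
    exact (Real.measurable_exp.comp ((hg x y).const_mul lam)).mul_const _
  · calc exitRate (perturbedRate r g lam) s x ≤ ∑ y, Real.exp (|lam| * G) * r x y :=
          Finset.sum_le_sum fun y _ => mul_le_mul_of_nonneg_right
            (Real.exp_le_exp.2 ((le_abs_self _).trans (hlam s x y))) (hr.nonneg x y)
      _ = Real.exp (|lam| * G) * ∑ y, r x y := by rw [Finset.mul_sum]
      _ ≤ _ := mul_le_mul_of_nonneg_left (Finset.single_le_sum (f := fun x => ∑ y, r x y)
          (fun x _ => Finset.sum_nonneg fun y _ => hr.nonneg x y) (Finset.mem_univ x))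
          (Real.exp_pos _).le
  · rcases subsingleton_or_nontrivial 𝒳 with h | h
    · exact Or.inl h
    · obtain ⟨ε, hε0, -, hε⟩ := exists_pos_le (fun x => ∑ y, r x y) hr.exitRate_pos
      refine Or.inr ⟨Real.exp (-(|lam| * G)) * ε, by positivity, fun s x => ?_⟩
      calc Real.exp (-(|lam| * G)) * ε ≤ Real.exp (-(|lam| * G)) * ∑ y, r x y :=
            mul_le_mul_of_nonneg_left (hε x) (Real.exp_pos _).le
        _ = ∑ y, Real.exp (-(|lam| * G)) * r x y := by rw [Finset.mul_sum]
        _ ≤ _ := Finset.sum_le_sum fun y _ => mul_le_mul_of_nonneg_right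
            (Real.exp_le_exp.2 (neg_le_of_abs_le (hlam s x y))) (hr.nonneg x y)

theorem isAdmissible : ∃ C, IsAdmissible (fun _ => r) C := by
  have h := hr.isAdmissible_perturbedRate (g := fun _ _ _ => 0) (G := 0)
    (fun _ _ => measurable_const) (fun _ _ _ => by simp) 0
  rw [perturbedRate_zero] at h
  exact ⟨_, h⟩

variable [MeasurableSpace 𝒳] [MeasurableSingletonClass 𝒳]

theorem transProb_perturbedRate_pos {g : ℝ → 𝒳 → 𝒳 → ℝ} {G : ℝ}
    (hg : ∀ x y, Measurable fun s => g s x y) (hG : ∀ s x y, |g s x y| ≤ G) (lam : ℝ)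
    {t : ℝ} (ht : 0 < t) (x y : 𝒳) : 0 < transProb (perturbedRate r g lam) t x y := by
  have hq := hr.isAdmissible_perturbedRate hg hG lam
  refine (hq.isForwardSolution (Measure.dirac x)).pos_of_irreducible hq.isBoundedRate (x := x) ?_ ?_
    t ht
  · refine Relation.ReflTransGen.mono (fun a b hab s => ?_) x y (hr.irred x y)
    exact mul_pos (Real.exp_pos _) hab
  · rw [hq.marginal_zero]
    simp [Measure.real]

theorem transProb_pos {t : ℝ} (ht : 0 < t) (x y : 𝒳) : 0 < transProb (fun _ => r) t x y := by
  have h := hr.transProb_perturbedRate_pos (g := fun _ _ _ => 0) (G := 0)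
    (fun _ _ => measurable_const) (fun _ _ _ => by simp) 0 ht x y
  rwa [perturbedRate_zero] at h

theorem sum_marginal_mul_eq (ν : Measure 𝒳) [IsProbabilityMeasure ν] {t : ℝ} (ht : 0 ≤ t)
    (f : 𝒳 → ℝ) :
    ∑ x, marginal (fun _ => r) ν t x * f x = ∑ x, ν.real {x} * semigroup r t f x := by
  obtain ⟨C, hq⟩ := hr.isAdmissible
  rw [(hq.isForwardSolution ν).duhamel hq.isBoundedRate r f ht]
  simp_rw [hq.marginal_zero]
  simp

theorem sum_transProb_mul_eq {t : ℝ} (ht : 0 ≤ t) (f : 𝒳 → ℝ) (x : 𝒳) :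
    ∑ y, transProb (fun _ => r) t x y * f y = semigroup r t f x := by
  classical
  have := hr.sum_marginal_mul_eq (Measure.dirac x) ht f
  simp_rw [transProb_eq_marginal, this]
  rw [Finset.sum_eq_single x]
  · simp [Measure.real]
  · intro y _ hyx
    simp [Measure.real, hyx.symm]
  · simp

/-- Oscillations decay exponentially under the semigroup. -/
theorem exists_osc_semigroup_le [Nonempty 𝒳] : ∃ K c : ℝ, 0 < K ∧ 0 < c ∧
    ∀ (f : 𝒳 → ℝ) (d : ℝ), (∀ a b, |f a - f b| ≤ d) → ∀ t, 0 ≤ t → ∀ a b,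
      |semigroup r t f a - semigroup r t f b| ≤ K * Real.exp (-(c * t)) * d := by
  obtain ⟨ε, hε0, hε1, hε⟩ := exists_pos_le
    (fun z : 𝒳 × 𝒳 => transProb (fun _ => r) 1 z.1 z.2) fun z => hr.transProb_pos one_pos z.1 z.2
  have hstep : ∀ (f : 𝒳 → ℝ) (d : ℝ), (∀ a b, |f a - f b| ≤ d) → ∀ a b,
      |semigroup r 1 f a - semigroup r 1 f b| ≤ (1 - ε) * d := fun f d hf a b => by
    rw [← hr.sum_transProb_mul_eq zero_le_one, ← hr.sum_transProb_mul_eq zero_le_one]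
    exact osc_contraction (transProb_nonneg _ 1) (sum_transProb _ 1) (fun x y => hε (x, y)) hf a b
  have hmono : ∀ (f : 𝒳 → ℝ) (d : ℝ), (∀ a b, |f a - f b| ≤ d) → ∀ t, 0 ≤ t → ∀ a b,
      |semigroup r t f a - semigroup r t f b| ≤ d := fun f d hf t ht a b => by
    rw [← hr.sum_transProb_mul_eq ht, ← hr.sum_transProb_mul_eq ht]
    have := osc_contraction (transProb_nonneg (fun _ => r) t) (sum_transProb _ t)
      (fun x y => transProb_nonneg (fun _ => r) t x y) hf a b
    rwa [sub_zero, one_mul] at this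
  have hnat : ∀ (n : ℕ) (f : 𝒳 → ℝ) (d : ℝ), (∀ a b, |f a - f b| ≤ d) → ∀ a b,
      |semigroup r n f a - semigroup r n f b| ≤ (1 - ε) ^ n * d := by
    intro n
    induction n with
    | zero => intro f d hf a b; simpa [semigroup_zero] using hf a b
    | succ n ih =>
      intro f d hf a b
      rw [Nat.cast_succ, semigroup_add, pow_succ, mul_assoc]
      exact ih _ _ (hstep f d hf) a b
  have hlog : Real.log (1 - ε) < 0 := Real.log_neg (by linarith) (by linarith)
  -- Writing `t` as `⌊t⌋` plus a remainder, over which the oscillation does not increase, gives the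
  -- factor `(1 - ε)^⌊t⌋ ≤ (1 - ε)^(t - 1)`. Hence `K = 1 / (1 - ε)` and `c = -log (1 - ε)`.
  refine ⟨Real.exp (-Real.log (1 - ε)), -Real.log (1 - ε), Real.exp_pos _, by linarith,
    fun f d hf t ht a b => ?_⟩
  have hd : 0 ≤ d := (abs_nonneg _).trans (hf a a)
  have h1 : semigroup r t f = semigroup r (t - ⌊t⌋₊) (semigroup r ⌊t⌋₊ f) := by
    rw [← semigroup_add]
    ring_nf
  rw [h1]
  refine (hmono _ _ (hnat ⌊t⌋₊ f d hf) _ (sub_nonneg.2 (Nat.floor_le ht)) a b).trans ?_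
  refine mul_le_mul_of_nonneg_right ?_ hd
  rw [← Real.exp_add, ← Real.exp_log (show 0 < 1 - ε by linarith), ← Real.exp_nat_mul,
    Real.exp_le_exp, Real.log_exp]
  have := Nat.lt_floor_add_one t
  nlinarith

/-- The candidate is the invariant probability of the time-one matrix. The matrices for times `t`
and `1` commute, so its image under the time-`t` matrix is again invariant for time one and equals
it by uniqueness. -/
theorem existsUnique_isInvariantDistribution [Nonempty 𝒳] :
    ∃! π : Measure 𝒳, IsInvariantDistribution r π := by
  classical
  obtain ⟨π, ⟨hπ, hinv⟩, huniq⟩ := existsUnique_isInvariantProb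
    (fun x y => hr.transProb_pos one_pos x y) (sum_transProb _ 1)
  refine ⟨π, fun t ht => ⟨hπ, ?_⟩, fun μ hμ => huniq μ (hμ 1 zero_le_one)⟩
  have hcomp : ∀ s t, 0 ≤ s → 0 ≤ t → ∀ x z,
      ∑ y, transProb (fun _ => r) s x y * transProb (fun _ => r) t y z
        = semigroup r (s + t) (fun y => if y = z then 1 else 0) x := by
    intro s t hs ht x z
    have h1 : ∀ y, transProb (fun _ => r) t y z
        = semigroup r t (fun y => if y = z then 1 else 0) y := fun y => by
      rw [← hr.sum_transProb_mul_eq ht]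
      simp
    simp_rw [h1, hr.sum_transProb_mul_eq hs, semigroup_add]
  have h2 := invariant_vector_unique (P := transProb (fun _ => r) 1)
    (w := fun y => ∑ x, π.real {x} * transProb (fun _ => r) t x y) (w' := fun y => π.real {y})
    (fun x y => hr.transProb_pos one_pos x y) (sum_transProb _ 1)
    (fun y => Finset.sum_nonneg fun x _ => mul_nonneg measureReal_nonneg (transProb_nonneg _ t x y))
    (by
      rw [Finset.sum_comm]
      simp_rw [← Finset.mul_sum, sum_transProb, mul_one]
      exact sum_real_singleton π)
    (fun z => by
      simp_rw [Finset.sum_mul, mul_assoc]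
      rw [Finset.sum_comm]
      simp_rw [← Finset.mul_sum, hcomp t 1 ht zero_le_one]
      rw [add_comm]
      simp_rw [← hcomp 1 t zero_le_one ht, Finset.mul_sum, ← mul_assoc]
      rw [Finset.sum_comm]
      simp_rw [← Finset.sum_mul, hinv])
    (fun y => measureReal_nonneg) (sum_real_singleton π) hinv
  exact fun y => congrFun h2 y

end IsIrreducibleRate

namespace IsInvariantDistribution

variable [MeasurableSpace 𝒳] [MeasurableSingletonClass 𝒳] {r : 𝒳 → 𝒳 → ℝ} {π : Measure 𝒳}
  (hπ : IsInvariantDistribution r π)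
include hπ

omit [MeasurableSingletonClass 𝒳] in
theorem isProbabilityMeasure : IsProbabilityMeasure π := (hπ 0 le_rfl).1

theorem marginal_eq {t : ℝ} (ht : 0 ≤ t) (x : 𝒳) : marginal (fun _ => r) π t x = π.real {x} := by
  have := hπ.isProbabilityMeasure
  rw [marginal_eq_sum]
  exact (hπ t ht).2 x

theorem sum_mul_semigroup (hr : IsIrreducibleRate r) {t : ℝ} (ht : 0 ≤ t) (f : 𝒳 → ℝ) :
    ∑ x, π.real {x} * semigroup r t f x = ∑ x, π.real {x} * f x := by
  have := hπ.isProbabilityMeasure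
  rw [← hr.sum_marginal_mul_eq π ht]
  simp_rw [hπ.marginal_eq ht]

theorem pos (hr : IsIrreducibleRate r) (x : 𝒳) : 0 < π.real {x} := by
  have := hπ.isProbabilityMeasure
  obtain ⟨z, -, hz⟩ := Finset.exists_ne_zero_of_sum_ne_zero
    (show ∑ x, π.real {x} ≠ 0 by rw [sum_real_singleton]; exact one_ne_zero)
  rw [← (hπ 1 zero_le_one).2 x]
  exact Finset.sum_pos' (fun z _ => mul_nonneg measureReal_nonneg (measureReal_nonneg))
    ⟨z, Finset.mem_univ z, mul_pos (lt_of_le_of_ne measureReal_nonneg hz.symm)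
      (hr.transProb_pos one_pos z x)⟩

end IsInvariantDistribution

end Rates

/-! ### Linear response of periodic solutions -/

section Response

variable {𝒳 : Type*} [Fintype 𝒳] {r : 𝒳 → 𝒳 → ℝ} {g : ℝ → 𝒳 → 𝒳 → ℝ} {T G : ℝ}

/-- A bounded, measurable, time-periodic perturbation. -/
structure IsPeriodicPerturbation {𝒳 : Type*} (g : ℝ → 𝒳 → 𝒳 → ℝ) (T G : ℝ) : Prop where
  measurable : ∀ x y, Measurable fun s => g s x y
  abs_le : ∀ s x y, |g s x y| ≤ G
  periodic : ∀ x y, Function.Periodic (fun s => g s x y) T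

section Pointwise

variable {𝒳 : Type*} {g : ℝ → 𝒳 → 𝒳 → ℝ} {T G : ℝ} (hg : IsPeriodicPerturbation g T G)
include hg

theorem IsPeriodicPerturbation.periodic_perturbedRate (r : 𝒳 → 𝒳 → ℝ) (lam : ℝ) (x y : 𝒳) :
    Function.Periodic (fun s => perturbedRate r g lam s x y) T := fun s => by
  have : g (s + T) x y = g s x y := hg.periodic x y s
  simp only [perturbedRate, this]

theorem IsPeriodicPerturbation.abs_exp_sub_one_le {lam : ℝ} (hlam : |lam| * G ≤ 1) (s : ℝ)
    (x y : 𝒳) : |Real.exp (lam * g s x y) - 1| ≤ 2 * |lam| * G := by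
  have h1 : |lam * g s x y| ≤ |lam| * G := by
    rw [abs_mul]; exact mul_le_mul_of_nonneg_left (hg.abs_le s x y) (abs_nonneg _)
  refine (Real.abs_exp_sub_one_le (h1.trans hlam)).trans ?_
  linarith

theorem IsPeriodicPerturbation.abs_exp_sub_one_sub_le {lam : ℝ} (hlam : |lam| * G ≤ 1) (s : ℝ)
    (x y : 𝒳) : |Real.exp (lam * g s x y) - 1 - lam * g s x y| ≤ lam ^ 2 * G ^ 2 := by
  have h1 : |lam * g s x y| ≤ |lam| * G := by
    rw [abs_mul]; exact mul_le_mul_of_nonneg_left (hg.abs_le s x y) (abs_nonneg _)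
  refine (Real.abs_exp_sub_one_sub_id_le (h1.trans hlam)).trans ?_
  rw [← sq_abs lam, ← mul_pow, ← sq_abs (lam * g s x y)]
  exact pow_le_pow_left₀ (abs_nonneg _) h1 2

end Pointwise

/-- Oscillations decay exponentially under the semigroup with rates `r`. -/
structure HasOscDecay (r : 𝒳 → 𝒳 → ℝ) (K c : ℝ) : Prop where
  pos : 0 < K
  rate_pos : 0 < c
  le : ∀ (f : 𝒳 → ℝ) (d : ℝ), (∀ a b, |f a - f b| ≤ d) → ∀ t, 0 ≤ t → ∀ a b,
      |semigroup r t f a - semigroup r t f b| ≤ K * Real.exp (-(c * t)) * d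

/-- The bound does not depend on `S`, which allows `S → ∞` in Duhamel's formula. -/
theorem integral_exp_neg_sub_le {c : ℝ} (hc : 0 < c) (S : ℝ) :
    ∫ u in (0 : ℝ)..S, Real.exp (-(c * (S - u))) ≤ 1 / c := by
  have hd : ∀ u, HasDerivAt (fun u => Real.exp (-(c * (S - u))) / c)
      (Real.exp (-(c * (S - u)))) u := fun u => by
    have h1 : HasDerivAt (fun u => -(c * (S - u))) c u :=
      (((hasDerivAt_id u).const_sub S).const_mul c).neg.congr_deriv (by simp)
    have h2 := h1.exp.div_const c
    rwa [mul_div_assoc, div_self hc.ne', mul_one] at h2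
  have hcont : Continuous fun u => Real.exp (-(c * (S - u))) := by fun_prop
  rw [intervalIntegral.integral_eq_sub_of_hasDerivAt (fun u _ => hd u)
    (hcont.intervalIntegrable _ _)]
  simp only [sub_self, mul_zero, neg_zero, Real.exp_zero, sub_zero]
  have := div_pos (Real.exp_pos (-(c * S))) hc
  linarith

theorem HasOscDecay.tendsto {K c : ℝ} (hdec : HasOscDecay r K c) (hT : 0 < T) (t d : ℝ) :
    Tendsto (fun n : ℕ => K * Real.exp (-(c * (t + n * T))) * d) atTop (𝓝 0) := by
  have h1 : Tendsto (fun n : ℕ => c * (t + n * T)) atTop atTop :=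
    (tendsto_atTop_add_const_left _ t
      (tendsto_natCast_atTop_atTop.atTop_mul_const hT)).const_mul_atTop hdec.rate_pos
  have h2 := ((Real.tendsto_exp_neg_atTop_nhds_zero.comp h1).const_mul K).mul_const d
  simpa using h2

section RateBounds

variable (hr0 : ∀ x y, 0 ≤ r x y) (hg : IsPeriodicPerturbation g T G)
  {lam : ℝ} (hlam : |lam| * G ≤ 1)
include hr0 hg

theorem IsPeriodicPerturbation.sum_abs_mul_le (s : ℝ) (x : 𝒳) :
    ∑ y, |r x y * g s x y| ≤ G * ∑ x, ∑ y, r x y := by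
  calc ∑ y, |r x y * g s x y| ≤ ∑ y, G * r x y := Finset.sum_le_sum fun y _ => by
        rw [abs_mul, abs_of_nonneg (hr0 x y), mul_comm]
        exact mul_le_mul_of_nonneg_right (hg.abs_le s x y) (hr0 x y)
    _ = G * ∑ y, r x y := by rw [Finset.mul_sum]
    _ ≤ _ := mul_le_mul_of_nonneg_left (Finset.single_le_sum (f := fun x => ∑ y, r x y)
          (fun x _ => Finset.sum_nonneg fun y _ => hr0 x y) (Finset.mem_univ x))
          ((abs_nonneg _).trans (hg.abs_le s x x))

include hlam

theorem IsPeriodicPerturbation.sum_abs_rate_sub_le (s : ℝ) (x : 𝒳) :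
    ∑ y, |perturbedRate r g lam s x y - r x y| ≤ 2 * |lam| * G * ∑ x, ∑ y, r x y := by
  have hG := (abs_nonneg _).trans (hg.abs_le s x x)
  calc ∑ y, |perturbedRate r g lam s x y - r x y| ≤ ∑ y, 2 * |lam| * G * r x y :=
        Finset.sum_le_sum fun y _ => by
          rw [perturbedRate, ← sub_one_mul, abs_mul, abs_of_nonneg (hr0 x y)]
          exact mul_le_mul_of_nonneg_right (hg.abs_exp_sub_one_le hlam s x y) (hr0 x y)
    _ = 2 * |lam| * G * ∑ y, r x y := by rw [Finset.mul_sum]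
    _ ≤ _ := mul_le_mul_of_nonneg_left (Finset.single_le_sum (f := fun x => ∑ y, r x y)
          (fun x _ => Finset.sum_nonneg fun y _ => hr0 x y) (Finset.mem_univ x)) (by positivity)

theorem IsPeriodicPerturbation.sum_abs_rate_sub_sub_le (s : ℝ) (x : 𝒳) :
    ∑ y, |perturbedRate r g lam s x y - r x y - lam * (r x y * g s x y)|
      ≤ lam ^ 2 * G ^ 2 * ∑ x, ∑ y, r x y := by
  calc ∑ y, |perturbedRate r g lam s x y - r x y - lam * (r x y * g s x y)|
        ≤ ∑ y, lam ^ 2 * G ^ 2 * r x y :=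
        Finset.sum_le_sum fun y _ => by
          have : perturbedRate r g lam s x y - r x y - lam * (r x y * g s x y)
            = (Real.exp (lam * g s x y) - 1 - lam * g s x y) * r x y := by
            rw [perturbedRate]; ring
          rw [this, abs_mul, abs_of_nonneg (hr0 x y)]
          exact mul_le_mul_of_nonneg_right (hg.abs_exp_sub_one_sub_le hlam s x y) (hr0 x y)
    _ = lam ^ 2 * G ^ 2 * ∑ y, r x y := by rw [Finset.mul_sum]
    _ ≤ _ := mul_le_mul_of_nonneg_left (Finset.single_le_sum (f := fun x => ∑ y, r x y)
          (fun x _ => Finset.sum_nonneg fun y _ => hr0 x y) (Finset.mem_univ x)) (by positivity)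

end RateBounds

variable [MeasurableSpace 𝒳] {π : Measure 𝒳}

/-- Exchanging the summation variables in the `r*` term cancels `π(x)` and moves the increment onto
`h`. Thus `ψ` is the adjoint in `L²(π)` of the linearised generator, applied to the constant `1`,
and the pairing sees only the oscillation of `h`. -/
theorem scalarProd_psi (hπ : ∀ x, 0 < π.real {x}) (h : 𝒳 → ℝ) (s : ℝ) :
    scalarProd π h (psi r π g s)
      = ∑ x, π.real {x} * ∑ y, r x y * g s x y * (h y - h x) := by
  simp only [scalarProd, psi, reversedRate, mul_sub, Finset.sum_sub_distrib, Finset.mul_sum]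
  congr 1
  · rw [Finset.sum_comm]
    refine Finset.sum_congr rfl fun x _ => Finset.sum_congr rfl fun y _ => ?_
    have := (hπ y).ne'
    field_simp
  · refine Finset.sum_congr rfl fun x _ => Finset.sum_congr rfl fun y _ => ?_
    ring

theorem measurable_psi (hg : IsPeriodicPerturbation g T G) (x : 𝒳) :
    Measurable fun s => psi r π g s x :=
  Finset.measurable_sum _ fun y _ =>
    ((hg.measurable y x).const_mul _).sub ((hg.measurable x y).const_mul _)

theorem psi_periodic (hg : IsPeriodicPerturbation g T G) (n : ℕ) (s : ℝ) :
    psi r π g (s + n * T) = psi r π g s := by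
  funext x
  refine Finset.sum_congr rfl fun y _ => ?_
  have h1 : ∀ x y, g (s + n * T) x y = g s x y := fun x y => (hg.periodic x y).nat_mul n s
  rw [h1, h1]

/-- The integrand of the linear response is jointly measurable. -/
theorem measurable_scalarProd_psi (hg : IsPeriodicPerturbation g T G) (f : 𝒳 → ℝ) :
    Measurable fun p : ℝ × ℝ =>
      scalarProd π (semigroup r p.2 f) (psi r π g (p.1 - p.2)) :=
  Finset.measurable_sum _ fun x _ => ((((continuous_semigroup_apply r f x).measurable.comp
    measurable_snd).mul ((measurable_psi hg x).comp (measurable_fst.sub measurable_snd)))).const_mul _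

/-- The linear response `∫_0^∞ ⟨e^{s𝓛}f, ψ_{t-s}⟩ ds`. -/
noncomputable def response (r : 𝒳 → 𝒳 → ℝ) (π : Measure 𝒳) (g : ℝ → 𝒳 → 𝒳 → ℝ) (t : ℝ)
    (f : 𝒳 → ℝ) : ℝ :=
  ∫ s in Set.Ioi (0 : ℝ), scalarProd π (semigroup r s f) (psi r π g (t - s))

variable [MeasurableSingletonClass 𝒳] (hr : IsIrreducibleRate r)
  (hπ : IsInvariantDistribution r π) (hg : IsPeriodicPerturbation g T G)
  {K c : ℝ} (hdec : HasOscDecay r K c)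
include hr hπ hg

/-- Control by the oscillation of `h` alone, rather than its size, is what makes the response
integrable up to infinity: `e^{s𝓛} f` tends to a constant, not in general to zero. -/
theorem abs_scalarProd_psi_le {h : 𝒳 → ℝ} {d : ℝ} (hd : ∀ a b, |h a - h b| ≤ d) (s : ℝ) :
    |scalarProd π h (psi r π g s)| ≤ G * (∑ x, ∑ y, r x y) * d := by
  have := hπ.isProbabilityMeasure
  rw [scalarProd_psi (hπ.pos hr)]
  refine abs_sum_mul_le (fun x => measureReal_nonneg) (sum_real_singleton π) fun x => ?_
  exact abs_sum_mul_sub_le x (hg.sum_abs_mul_le hr.nonneg s x)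
    ((abs_nonneg _).trans (hd x x)) fun y => hd y x

include hdec

theorem abs_scalarProd_semigroup_psi_le {f : 𝒳 → ℝ} {d : ℝ} (hd : ∀ a b, |f a - f b| ≤ d)
    (s : ℝ) {u : ℝ} (hu : 0 ≤ u) : |scalarProd π (semigroup r u f) (psi r π g s)|
      ≤ G * (∑ x, ∑ y, r x y) * K * d * Real.exp (-c * u) := by
  refine (abs_scalarProd_psi_le hr hπ hg (hdec.le f d hd u hu) s).trans_eq ?_
  ring_nf

theorem integrableOn_response (t : ℝ) (f : 𝒳 → ℝ) :
    IntegrableOn (fun s => scalarProd π (semigroup r s f) (psi r π g (t - s))) (Set.Ioi 0) := by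
  have hd : ∀ a b, |f a - f b| ≤ 2 * ∑ x, |f x| := fun a b => by
    have h1 := fun x => Finset.single_le_sum (f := fun x => |f x|) (fun x _ => abs_nonneg _)
      (Finset.mem_univ x)
    have h2 := abs_sub (f a) (f b)
    linarith [h1 a, h1 b]
  refine Integrable.mono' ((exp_neg_integrableOn_Ioi 0 hdec.rate_pos).const_mul
    (G * (∑ x, ∑ y, r x y) * K * (2 * ∑ x, |f x|))) ?_ ?_
  · exact ((measurable_scalarProd_psi hg f).comp measurable_prodMk_left).aestronglyMeasurable
  · filter_upwards [ae_restrict_mem measurableSet_Ioi] with u hu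
    exact abs_scalarProd_semigroup_psi_le hr hπ hg hdec hd _ (le_of_lt hu)

-- Loss of memory: since `π` is invariant, both terms are means of `e^{S𝓛} f`, whose oscillation is
-- exponentially small.
omit hg in
theorem abs_sum_mul_semigroup_sub_le {w f : 𝒳 → ℝ} {d : ℝ} (hw0 : ∀ x, 0 ≤ w x)
    (hw : ∑ x, w x = 1) (hd : ∀ a b, |f a - f b| ≤ d) {S : ℝ} (hS : 0 ≤ S) :
    |∑ x, w x * semigroup r S f x - ∑ x, π.real {x} * f x| ≤ K * Real.exp (-(c * S)) * d := by
  have := hπ.isProbabilityMeasure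
  rw [← hπ.sum_mul_semigroup hr hS]
  exact abs_sum_sub_sum_le hw0 hw (fun x => measureReal_nonneg) (sum_real_singleton π)
    (hdec.le f d hd S hS)

section Solution

variable {lam : ℝ} (hT : 0 < T) (hlam : |lam| * G ≤ 1) {p : ℝ → 𝒳 → ℝ}
  (hp : IsForwardSolution (perturbedRate r g lam) p) (hper : p T = p 0)
include hT hlam hp hper

/-- Periodicity replaces `t` by `t + nT` in Duhamel's formula. The initial term forgets `p 0` as `n
→ ∞`; the rate increments are `O(λ)` and act on functions of exponentially small oscillation, so
their contribution is bounded uniformly in `n`. -/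
theorem abs_sum_periodic_sub_le {f : 𝒳 → ℝ} {d : ℝ} (hd : ∀ a b, |f a - f b| ≤ d) {t : ℝ}
    (ht : 0 ≤ t) : |∑ x, p t x * f x - ∑ x, π.real {x} * f x|
      ≤ |lam| * (2 * G * (∑ x, ∑ y, r x y) * K / c) * d := by
  have hq := (hr.isAdmissible_perturbedRate hg.measurable hg.abs_le lam).isBoundedRate
  obtain ⟨x₀⟩ : Nonempty 𝒳 := by
    by_contra h
    rw [not_nonempty_iff] at h
    simpa using hp.sum_eq_one 0
  have hd0 : 0 ≤ d := (abs_nonneg _).trans (hd x₀ x₀)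
  have hG : 0 ≤ G := (abs_nonneg _).trans (hg.abs_le 0 x₀ x₀)
  have hR : 0 ≤ ∑ x, ∑ y, r x y := Finset.sum_nonneg fun x _ => Finset.sum_nonneg fun y _ =>
    hr.nonneg x y
  have hK := hdec.pos
  have hc := hdec.rate_pos
  have key : ∀ n : ℕ, |∑ x, p t x * f x - ∑ x, π.real {x} * f x|
      ≤ K * Real.exp (-(c * (t + n * T))) * d
        + |lam| * (2 * G * (∑ x, ∑ y, r x y) * K / c) * d := by
    intro n
    have hS : 0 ≤ t + n * T := by positivity
    set S := t + n * T
    have h1 := hp.duhamel hq r f hS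
    rw [hp.add_mul_eq hq hT.le (hg.periodic_perturbedRate r lam) hper n ht] at h1
    have h2 := abs_sum_mul_semigroup_sub_le hr hπ hdec (hp.nonneg 0) (hp.sum_eq_one 0) hd hS
    have h3 : |∫ u in (0 : ℝ)..S, ∑ x, p u x * ∑ y, (perturbedRate r g lam u x y - r x y)
        * (semigroup r (S - u) f y - semigroup r (S - u) f x)|
        ≤ ∫ u in (0 : ℝ)..S, 2 * |lam| * G * (∑ x, ∑ y, r x y) * K * d
          * Real.exp (-(c * (S - u))) := by
      rw [← Real.norm_eq_abs]
      refine intervalIntegral.norm_integral_le_of_norm_le hS (Eventually.of_forall fun u hu => ?_)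
        (Continuous.intervalIntegrable (by fun_prop) _ _)
      refine abs_sum_mul_le (hp.nonneg u) (hp.sum_eq_one u) fun x => ?_
      refine (abs_sum_mul_sub_le x (hg.sum_abs_rate_sub_le hr.nonneg hlam u x) (by positivity)
        fun y => hdec.le f d hd _ (sub_nonneg.2 hu.2) y x).trans_eq ?_
      ring
    have h4 : ∫ u in (0 : ℝ)..S, 2 * |lam| * G * (∑ x, ∑ y, r x y) * K * d
          * Real.exp (-(c * (S - u)))
        ≤ |lam| * (2 * G * (∑ x, ∑ y, r x y) * K / c) * d := by
      rw [intervalIntegral.integral_const_mul]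
      refine (mul_le_mul_of_nonneg_left (integral_exp_neg_sub_le hc S)
        (by positivity)).trans_eq ?_
      ring
    have h5 : ∑ x, p t x * f x - ∑ x, π.real {x} * f x
        = (∑ x, p 0 x * semigroup r S f x - ∑ x, π.real {x} * f x)
          + ∫ u in (0 : ℝ)..S, ∑ x, p u x * ∑ y, (perturbedRate r g lam u x y - r x y)
            * (semigroup r (S - u) f y - semigroup r (S - u) f x) := by
      rw [h1]; ring
    rw [h5]
    exact (abs_add_le _ _).trans (add_le_add h2 (h3.trans h4))
  have hlim := (hdec.tendsto hT t d).add_const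
    (|lam| * (2 * G * (∑ x, ∑ y, r x y) * K / c) * d)
  rw [zero_add] at hlim
  exact ge_of_tendsto' hlim key

/-- The same Duhamel argument to second order. Replacing `p u` by `π` costs `O(λ)` by the previous
bound, multiplied by rate increments that are `O(λ)`; linearising the increments costs `O(λ²)`. By
`scalarProd_psi` the remaining integrand is `lam` times that of the response. -/
theorem abs_sum_periodic_sub_response_le {f : 𝒳 → ℝ} {d : ℝ} (hd : ∀ a b, |f a - f b| ≤ d)
    {t : ℝ} (ht : 0 ≤ t) :
    |∑ x, p t x * f x - ∑ x, π.real {x} * f x - lam * response r π g t f|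
      ≤ lam ^ 2 * ((8 * G ^ 2 * (∑ x, ∑ y, r x y) ^ 2 * K / c + G ^ 2 * ∑ x, ∑ y, r x y) * K / c)
        * d := by
  have := hπ.isProbabilityMeasure
  have hq := (hr.isAdmissible_perturbedRate hg.measurable hg.abs_le lam).isBoundedRate
  obtain ⟨x₀⟩ : Nonempty 𝒳 := by
    by_contra h
    rw [not_nonempty_iff] at h
    simpa using hp.sum_eq_one 0
  have hd0 : 0 ≤ d := (abs_nonneg _).trans (hd x₀ x₀)
  have hG : 0 ≤ G := (abs_nonneg _).trans (hg.abs_le 0 x₀ x₀)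
  have hR : 0 ≤ ∑ x, ∑ y, r x y := Finset.sum_nonneg fun x _ => Finset.sum_nonneg fun y _ =>
    hr.nonneg x y
  have hK := hdec.pos
  have hc := hdec.rate_pos
  set R := ∑ x, ∑ y, r x y with hRdef
  -- comparison of the two integrands
  have hpt : ∀ (h : 𝒳 → ℝ) (e : ℝ), (∀ a b, |h a - h b| ≤ e) → ∀ u, 0 ≤ u →
      |∑ x, p u x * ∑ y, (perturbedRate r g lam u x y - r x y) * (h y - h x)
        - lam * scalarProd π h (psi r π g u)|
      ≤ lam ^ 2 * (8 * G ^ 2 * R ^ 2 * K / c + G ^ 2 * R) * e := by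
    intro h e he u hu
    have he0 : 0 ≤ e := (abs_nonneg _).trans (he x₀ x₀)
    let w : 𝒳 → ℝ := fun x => ∑ y, (perturbedRate r g lam u x y - r x y) * (h y - h x)
    let v : 𝒳 → ℝ := fun x => ∑ y, (perturbedRate r g lam u x y - r x y
      - lam * (r x y * g u x y)) * (h y - h x)
    have hw : ∀ x, |w x| ≤ 2 * |lam| * G * R * e := fun x =>
      abs_sum_mul_sub_le x (hg.sum_abs_rate_sub_le hr.nonneg hlam u x) he0 fun y => he y x
    have hv : ∀ x, |v x| ≤ lam ^ 2 * G ^ 2 * R * e := fun x =>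
      abs_sum_mul_sub_le x (hg.sum_abs_rate_sub_sub_le hr.nonneg hlam u x) he0 fun y => he y x
    -- An oscillation of `4 |lam| G R e` inserted in the first-order bound gives the term `8 G² R² K
    -- / c`. The term `G² R` comes from `v`, the remainder of the rates beyond the part linear in
    -- `lam`.
    have hwosc : ∀ a b, |w a - w b| ≤ 2 * (2 * |lam| * G * R * e) := fun a b => by
      have := abs_sub (w a) (w b)
      linarith [hw a, hw b]
    have h1 := abs_sum_periodic_sub_le hr hπ hg hdec hT hlam hp hper hwosc hu
    have h2 := abs_sum_mul_le (p := fun x => π.real {x}) (fun x => measureReal_nonneg)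
      (sum_real_singleton π) hv
    have h3 : ∑ x, p u x * w x - lam * scalarProd π h (psi r π g u)
        = (∑ x, p u x * w x - ∑ x, π.real {x} * w x) + ∑ x, π.real {x} * v x := by
      rw [scalarProd_psi (hπ.pos hr)]
      simp only [v, w, sub_mul, Finset.sum_sub_distrib, mul_sub, Finset.mul_sum]
      ring_nf
    rw [h3]
    refine (abs_add_le _ _).trans ((add_le_add h1 h2).trans_eq ?_)
    rw [← sq_abs lam]
    ring
  have key : ∀ n : ℕ, |∑ x, p t x * f x - ∑ x, π.real {x} * f x - lam *
      ∫ u in (0 : ℝ)..(t + n * T), scalarProd π (semigroup r u f) (psi r π g (t - u))|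
      ≤ K * Real.exp (-(c * (t + n * T))) * d
        + lam ^ 2 * ((8 * G ^ 2 * R ^ 2 * K / c + G ^ 2 * R) * K / c) * d := by
    intro n
    have hS : 0 ≤ t + n * T := by positivity
    -- Periodicity of `ψ` moves its argument to `t + nT - u`, so that the substitution `u ↦ S - u`
    -- yields the time variable of Duhamel's formula.
    have hψ : ∀ u, psi r π g (t - u) = psi r π g (t + n * T - u) := fun u => by
      rw [← psi_periodic hg n]; ring_nf
    simp_rw [hψ]
    have hdu := hp.duhamel hq r f hS
    rw [hp.add_mul_eq hq hT.le (hg.periodic_perturbedRate r lam) hper n ht] at hdu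
    set S := t + n * T
    have h1 : ∫ u in (0 : ℝ)..S, scalarProd π (semigroup r u f) (psi r π g (S - u))
        = ∫ u in (0 : ℝ)..S, scalarProd π (semigroup r (S - u) f) (psi r π g u) := by
      have := intervalIntegral.integral_comp_sub_left (a := 0) (b := S)
        (fun u => scalarProd π (semigroup r (S - u) f) (psi r π g u)) S
      simpa using this
    have h2 := abs_sum_mul_semigroup_sub_le hr hπ hdec (hp.nonneg 0) (hp.sum_eq_one 0) hd hS
    have hi1 : IntervalIntegrable (fun u => ∑ x, p u x * ∑ y,
        (perturbedRate r g lam u x y - r x y)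
        * (semigroup r (S - u) f y - semigroup r (S - u) f x)) volume 0 S := by
      refine (Continuous.intervalIntegrable (u := fun u => 2 * |lam| * G * R
        * (K * Real.exp (-(c * (S - u))) * d)) (by fun_prop) 0 S).mono_fun' ?_ ?_
      · refine Measurable.aestronglyMeasurable ?_
        refine Finset.measurable_sum _ fun x _ => (hp.measurable x).mul ?_
        refine Finset.measurable_sum _ fun y _ => ((hq.measurable x y).sub_const _).mul ?_
        exact Measurable.sub
          ((continuous_semigroup_apply r f y).measurable.comp (measurable_const.sub measurable_id))
          ((continuous_semigroup_apply r f x).measurable.comp (measurable_const.sub measurable_id))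
      · filter_upwards [ae_restrict_mem measurableSet_uIoc] with u hu
        rw [Set.uIoc_of_le hS] at hu
        refine abs_sum_mul_le (hp.nonneg u) (hp.sum_eq_one u) fun x => ?_
        exact abs_sum_mul_sub_le x (hg.sum_abs_rate_sub_le hr.nonneg hlam u x) (by positivity)
          fun y => hdec.le f d hd _ (sub_nonneg.2 hu.2) y x
    have hi2 : IntervalIntegrable (fun u => scalarProd π (semigroup r (S - u) f) (psi r π g u))
        volume 0 S := by
      refine (Continuous.intervalIntegrable (u := fun u => G * R
        * (K * Real.exp (-(c * (S - u))) * d)) (by fun_prop) 0 S).mono_fun' ?_ ?_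
      · refine Measurable.aestronglyMeasurable ?_
        exact Finset.measurable_sum _ fun x _ => ((((continuous_semigroup_apply r f x).measurable.comp
          (measurable_const.sub measurable_id)).mul (measurable_psi hg x))).const_mul _
      · filter_upwards [ae_restrict_mem measurableSet_uIoc] with u hu
        rw [Set.uIoc_of_le hS] at hu
        exact abs_scalarProd_psi_le hr hπ hg (hdec.le f d hd _ (sub_nonneg.2 hu.2)) u
    have h3 : |(∫ u in (0 : ℝ)..S, ∑ x, p u x * ∑ y, (perturbedRate r g lam u x y - r x y)
        * (semigroup r (S - u) f y - semigroup r (S - u) f x))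
        - lam * ∫ u in (0 : ℝ)..S, scalarProd π (semigroup r (S - u) f) (psi r π g u)|
        ≤ ∫ u in (0 : ℝ)..S, lam ^ 2 * (8 * G ^ 2 * R ^ 2 * K / c + G ^ 2 * R) * K * d
          * Real.exp (-(c * (S - u))) := by
      rw [← intervalIntegral.integral_const_mul, ← intervalIntegral.integral_sub hi1
        (hi2.const_mul lam), ← Real.norm_eq_abs]
      refine intervalIntegral.norm_integral_le_of_norm_le hS (Eventually.of_forall fun u hu => ?_)
        (Continuous.intervalIntegrable (by fun_prop) _ _)
      refine (hpt _ _ (hdec.le f d hd _ (sub_nonneg.2 hu.2)) u hu.1.le).trans_eq ?_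
      ring
    have h4 : ∫ u in (0 : ℝ)..S, lam ^ 2 * (8 * G ^ 2 * R ^ 2 * K / c + G ^ 2 * R) * K * d
          * Real.exp (-(c * (S - u)))
        ≤ lam ^ 2 * ((8 * G ^ 2 * R ^ 2 * K / c + G ^ 2 * R) * K / c) * d := by
      rw [intervalIntegral.integral_const_mul]
      refine (mul_le_mul_of_nonneg_left (integral_exp_neg_sub_le hc S)
        (by positivity)).trans_eq ?_
      ring
    rw [h1, hdu]
    refine le_trans (le_of_eq ?_) ((abs_add_le _ _).trans (add_le_add h2 (h3.trans h4)))
    congr 1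
    ring
  have hlim := (hdec.tendsto hT t d).add_const
    (lam ^ 2 * ((8 * G ^ 2 * R ^ 2 * K / c + G ^ 2 * R) * K / c) * d)
  rw [zero_add] at hlim
  have hS : Tendsto (fun n : ℕ => t + n * T) atTop atTop :=
    tendsto_atTop_add_const_left _ t (tendsto_natCast_atTop_atTop.atTop_mul_const hT)
  have hlim2 := (((intervalIntegral_tendsto_integral_Ioi 0
    (integrableOn_response hr hπ hg hdec t f) hS).const_mul lam).const_sub
      (∑ x, p t x * f x - ∑ x, π.real {x} * f x)).abs
  exact le_of_tendsto_of_tendsto' hlim2 hlim key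

end Solution

end Response

/-! ### Differentiability at zero from quadratic error bounds -/

section DerivativeCriteria

/-- The value `A` need not be identified with `F 0` beforehand: the bound at `lam = 0` forces it. -/
theorem hasDerivAt_zero_of_abs_sub_le {F : ℝ → ℝ} {A D K δ : ℝ} (hδ : 0 < δ)
    (h : ∀ lam, |lam| < δ → |F lam - A - lam * D| ≤ K * lam ^ 2) : HasDerivAt F D 0 := by
  have h0 : F 0 = A := by
    have := h 0 (by simpa using hδ)
    simp only [zero_mul, sub_zero, ne_eq, OfNat.ofNat_ne_zero, not_false_eq_true, zero_pow,
      mul_zero] at this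
    exact sub_eq_zero.1 (abs_eq_zero.1 (le_antisymm this (abs_nonneg _)))
  rw [hasDerivAt_iff_isLittleO, h0]
  have h1 : (fun lam => F lam - A - (lam - 0) • D) =O[𝓝 0] fun lam : ℝ => lam ^ 2 := by
    refine Asymptotics.IsBigO.of_bound K ?_
    filter_upwards [Metric.ball_mem_nhds (0 : ℝ) hδ] with lam hlam
    rw [Metric.mem_ball, dist_zero_right, Real.norm_eq_abs] at hlam
    rw [sub_zero, smul_eq_mul, Real.norm_eq_abs, Real.norm_of_nonneg (sq_nonneg lam)]
    exact h lam hlam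
  simpa using h1.trans_isLittleO (Asymptotics.isLittleO_pow_id one_lt_two)

/-- The quadratic error carries a weight `m` that is only integrable in time. Observables unbounded
in time are thus admitted. -/
theorem hasDerivAt_zero_setIntegral {s : Set ℝ} (hs : MeasurableSet s) {I : ℝ → ℝ → ℝ}
    {A D m : ℝ → ℝ} {K δ : ℝ} (hδ : 0 < δ) (hI : ∀ lam, IntegrableOn (I lam) s)
    (hA : IntegrableOn A s) (hD : IntegrableOn D s) (hm : IntegrableOn m s)
    (h : ∀ lam, |lam| < δ → ∀ u ∈ s, |I lam u - A u - lam * D u| ≤ K * lam ^ 2 * m u) :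
    HasDerivAt (fun lam => ∫ u in s, I lam u) (∫ u in s, D u) 0 := by
  refine hasDerivAt_zero_of_abs_sub_le (A := ∫ u in s, A u) (K := K * ∫ u in s, m u) hδ
    fun lam hlam => ?_
  have hIA : IntegrableOn (fun u => I lam u - A u) s := (hI lam).sub hA
  rw [← integral_sub (hI lam) hA, ← integral_const_mul,
    ← integral_sub hIA (hD.const_mul lam), ← Real.norm_eq_abs]
  refine (norm_integral_le_of_norm_le (hm.const_mul (K * lam ^ 2)) ?_).trans_eq ?_
  · filter_upwards [ae_restrict_mem hs] with u hu
    exact h lam hlam u hu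
  · rw [integral_const_mul]
    ring

end DerivativeCriteria

/-! ### Uniform response bounds and integrability -/

section Response

variable {𝒳 : Type*} [Fintype 𝒳] {r : 𝒳 → 𝒳 → ℝ} {g : ℝ → 𝒳 → 𝒳 → ℝ} {T G : ℝ}

theorem abs_le_sum_abs (f : 𝒳 → ℝ) (x : 𝒳) : |f x| ≤ ∑ x, |f x| :=
  Finset.single_le_sum (f := fun x => |f x|) (fun _ _ => abs_nonneg _) (Finset.mem_univ x)

theorem IsIrreducibleRate.exists_hasOscDecay [Nonempty 𝒳] (hr : IsIrreducibleRate r) :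
    ∃ K c, HasOscDecay r K c := by
  classical
  -- The conclusion involves only the matrix semigroup, so any measurable structure in which points
  -- are measurable may be chosen for the argument through transition probabilities.
  let _ : MeasurableSpace 𝒳 := ⊤
  have : MeasurableSingletonClass 𝒳 := ⟨fun _ => trivial⟩
  obtain ⟨K, c, h1, h2, h3⟩ := hr.exists_osc_semigroup_le
  exact ⟨K, c, h1, h2, h3⟩

variable [MeasurableSpace 𝒳] [MeasurableSingletonClass 𝒳] {π : Measure 𝒳}

theorem marginal_oss (hr : IsIrreducibleRate r) (hg : IsPeriodicPerturbation g T G)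
    {lam : ℝ} {μ : Measure 𝒳} (hμ : IsOSS r g T lam μ) :
    marginal (perturbedRate r g lam) μ T = marginal (perturbedRate r g lam) μ 0 := by
  have := hμ.1
  funext y
  rw [(hr.isAdmissible_perturbedRate hg.measurable hg.abs_le lam).marginal_zero, marginal_eq_sum]
  exact hμ.2 y

theorem existsUnique_isOSS [Nonempty 𝒳] (hr : IsIrreducibleRate r)
    (hg : IsPeriodicPerturbation g T G) (hT : 0 < T) (lam : ℝ) :
    ∃! μ : Measure 𝒳, IsOSS r g T lam μ :=
  existsUnique_isInvariantProb
    (fun x y => hr.transProb_perturbedRate_pos hg.measurable hg.abs_le lam hT x y)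
    (sum_transProb _ T)

theorem expect_two_time (hr : IsIrreducibleRate r) [IsProbabilityMeasure π] (v h : 𝒳 → ℝ) {s : ℝ}
    (hs : 0 ≤ s) : expect (fun _ => r) π (fun ξ => v (ξ s) * h (ξ 0))
      = scalarProd π (semigroup r s v) h := by
  obtain ⟨C, hq⟩ := hr.isAdmissible
  simp only [expect]
  rw [hq.integral_two_time π s v h]
  simp_rw [hr.sum_transProb_mul_eq hs]
  rfl

variable (hr : IsIrreducibleRate r) (hπ : IsInvariantDistribution r π)
  (hg : IsPeriodicPerturbation g T G)
include hr hπ hg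

omit hg in
theorem setIntegral_expect_two_time (v : 𝒳 → ℝ) (t : ℝ) :
    ∫ s in Set.Ioi (0 : ℝ), expect (fun _ => r) π (fun ξ => v (ξ s) * psi r π g (t - s) (ξ 0))
      = response r π g t v := by
  have := hπ.isProbabilityMeasure
  exact setIntegral_congr_fun measurableSet_Ioi fun s hs => expect_two_time hr v _ (le_of_lt hs)

theorem integrableOn_expect_two_time [Nonempty 𝒳] (v : 𝒳 → ℝ) (t : ℝ) :
    IntegrableOn (fun s => expect (fun _ => r) π
      (fun ξ => v (ξ s) * psi r π g (t - s) (ξ 0))) (Set.Ioi 0) := by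
  have := hπ.isProbabilityMeasure
  obtain ⟨K, c, hdec⟩ := hr.exists_hasOscDecay
  refine (integrableOn_response hr hπ hg hdec t v).congr_fun (fun s hs => ?_) measurableSet_Ioi
  exact (expect_two_time hr v _ (le_of_lt hs)).symm

/-- Expansion in coordinates separates the two roles of time in `response r π g u (v u)`: it becomes
a finite sum of bounded measurable functions of `u` times the coordinates `v u x`. -/
theorem response_eq_sum [Nonempty 𝒳] [DecidableEq 𝒳] (t : ℝ) (f : 𝒳 → ℝ) :
    response r π g t f = ∑ x, f x * response r π g t (Pi.single x 1) := by
  obtain ⟨K, c, hdec⟩ := hr.exists_hasOscDecay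
  unfold response
  simp_rw [← integral_const_mul]
  rw [← integral_finsetSum _ fun x _ =>
    (integrableOn_response hr hπ hg hdec t (Pi.single x 1)).const_mul (f x)]
  refine integral_congr_ae (Eventually.of_forall fun s => ?_)
  have h1 : semigroup r s f = ∑ x, f x • semigroup r s (Pi.single x 1) := by
    simp_rw [← map_smul, ← map_sum]
    congr 1
    ext y
    simp [Pi.single_apply]
  simp only [h1, scalarProd, Finset.sum_apply, Pi.smul_apply, smul_eq_mul, Finset.sum_mul,
    Finset.mul_sum]
  rw [Finset.sum_comm]
  exact Finset.sum_congr rfl fun x _ => Finset.sum_congr rfl fun y _ => by ring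

theorem exists_abs_response_le [Nonempty 𝒳] (f : 𝒳 → ℝ) :
    ∃ B, ∀ t, |response r π g t f| ≤ B := by
  obtain ⟨K, c, hdec⟩ := hr.exists_hasOscDecay
  have hd : ∀ a b, |f a - f b| ≤ 2 * ∑ x, |f x| := fun a b => by
    have h2 := abs_sub (f a) (f b)
    linarith [abs_le_sum_abs f a, abs_le_sum_abs f b]
  refine ⟨∫ u in Set.Ioi (0 : ℝ), G * (∑ x, ∑ y, r x y) * K * (2 * ∑ x, |f x|)
    * Real.exp (-c * u), fun t => ?_⟩
  rw [response, ← Real.norm_eq_abs]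
  refine norm_integral_le_of_norm_le ((exp_neg_integrableOn_Ioi 0 hdec.rate_pos).const_mul _) ?_
  filter_upwards [ae_restrict_mem measurableSet_Ioi] with u hu
  exact abs_scalarProd_semigroup_psi_le hr hπ hg hdec hd _ (le_of_lt hu)

omit [MeasurableSingletonClass 𝒳] hr hπ in
theorem measurable_response (f : 𝒳 → ℝ) : Measurable fun t => response r π g t f :=
  ((measurable_scalarProd_psi hg f).stronglyMeasurable.integral_prod_right'
    (ν := volume.restrict (Set.Ioi 0))).measurable

theorem integrableOn_response_family [Nonempty 𝒳] {v : ℝ → 𝒳 → ℝ} {s : Set ℝ}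
    (hv : ∀ x, IntegrableOn (fun u => v u x) s) :
    IntegrableOn (fun u => response r π g u (v u)) s := by
  classical
  have h1 : (fun u => response r π g u (v u))
      = fun u => ∑ x, response r π g u (Pi.single x 1) * v u x := by
    funext u
    rw [response_eq_sum hr hπ hg]
    exact Finset.sum_congr rfl fun x _ => mul_comm _ _
  rw [h1]
  refine integrable_finsetSum _ fun x _ => ?_
  obtain ⟨B, hB⟩ := exists_abs_response_le hr hπ hg (Pi.single x 1)
  exact (hv x).bdd_mul (c := B) (measurable_response hg _).aestronglyMeasurable
    (Eventually.of_forall hB)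

/-- One constant `B` serves all times, all steady states and all observables, and enters linearly in
the bound `m` on `f`. Time-dependent observables can therefore be treated at each time and then
integrated. -/
theorem exists_response_bound [Nonempty 𝒳] (hT : 0 < T) : ∃ B δ, 0 ≤ B ∧ 0 < δ ∧
    ∀ lam, |lam| < δ → |lam| * G ≤ 1 ∧ ∀ μ : Measure 𝒳, IsOSS r g T lam μ → ∀ t, 0 ≤ t →
    ∀ (f : 𝒳 → ℝ) (m : ℝ), (∀ x, |f x| ≤ m) →
      |∑ x, marginal (perturbedRate r g lam) μ t x * f x - ∑ x, π.real {x} * f x|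
        ≤ |lam| * B * m ∧
      |∑ x, marginal (perturbedRate r g lam) μ t x * f x - ∑ x, π.real {x} * f x
        - lam * response r π g t f| ≤ lam ^ 2 * B * m := by
  obtain ⟨K, c, hdec⟩ := hr.exists_hasOscDecay
  have hG : 0 ≤ G := (abs_nonneg _).trans
    (hg.abs_le 0 (Classical.arbitrary 𝒳) (Classical.arbitrary 𝒳))
  have hR : 0 ≤ ∑ x, ∑ y, r x y := Finset.sum_nonneg fun x _ => Finset.sum_nonneg fun y _ =>
    hr.nonneg x y
  have hK := hdec.pos
  have hc := hdec.rate_pos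
  set B₁ := 2 * G * (∑ x, ∑ y, r x y) * K / c
  set B₂ := (8 * G ^ 2 * (∑ x, ∑ y, r x y) ^ 2 * K / c + G ^ 2 * ∑ x, ∑ y, r x y) * K / c
  have hB₁ : 0 ≤ B₁ := by positivity
  have hB₂ : 0 ≤ B₂ := by positivity
  -- The factor `2` passes from a supremum bound `m` to an oscillation bound `2 * m`. The radius
  -- ensures `|lam| * G ≤ 1`, needed for the exponential estimates, also when `G = 0`.
  refine ⟨2 * (B₁ + B₂), 1 / (G + 1), by positivity, by positivity, fun lam hlam => ?_⟩
  have hlamG : |lam| * G ≤ 1 := by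
    rw [lt_div_iff₀ (by positivity)] at hlam
    linarith [abs_nonneg lam]
  refine ⟨hlamG, fun μ hμ t ht f m hf => ?_⟩
  have := hμ.1
  have hm : 0 ≤ m := (abs_nonneg _).trans (hf (Classical.arbitrary 𝒳))
  have hd : ∀ a b, |f a - f b| ≤ 2 * m := fun a b => by
    have h2 := abs_sub (f a) (f b)
    linarith [hf a, hf b]
  have hp := (hr.isAdmissible_perturbedRate hg.measurable hg.abs_le lam).isForwardSolution μ
  have hper := marginal_oss hr hg hμ
  refine ⟨(abs_sum_periodic_sub_le hr hπ hg hdec hT hlamG hp hper hd ht).trans ?_,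
    (abs_sum_periodic_sub_response_le hr hπ hg hdec hT hlamG hp hper hd ht).trans ?_⟩
  · have : 0 ≤ |lam| * B₂ * m := by positivity
    nlinarith
  · have : 0 ≤ lam ^ 2 * B₁ * m := by positivity
    nlinarith

-- Under stationarity, each of the two bounds controls `∫ π(x) |α r|` for every pair `x, y`, and
-- `π(x) > 0` can be divided out. Only the product `α r` is controlled: where `r x y = 0`, nothing
-- is known about `α`.
omit hg in
theorem integrableOn_of_isPathIntegrable {α : ℝ → 𝒳 → 𝒳 → ℝ}
    (hα : ∀ x y, Measurable fun s => α s x y) {t : ℝ} (ht : 0 ≤ t)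
    (h : IsPathIntegrable r π t α) (x y : 𝒳) :
    IntegrableOn (fun s => α s x y * r x y) (Set.Ioc 0 t) := by
  have := hπ.isProbabilityMeasure
  obtain ⟨C, hq⟩ := hr.isAdmissible
  have habs : ∀ x y, Measurable fun s => |α s x y| := fun x y => (hα x y).abs
  have key : ∫⁻ u in Set.Ioc (0 : ℝ) t, ENNReal.ofReal (marginal (fun _ => r) π u x)
      * ENNReal.ofReal |α u x y * r x y| < ∞ := by
    rcases h with h | h
    · simp only [jumpSumAbs] at h
      rw [hq.lintegral_tsum_jumps_ofReal π habs ht] at h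
      refine lt_of_le_of_lt ?_ (ENNReal.sum_lt_top.1 (ENNReal.sum_lt_top.1 h x
        (Finset.mem_univ x)) y (Finset.mem_univ y))
      refine lintegral_mono fun u => ?_
      rw [← ENNReal.ofReal_mul (marginal_nonneg _ π u x)]
      refine ENNReal.ofReal_le_ofReal (mul_le_mul_of_nonneg_left ?_ (marginal_nonneg _ π u x))
      rw [abs_mul, abs_of_nonneg (hr.nonneg x y)]
      exact le_max_left _ _
    · have hm : ∀ x, Measurable fun s => ENNReal.ofReal (contract r (fun s x y => |α s x y|) s x) :=
        fun x => (Finset.measurable_sum _ fun y _ => (habs x y).mul_const _).ennreal_ofReal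
      rw [lintegral_path_setLIntegral (fun _ => r) π
        (v := fun s x => ENNReal.ofReal (contract r (fun s x y => |α s x y|) s x)) hm] at h
      refine lt_of_le_of_lt ?_ (ENNReal.sum_lt_top.1 h x (Finset.mem_univ x))
      refine lintegral_mono fun u => mul_le_mul_right (ENNReal.ofReal_le_ofReal ?_) _
      rw [abs_mul, abs_of_nonneg (hr.nonneg x y)]
      exact Finset.single_le_sum (f := fun y => |α u x y| * r x y)
        (fun y _ => mul_nonneg (abs_nonneg _) (hr.nonneg x y)) (Finset.mem_univ y)
  have hcongr : ∫⁻ u in Set.Ioc (0 : ℝ) t, ENNReal.ofReal (marginal (fun _ => r) π u x)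
      * ENNReal.ofReal |α u x y * r x y|
      = ENNReal.ofReal (π.real {x}) * ∫⁻ u in Set.Ioc (0 : ℝ) t,
        ENNReal.ofReal |α u x y * r x y| := by
    rw [← lintegral_const_mul _ ((hα x y).mul_const _).abs.ennreal_ofReal]
    refine setLIntegral_congr_fun measurableSet_Ioc fun u hu => ?_
    simp only [hπ.marginal_eq hu.1.le]
  rw [hcongr] at key
  refine ⟨((hα x y).mul_const _).aestronglyMeasurable, ?_⟩
  rw [hasFiniteIntegral_iff_norm]
  simp_rw [Real.norm_eq_abs]
  exact ENNReal.lt_top_of_mul_ne_top_right key.ne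
    (ENNReal.ofReal_pos.2 (hπ.pos hr x)).ne'

end Response

/-! ### Derivatives of the three kinds of expectation -/

section LinearResponse

variable {𝒳 : Type*} [Fintype 𝒳] [Nonempty 𝒳] [MeasurableSpace 𝒳] [MeasurableSingletonClass 𝒳]
  {r : 𝒳 → 𝒳 → ℝ} {g : ℝ → 𝒳 → 𝒳 → ℝ} {T G : ℝ} {π : Measure 𝒳} {πl : ℝ → Measure 𝒳}
  (hr : IsIrreducibleRate r) (hπ : IsInvariantDistribution r π)
  (hg : IsPeriodicPerturbation g T G) (hT : 0 < T) (hπl : ∀ lam, IsOSS r g T lam (πl lam))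
include hr hπ hg hT hπl

theorem hasDerivAt_expect_path (v : 𝒳 → ℝ) {t : ℝ} (ht : 0 ≤ t) :
    HasDerivAt (fun lam => expect (perturbedRate r g lam) (πl lam) (fun ξ => v (ξ t)))
      (response r π g t v) 0 := by
  obtain ⟨B, δ, hB, hδ, h⟩ := exists_response_bound hr hπ hg hT
  refine hasDerivAt_zero_of_abs_sub_le (A := ∑ x, π.real {x} * v x)
    (K := B * ∑ x, |v x|) hδ fun lam hlam => ?_
  have := (hπl lam).1
  simp only [expect]
  rw [integral_path]
  refine (((h lam hlam).2 _ (hπl lam) t ht v _ (abs_le_sum_abs v)).2).trans_eq ?_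
  ring

theorem hasDerivAt_expect_integral {v : ℝ → 𝒳 → ℝ} (hv : ∀ x, Measurable fun s => v s x) {t : ℝ}
    (ht : 0 ≤ t) (hi : ∀ x, IntegrableOn (fun s => v s x) (Set.Ioc 0 t)) :
    HasDerivAt (fun lam => expect (perturbedRate r g lam) (πl lam)
      (fun ξ => ∫ s in (0 : ℝ)..t, v s (ξ s))) (∫ u in (0 : ℝ)..t, response r π g u (v u)) 0 := by
  obtain ⟨B, δ, hB, hδ, h⟩ := exists_response_bound hr hπ hg hT
  have h1 : ∀ lam, expect (perturbedRate r g lam) (πl lam) (fun ξ => ∫ s in (0 : ℝ)..t, v s (ξ s))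
      = ∫ u in Set.Ioc 0 t, ∑ x, marginal (perturbedRate r g lam) (πl lam) u x * v u x := by
    intro lam
    have := (hπl lam).1
    simp only [expect, intervalIntegral.integral_of_le ht]
    exact integral_path_setIntegral _ _ hv hi
  simp_rw [h1, intervalIntegral.integral_of_le ht]
  refine hasDerivAt_zero_setIntegral measurableSet_Ioc (A := fun u => ∑ x, π.real {x} * v u x)
    (m := fun u => ∑ x, |v u x|) (K := B) hδ (fun lam => ?_) ?_
    (integrableOn_response_family hr hπ hg hi) ?_ fun lam hlam u hu => ?_
  · have := (hπl lam).1
    exact integrable_finsetSum _ fun x _ => integrableOn_marginal_mul _ _ (hi x) x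
  · exact integrable_finsetSum _ fun x _ => (hi x).const_mul _
  · exact integrable_finsetSum _ fun x _ => (hi x).abs
  · refine (((h lam hlam).2 _ (hπl lam) u hu.1.le (v u) _ (abs_le_sum_abs (v u))).2).trans_eq ?_
    ring

-- Perturbed and unperturbed rates differ by the factor `e^{λg}`, bounded for each `lam`.
-- Integrability of `α r` thus passes to the perturbed rates and the compensator formula applies.
omit [Nonempty 𝒳] hπ hT in
theorem integral_jumpSum_perturbed {α : ℝ → 𝒳 → 𝒳 → ℝ}
    (hα : ∀ x y, Measurable fun s => α s x y) {t : ℝ} (ht : 0 ≤ t)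
    (hi : ∀ x y, IntegrableOn (fun s => α s x y * r x y) (Set.Ioc 0 t)) (lam : ℝ) :
    HasExpect (perturbedRate r g lam) (πl lam) (jumpSum α t) ∧
    (∀ x y, IntegrableOn (fun s => α s x y * perturbedRate r g lam s x y) (Set.Ioc 0 t)) ∧
    expect (perturbedRate r g lam) (πl lam) (jumpSum α t)
      = ∫ u in Set.Ioc 0 t, ∑ x, marginal (perturbedRate r g lam) (πl lam) u x
        * ∑ y, α u x y * perturbedRate r g lam u x y := by
  have := (hπl lam).1
  have hq := hr.isAdmissible_perturbedRate hg.measurable hg.abs_le lam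
  have hi' : ∀ x y, IntegrableOn (fun s => α s x y * perturbedRate r g lam s x y)
      (Set.Ioc 0 t) := fun x y => by
    have h1 : (fun s => α s x y * perturbedRate r g lam s x y)
        = fun s => Real.exp (lam * g s x y) * (α s x y * r x y) := by
      funext s
      simp only [perturbedRate]
      ring
    rw [h1]
    refine (hi x y).bdd_mul (c := Real.exp (|lam| * G))
      (Real.measurable_exp.comp ((hg.measurable x y).const_mul lam)).aestronglyMeasurable
      (Eventually.of_forall fun s => ?_)
    rw [Real.norm_of_nonneg (Real.exp_pos _).le, Real.exp_le_exp]
    refine (le_abs_self _).trans ?_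
    rw [abs_mul]
    exact mul_le_mul_of_nonneg_left (hg.abs_le s x y) (abs_nonneg _)
  obtain ⟨h1, h2⟩ := hq.integral_jumpSum (πl lam) hα ht hi'
  refine ⟨h1, hi', ?_⟩
  simp only [expect]
  rw [h2]
  simp_rw [Finset.mul_sum]
  have h3 : ∀ x y, IntegrableOn (fun u => marginal (perturbedRate r g lam) (πl lam) u x
      * (α u x y * perturbedRate r g lam u x y)) (Set.Ioc 0 t) := fun x y =>
    integrableOn_marginal_mul _ _ (hi' x y) x
  rw [integral_finsetSum _ fun x _ => integrable_finsetSum _ fun y _ => h3 x y]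
  exact Finset.sum_congr rfl fun x _ => (integral_finsetSum _ fun y _ => h3 x y).symm

omit hr hπ hT hπl [Nonempty 𝒳] [MeasurableSpace 𝒳] [MeasurableSingletonClass 𝒳] in
theorem integrableOn_mul_perturbation {α : ℝ → 𝒳 → 𝒳 → ℝ} {s : Set ℝ}
    (hi : ∀ x y, IntegrableOn (fun s => α s x y * r x y) s) (x : 𝒳) :
    IntegrableOn (fun u => contract r (fun s x y => α s x y * g s x y) u x) s := by
  refine integrable_finsetSum _ fun y _ => ?_
  have h1 : (fun u => α u x y * g u x y * r x y) = fun u => g u x y * (α u x y * r x y) := by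
    funext u; ring
  rw [h1]
  exact (hi x y).bdd_mul (c := G) (hg.measurable x y).aestronglyMeasurable
    (Eventually.of_forall fun u => hg.abs_le u x y)

/-- The product rule under the time integral: the compensator contains the marginal, whose variation
is the response, and the rate `e^{λg} r`, whose variation brings down `g`. -/
theorem hasDerivAt_expect_jumpSum {α : ℝ → 𝒳 → 𝒳 → ℝ}
    (hα : ∀ x y, Measurable fun s => α s x y) {t : ℝ} (ht : 0 ≤ t)
    (hi : ∀ x y, IntegrableOn (fun s => α s x y * r x y) (Set.Ioc 0 t)) :
    HasDerivAt (fun lam => expect (perturbedRate r g lam) (πl lam) (jumpSum α t))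
      ((∫ s in (0 : ℝ)..t, ∑ x, π.real {x} * contract r (fun s x y => α s x y * g s x y) s x)
        + ∫ s in (0 : ℝ)..t, response r π g s (contract r α s)) 0 := by
  obtain ⟨B, δ, hB, hδ, h⟩ := exists_response_bound hr hπ hg hT
  have hG : 0 ≤ G := (abs_nonneg _).trans
    (hg.abs_le 0 (Classical.arbitrary 𝒳) (Classical.arbitrary 𝒳))
  have hJ := integral_jumpSum_perturbed hr hg hπl hα ht hi
  have hiv : ∀ x, IntegrableOn (fun s => contract r α s x) (Set.Ioc 0 t) := fun x =>
    integrable_finsetSum _ fun y _ => hi x y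
  have hiw : ∀ x, IntegrableOn (fun s => contract r (fun s x y => α s x y * g s x y) s x)
      (Set.Ioc 0 t) := integrableOn_mul_perturbation hg hi
  have hiπw : IntegrableOn (fun s => ∑ x, π.real {x}
      * contract r (fun s x y => α s x y * g s x y) s x) (Set.Ioc 0 t) :=
    integrable_finsetSum _ fun x _ => (hiw x).const_mul _
  have hires : IntegrableOn (fun s => response r π g s (contract r α s)) (Set.Ioc 0 t) :=
    integrableOn_response_family hr hπ hg hiv
  simp_rw [fun lam => (hJ lam).2.2, intervalIntegral.integral_of_le ht]
  rw [← integral_add hiπw hires]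
  -- The three errors in `K`: `B` is the second-order error of the marginals against `α_r`, `B * G`
  -- their first-order error against `lam (αg)_r`, and `G ^ 2` the quadratic remainder `z` of the
  -- exponential.
  refine hasDerivAt_zero_setIntegral measurableSet_Ioc
    (A := fun u => ∑ x, π.real {x} * contract r α u x)
    (m := fun u => ∑ x, ∑ y, |α u x y * r x y|) (K := B + B * G + G ^ 2) hδ (fun lam => ?_) ?_
    (hiπw.add hires) ?_ fun lam hlam u hu => ?_
  · have := (hπl lam).1
    exact integrable_finsetSum _ fun x _ => integrableOn_marginal_mul _ _
      (integrable_finsetSum _ fun y _ => (hJ lam).2.1 x y) x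
  · exact integrable_finsetSum _ fun x _ => (hiv x).const_mul _
  · exact integrable_finsetSum _ fun x _ => integrable_finsetSum _ fun y _ => (hi x y).abs
  · have := (hπl lam).1
    obtain ⟨hlamG, hb⟩ := h lam hlam
    set m := ∑ x, ∑ y, |α u x y * r x y|
    set p := marginal (perturbedRate r g lam) (πl lam) u
    have hrow : ∀ x, ∑ y, |α u x y * r x y| ≤ m := fun x =>
      Finset.single_le_sum (f := fun x => ∑ y, |α u x y * r x y|)
        (fun x _ => Finset.sum_nonneg fun y _ => abs_nonneg _) (Finset.mem_univ x)
    have hweight : ∀ (c : 𝒳 → 𝒳 → ℝ) (D : ℝ), 0 ≤ D → (∀ x y, |c x y| ≤ D) → ∀ x,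
        |∑ y, c x y * (α u x y * r x y)| ≤ D * m := fun c D hD hc x => by
      calc _ ≤ ∑ y, |c x y * (α u x y * r x y)| := Finset.abs_sum_le_sum_abs _ _
        _ ≤ ∑ y, D * |α u x y * r x y| := Finset.sum_le_sum fun y _ => by
            rw [abs_mul]
            exact mul_le_mul_of_nonneg_right (hc x y) (abs_nonneg _)
        _ = D * ∑ y, |α u x y * r x y| := by rw [Finset.mul_sum]
        _ ≤ D * m := mul_le_mul_of_nonneg_left (hrow x) hD
    have hv : ∀ x, |contract r α u x| ≤ m := fun x => by
      have := hweight (fun _ _ => 1) 1 zero_le_one (fun _ _ => by simp) x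
      simpa [contract] using this
    have hw : ∀ x, |contract r (fun s x y => α s x y * g s x y) u x| ≤ G * m := fun x => by
      have := hweight (g u) G hG (hg.abs_le u) x
      refine le_of_eq_of_le ?_ this
      congr 1
      exact Finset.sum_congr rfl fun y _ => by ring
    let z : 𝒳 → ℝ := fun x => ∑ y, (Real.exp (lam * g u x y) - 1 - lam * g u x y)
      * (α u x y * r x y)
    have hz : ∀ x, |z x| ≤ lam ^ 2 * G ^ 2 * m :=
      hweight _ _ (by positivity) (hg.abs_exp_sub_one_sub_le hlamG u)
    have h1 := (hb _ (hπl lam) u hu.1.le _ _ hv).2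
    have h2 := (hb _ (hπl lam) u hu.1.le _ _ hw).1
    have h3 := abs_sum_mul_le (marginal_nonneg (perturbedRate r g lam) (πl lam) u)
      (sum_marginal (perturbedRate r g lam) (πl lam) u) hz
    have hsplit : ∀ x, ∑ y, α u x y * perturbedRate r g lam u x y
        = contract r α u x + lam * contract r (fun s x y => α s x y * g s x y) u x + z x := by
      intro x
      simp only [contract, z, perturbedRate, Finset.mul_sum, ← Finset.sum_add_distrib]
      exact Finset.sum_congr rfl fun y _ => by ring
    have h4 : ∑ x, p x * ∑ y, α u x y * perturbedRate r g lam u x y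
        = ∑ x, p x * contract r α u x
          + lam * ∑ x, p x * contract r (fun s x y => α s x y * g s x y) u x
          + ∑ x, p x * z x := by
      simp_rw [hsplit, mul_add, Finset.sum_add_distrib, Finset.mul_sum]
      congr 2
      exact Finset.sum_congr rfl fun x _ => by ring
    have h5 : ∑ x, p x * ∑ y, α u x y * perturbedRate r g lam u x y
        - ∑ x, π.real {x} * contract r α u x
        - lam * (∑ x, π.real {x} * contract r (fun s x y => α s x y * g s x y) u x
          + response r π g u (contract r α u))
        = (∑ x, p x * contract r α u x - ∑ x, π.real {x} * contract r α u x
            - lam * response r π g u (contract r α u))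
          + lam * (∑ x, p x * contract r (fun s x y => α s x y * g s x y) u x
            - ∑ x, π.real {x} * contract r (fun s x y => α s x y * g s x y) u x)
          + ∑ x, p x * z x := by
      rw [h4]; ring
    have h6 := mul_le_mul_of_nonneg_left h2 (abs_nonneg lam)
    rw [← abs_mul] at h6
    rw [h5]
    refine (abs_add_three _ _ _).trans ((add_le_add (add_le_add h1 h6) h3).trans_eq ?_)
    have h7 : |lam| * (|lam| * B * (G * m)) = lam ^ 2 * B * (G * m) := by
      rw [← sq_abs lam]; ring
    rw [h7]
    ring

end LinearResponse

end MarkovJump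

/-! ### The linear response formulas -/

theorem mainTheorem5
    {𝒳 : Type*} [Fintype 𝒳] [Nonempty 𝒳] [MeasurableSpace 𝒳] [MeasurableSingletonClass 𝒳]
    (r : 𝒳 → 𝒳 → ℝ) (hr_nonneg : ∀ x y, 0 ≤ r x y) (hr_diag : ∀ x, r x x = 0)
    (hr_irred : ∀ x y, Relation.ReflTransGen (fun a b => 0 < r a b) x y)
    (T : ℝ) (hT : 0 < T)
    (g : ℝ → 𝒳 → 𝒳 → ℝ)
    (hg_per : ∀ x y, Function.Periodic (fun s => g s x y) T)
    (hg_meas : ∀ x y, Measurable fun s => g s x y)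
    (hg_bdd : ∃ C : ℝ, ∀ s x y, |g s x y| ≤ C) :
    -- the invariant distribution and the oscillatory steady states exist and are unique
    (∃! π : Measure 𝒳, IsInvariantDistribution r π) ∧
    (∀ lam : ℝ, ∃! μ : Measure 𝒳, IsOSS r g T lam μ) ∧
    ∀ (π : Measure 𝒳) (πl : ℝ → Measure 𝒳), IsInvariantDistribution r π →
      (∀ lam, IsOSS r g T lam (πl lam)) →
      ∀ t : ℝ, 0 ≤ t →
      -- (1) observables
      (∀ v : 𝒳 → ℝ,
        (∀ lam, HasExpect (perturbedRate r g lam) (πl lam)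
          (fun ξ => v (ξ t))) ∧
        IntegrableOn (fun s => scalarProd π
          (semigroup r s v) (psi r π g (t - s))) (Set.Ioi 0) ∧
        (∀ s, 0 ≤ s → HasExpect (fun _ => r) π
          (fun ξ => v (ξ s) * psi r π g (t - s) (ξ 0))) ∧
        IntegrableOn (fun s => expect (fun _ => r) π
          (fun ξ => v (ξ s) * psi r π g (t - s) (ξ 0))) (Set.Ioi 0) ∧
        HasDerivAt (fun lam => expect (perturbedRate r g lam) (πl lam)
            (fun ξ => v (ξ t)))
          (∫ s in Set.Ioi (0 : ℝ), scalarProd π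
            (semigroup r s v) (psi r π g (t - s))) 0 ∧
        (∫ s in Set.Ioi (0 : ℝ), scalarProd π
            (semigroup r s v) (psi r π g (t - s)))
          = ∫ s in Set.Ioi (0 : ℝ), expect (fun _ => r) π
              (fun ξ => v (ξ s) * psi r π g (t - s) (ξ 0))) ∧
      -- (2) time-integrated observables
      (∀ v : ℝ → 𝒳 → ℝ, (∀ x, Measurable fun s => v s x) →
        (∀ x, IntegrableOn (fun s => v s x) (Set.Icc 0 t)) →
        (∀ lam, HasExpect (perturbedRate r g lam) (πl lam)
          (fun ξ => ∫ s in (0 : ℝ)..t, v s (ξ s))) ∧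
        (∀ u, IntegrableOn (fun s => scalarProd π
          (semigroup r s (v u)) (psi r π g (u - s))) (Set.Ioi 0)) ∧
        IntervalIntegrable (fun u => ∫ s in Set.Ioi (0 : ℝ), scalarProd π
          (semigroup r s (v u)) (psi r π g (u - s)))
          volume 0 t ∧
        (∀ u s, 0 ≤ s → HasExpect (fun _ => r) π
          (fun ξ => v u (ξ s) * psi r π g (u - s) (ξ 0))) ∧
        (∀ u, IntegrableOn (fun s => expect (fun _ => r) π
          (fun ξ => v u (ξ s) * psi r π g (u - s) (ξ 0))) (Set.Ioi 0)) ∧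
        IntervalIntegrable (fun u => ∫ s in Set.Ioi (0 : ℝ), expect (fun _ => r) π
          (fun ξ => v u (ξ s) * psi r π g (u - s) (ξ 0)))
          volume 0 t ∧
        HasDerivAt (fun lam => expect (perturbedRate r g lam) (πl lam)
            (fun ξ => ∫ s in (0 : ℝ)..t, v s (ξ s)))
          (∫ u in (0 : ℝ)..t, ∫ s in Set.Ioi (0 : ℝ), scalarProd π
            (semigroup r s (v u)) (psi r π g (u - s))) 0 ∧
        (∫ u in (0 : ℝ)..t, ∫ s in Set.Ioi (0 : ℝ), scalarProd π
            (semigroup r s (v u)) (psi r π g (u - s)))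
          = ∫ u in (0 : ℝ)..t, ∫ s in Set.Ioi (0 : ℝ), expect (fun _ => r) π
              (fun ξ => v u (ξ s) * psi r π g (u - s) (ξ 0))) ∧
      -- (3) additive functionals of the jumps
      (∀ α : ℝ → 𝒳 → 𝒳 → ℝ, (∀ x y, Measurable fun s => α s x y) →
        IsPathIntegrable r π t α →
        (∀ lam, HasExpect (perturbedRate r g lam) (πl lam)
          (jumpSum α t)) ∧
        (∀ s, 0 ≤ s → HasExpect (fun _ => r) π
          (fun ξ => contract r (fun s x y => α s x y * g s x y) s (ξ s))) ∧
        IntervalIntegrable (fun s => expect (fun _ => r) π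
          (fun ξ => contract r (fun s x y => α s x y * g s x y) s (ξ s)))
          volume 0 t ∧
        (∀ s u, 0 ≤ u → HasExpect (fun _ => r) π
          (fun ξ => contract r α s (ξ u) * psi r π g (s - u) (ξ 0))) ∧
        (∀ s, IntegrableOn (fun u => expect (fun _ => r) π
          (fun ξ => contract r α s (ξ u) * psi r π g (s - u) (ξ 0)))
          (Set.Ioi 0)) ∧
        IntervalIntegrable (fun s => ∫ u in Set.Ioi (0 : ℝ), expect (fun _ => r) π
          (fun ξ => contract r α s (ξ u) * psi r π g (s - u) (ξ 0)))
          volume 0 t ∧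
        HasDerivAt (fun lam => expect (perturbedRate r g lam) (πl lam)
            (jumpSum α t))
          ((∫ s in (0 : ℝ)..t, expect (fun _ => r) π
              (fun ξ => contract r (fun s x y => α s x y * g s x y) s (ξ s)))
            + ∫ s in (0 : ℝ)..t, ∫ u in Set.Ioi (0 : ℝ), expect (fun _ => r) π
              (fun ξ => contract r α s (ξ u)
                * psi r π g (s - u) (ξ 0))) 0) := by
  have hr : IsIrreducibleRate r := ⟨hr_nonneg, hr_diag, hr_irred⟩
  obtain ⟨G, hG⟩ := hg_bdd
  have hg : IsPeriodicPerturbation g T G := ⟨hg_meas, hG, hg_per⟩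
  refine ⟨hr.existsUnique_isInvariantDistribution, existsUnique_isOSS hr hg hT, ?_⟩
  intro π πl hπ hπl t ht
  have := hπ.isProbabilityMeasure
  have hprob : ∀ lam, IsProbabilityMeasure (πl lam) := fun lam => (hπl lam).1
  obtain ⟨K, c, hdec⟩ := hr.exists_hasOscDecay
  refine ⟨fun v => ?_, fun v hv hvi => ?_, fun α hα hαi => ?_⟩
  · exact ⟨fun lam => integrable_path _ _ t v, integrableOn_response hr hπ hg hdec t v,
      fun s _ => integrable_two_time _ _ s v _, integrableOn_expect_two_time hr hπ hg v t,
      hasDerivAt_expect_path hr hπ hg hT hπl v ht, (setIntegral_expect_two_time hr hπ v t).symm⟩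
  · have hi : ∀ x, IntegrableOn (fun s => v s x) (Set.Ioc 0 t) := fun x =>
      (hvi x).mono_set Set.Ioc_subset_Icc_self
    have hres : IntervalIntegrable (fun u => response r π g u (v u)) volume 0 t :=
      (intervalIntegrable_iff_integrableOn_Ioc_of_le ht).2
        (integrableOn_response_family hr hπ hg hi)
    refine ⟨fun lam => ?_, fun u => integrableOn_response hr hπ hg hdec u (v u), hres,
      fun u s _ => integrable_two_time _ _ s (v u) _,
      fun u => integrableOn_expect_two_time hr hπ hg (v u) u, ?_,
      hasDerivAt_expect_integral hr hπ hg hT hπl hv ht hi, ?_⟩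
    · simp only [HasExpect, intervalIntegral.integral_of_le ht]
      exact (integrable_path_prod _ _ hv hi).integral_prod_left
    · simp_rw [setIntegral_expect_two_time hr hπ]
      exact hres
    · simp_rw [setIntegral_expect_two_time hr hπ]
      rfl
  · have hi := integrableOn_of_isPathIntegrable hr hπ hα ht hαi
    -- Stationarity of `π` removes the path from the first integral of the third formula; it is
    -- available only for nonnegative times, which suffices on `[0,t]`.
    have hexp : ∀ s, 0 ≤ s → expect (fun _ => r) π
        (fun ξ => contract r (fun s x y => α s x y * g s x y) s (ξ s))
        = ∑ x, π.real {x} * contract r (fun s x y => α s x y * g s x y) s x := fun s hs => by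
      simp only [expect]
      rw [integral_path _ _ s (contract r (fun s x y => α s x y * g s x y) s)]
      simp_rw [hπ.marginal_eq hs]
    refine ⟨fun lam => (integral_jumpSum_perturbed hr hg hπl hα ht hi lam).1,
      fun s _ => integrable_path _ _ s _, ?_, fun s u _ => integrable_two_time _ _ u _ _,
      fun s => integrableOn_expect_two_time hr hπ hg (contract r α s) s, ?_, ?_⟩
    · rw [intervalIntegrable_iff_integrableOn_Ioc_of_le ht]
      refine IntegrableOn.congr_fun (f := fun s => ∑ x, π.real {x}
        * contract r (fun s x y => α s x y * g s x y) s x) ?_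
        (fun s hs => (hexp s hs.1.le).symm) measurableSet_Ioc
      exact integrable_finsetSum _ fun x _ =>
        (integrableOn_mul_perturbation hg hi x).const_mul _
    · simp_rw [setIntegral_expect_two_time hr hπ]
      exact (intervalIntegrable_iff_integrableOn_Ioc_of_le ht).2
        (integrableOn_response_family hr hπ hg fun x =>
          integrable_finsetSum _ fun y _ => hi x y)
    · simp_rw [setIntegral_expect_two_time hr hπ]
      have h1 : ∫ s in (0 : ℝ)..t, expect (fun _ => r) π
          (fun ξ => contract r (fun s x y => α s x y * g s x y) s (ξ s))
          = ∫ s in (0 : ℝ)..t, ∑ x, π.real {x}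
            * contract r (fun s x y => α s x y * g s x y) s x := by
        refine intervalIntegral.integral_congr fun s hs => ?_
        rw [Set.uIcc_of_le ht] at hs
        exact hexp s hs.1
      rw [h1]
      exact hasDerivAt_expect_jumpSum hr hπ hg hT hπl hα ht hi
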